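/- **Setting.** Let $d<n$, let $\mathbb T^d=\mathbb R^d/(2\pi\mathbb Z)^d$, and for $\rho>0$ let $\mathbb T^d_\rho$ be the complex strip $\{|\mathrm{Im}\,\theta_j|<\rho,\ j=1,\dots,d\}$ around it. For a vector- or matrix-valued map $f$ on $\mathbb T^d_\rho$ let $\|f\|_\rho$ be the supremum over $\mathbb T^d_\rho$ of the moduli of its entries. Let $\mathcal U\subset\mathbb C^{2n}$ be open, and let $a:\mathcal U\to\mathbb C^{2n}$ and $G,J:\mathcal U\to\mathbb C^{2n\times 2n}$ be holomorphic and real at real points, such that $\Omega=(Da)^\top-Da$ is invertible on $\mathcal U$ and such that at real points $G$ is symmetric positive definite, $J^2=-I$ and $J^\top\Omega=G$ (a compatible triple with the exact symplectic form $\Omega$). Let $h(z;\lambda)$ be a family of Hamiltonians, continuous on $\mathcal U\times\mathcal O$ with $\mathcal O\subset\mathbb R^{n-d}$ open, and, for each $\lambda\in\mathcal O$, holomorphic in $z$ and real at real $z$. Let $X_h(z;\lambda)=\Omega(z)^{-1}(D_zh(z;\lambda))^\top$. Let $\omega\in\mathbb R^d$ and $\beta\in\mathbb R^{n-d}$ satisfy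 Diophantine–Melnikov conditions of type $(\gamma,\tau)$, with $\gamma>0$, $\tau>d-1$: $\beta_i\ne0$ for all $i$, $|\beta_i|\neq|\beta_j|$ for $i\ne j$, and for all $k\in\mathbb Z^d\setminus\{0\}$ one has $|k\cdot\omega|\ge\gamma|k|_1^{-\tau}$, $|k\cdot\omega-\beta_i|\ge\gamma|k|_1^{-\tau}$ for all $i$, and $|k\cdot\omega-\beta_i\pm\beta_j|\ge\gamma|k|_1^{-\tau}$ for all $i\ne j$. Write $\mathcal L_\omega u=-Du\cdot\omega$ and $$\Gamma_{\alpha,\beta}=\begin{pmatrix}\mathrm{diag}(\alpha)&-\mathrm{diag}(\beta)\\ \mathrm{diag}(\beta)&\mathrm{diag}(\alpha)\end{pmatrix}.$$ For analytic maps $K:\mathbb T^d_\rho\to\mathcal U$ and $W:\mathbb T^d_\rho\to\mathbb C^{2n\times2(n-d)}$, real at real points, and for $\lambda\in\mathcal O$, $\alpha\in\mathbb R^{n-d}$, the invariance errors are $$E_K=\mathcal L_\omega K+X_h\circ(K;\lambda),\qquad E_W=\mathcal L_\omega W+D_zX_h\circ(K;\lambda)\,W-W\,\Gamma_{\alpha,\beta}.$$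 Put $\mathcal X_V=\mathcal L_\omega V+D_zX_h\circ(K;\lambda)V$, $\Omega_{V_1V_2}=V_1^\top(\Omega\circ K)V_2$, $G_{V_1V_2}=V_1^\top(G\circ K)V_2$, and $$L=DK,\quad B=G_{LL}^{-1},\quad C=\Omega_{WW}^{-1}G_{WL}B,\quad A=\tfrac12C^\top\Omega_{WW}C,\quad N=LA+(J\circ K)LB+WC,$$ $$P=(L\ \ N\ \ W),\qquad T=N^\top(\Omega\circ K)\,\mathcal X_N,\qquad \Lambda=\begin{pmatrix}O&T&O\\O&O&O\\O&O&\Gamma_{0,\beta}\end{pmatrix}.$$ **Lemma.** Let $Z\subset\mathcal U$ and $Q\subset\mathcal O$ be compact, let $0<\rho'<\rho$ and $M\ge0$. There are $\varepsilon>0$ and $C_0\ge0$, depending only on the data above, on $Z,Q,\rho,\rho',M$ and on $\omega,\beta,\gamma,\tau$, such that the following holds for all $K,W,\lambda,\alpha$ as above with $K(\mathbb T^d_\rho)\subset Z$, $\lambda\in Q$, $\|W\|_\rho\le M$, and $G_{LL}$ and $\Omega_{WW}$ invertible on $\mathbb T^d_\rho$ with $\|G_{LL}^{-1}\|_\rho\le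 M$ and $\|\Omega_{WW}^{-1}\|_\rho\le M$. If $\|E_K\|_\rho\le\varepsilon$ and $\|E_W\|_\rho\le\varepsilon$, then $P(\theta)$ is invertible for every $\theta\in\mathbb T^d_{\rho'}$, and $$\bigl\|P^{-1}\bigl(\mathcal L_\omega P+D_zX_h\circ(K;\lambda)\,P\bigr)-\Lambda\bigr\|_{\rho'}\le C_0\bigl(\|E_K\|_\rho+\|E_W\|_\rho\bigr).$$ -/

import Mathlib

open scoped Matrix NNReal ENNReal

noncomputable section

namespace EllipticTorus

/-! ### Analytic functions on complex strips around the torus -/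

/-- The real point `x`, seen as a point of complex space. -/
def complexify {k : ℕ} (x : Fin k → ℝ) : Fin k → ℂ := fun j => (x j : ℂ)

/-- The complex strip of width `ρ` around `ℝ^d` (the universal cover of the complexified torus). -/
def strip (d : ℕ) (ρ : ℝ) : Set (Fin d → ℂ) := {θ | ∀ j, |(θ j).im| < ρ}

/-- `f` is a real-analytic function on the torus `(ℝ/2πℤ)^d`, with a holomorphic extension to the
strip of width `ρ`. -/
structure IsTorusAnalytic {d : ℕ} (ρ : ℝ) (f : (Fin d → ℂ) → ℂ) : Prop where
  holomorphic : DifferentiableOn ℂ f (strip d ρ)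
  periodic : ∀ θ ∈ strip d ρ, ∀ j, f (θ + Pi.single j ((2 * Real.pi : ℝ) : ℂ)) = f θ
  real : ∀ x : Fin d → ℝ, (f (complexify x)).im = 0

/-- Supremum norm over the strip of width `ρ` of a vector-valued map. -/
def stripNorm {d : ℕ} {κ : Type} (ρ : ℝ) (f : (Fin d → ℂ) → κ → ℂ) : ℝ≥0∞ :=
  ⨆ θ ∈ strip d ρ, ⨆ r, ‖f θ r‖ₑ

/-- Supremum norm over the strip of width `ρ` of a matrix-valued map. -/
def stripMatrixNorm {d : ℕ} {κ κ' : Type} (ρ : ℝ) (f : (Fin d → ℂ) → Matrix κ κ' ℂ) : ℝ≥0∞ :=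
  ⨆ θ ∈ strip d ρ, ⨆ r, ⨆ s, ‖f θ r s‖ₑ

/-! ### Derivatives -/

/-- The Jacobian matrix `(Df)_{r j} = ∂_j f_r`. -/
def jacobian {k : ℕ} {κ : Type} (f : (Fin k → ℂ) → κ → ℂ) (z : Fin k → ℂ) :
    Matrix κ (Fin k) ℂ :=
  Matrix.of fun r j => fderiv ℂ (fun w => f w r) z (Pi.single j 1)

/-- The Lie derivative `L_ω u = - Du · ω` of a vector-valued map. -/
def lieVec {d : ℕ} {κ : Type} (ω : Fin d → ℝ) (u : (Fin d → ℂ) → κ → ℂ) (θ : Fin d → ℂ) :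
    κ → ℂ :=
  fun r => - fderiv ℂ (fun η => u η r) θ (complexify ω)

/-- The Lie derivative `L_ω V = - DV · ω` of a matrix-valued map. -/
def lieMat {d : ℕ} {κ κ' : Type} (ω : Fin d → ℝ) (V : (Fin d → ℂ) → Matrix κ κ' ℂ)
    (θ : Fin d → ℂ) : Matrix κ κ' ℂ :=
  Matrix.of fun r s => - fderiv ℂ (fun η => V η r s) θ (complexify ω)

/-! ### Symplectic setting -/

/-- The matrix `Ω = (Da)ᵀ - Da` of the exact two-form `dα`, where `α = ∑ a_i dz_i`. -/
def symplecticMatrix {n : ℕ} (a : (Fin (2 * n) → ℂ) → (Fin (2 * n) → ℂ))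
    (z : Fin (2 * n) → ℂ) : Matrix (Fin (2 * n)) (Fin (2 * n)) ℂ :=
  (jacobian a z)ᵀ - jacobian a z

/-- A real-analytic exact symplectic form `dα`, with a compatible metric `G` and almost-complex
structure `J`, on the real points of `U`; all of them extend holomorphically to the open set
`U` of complex space, and the symplectic form stays non-degenerate there. -/
structure SymplecticSetting (n : ℕ) where
  U : Set (Fin (2 * n) → ℂ)
  isOpen_U : IsOpen U
  a : (Fin (2 * n) → ℂ) → (Fin (2 * n) → ℂ)
  G : (Fin (2 * n) → ℂ) → Matrix (Fin (2 * n)) (Fin (2 * n)) ℂ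
  J : (Fin (2 * n) → ℂ) → Matrix (Fin (2 * n)) (Fin (2 * n)) ℂ
  a_holomorphic : DifferentiableOn ℂ a U
  G_holomorphic : ∀ r s, DifferentiableOn ℂ (fun z => G z r s) U
  J_holomorphic : ∀ r s, DifferentiableOn ℂ (fun z => J z r s) U
  det_ne_zero : ∀ z ∈ U, (symplecticMatrix a z).det ≠ 0
  a_real : ∀ x : Fin (2 * n) → ℝ, complexify x ∈ U → ∀ r, (a (complexify x) r).im = 0
  G_real : ∀ x : Fin (2 * n) → ℝ, complexify x ∈ U → ∀ r s, (G (complexify x) r s).im = 0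
  J_real : ∀ x : Fin (2 * n) → ℝ, complexify x ∈ U → ∀ r s, (J (complexify x) r s).im = 0
  /-- `G` is a Riemannian metric: symmetric and positive definite at real points. -/
  G_posDef : ∀ x : Fin (2 * n) → ℝ, complexify x ∈ U →
    ((G (complexify x)).map Complex.re).PosDef
  /-- `J² = -I`. -/
  J_sq : ∀ x : Fin (2 * n) → ℝ, complexify x ∈ U →
    J (complexify x) * J (complexify x) = -1
  /-- Compatibility: `Ω(J u, v) = G(u, v)`. -/
  compatible : ∀ x : Fin (2 * n) → ℝ, complexify x ∈ U →
    (J (complexify x))ᵀ * symplecticMatrix a (complexify x) = G (complexify x)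

/-- The matrix `Ω(z)` of the symplectic form. -/
def SymplecticSetting.Ω {n : ℕ} (S : SymplecticSetting n) (z : Fin (2 * n) → ℂ) :
    Matrix (Fin (2 * n)) (Fin (2 * n)) ℂ :=
  symplecticMatrix S.a z

/-- A family of real-analytic Hamiltonians `h(z; λ)` on `U`, depending on a parameter `λ` in an
open subset of `ℝ^m`. -/
structure HamiltonianFamily {n : ℕ} (S : SymplecticSetting n) (m : ℕ) where
  Par : Set (Fin m → ℝ)
  isOpen_Par : IsOpen Par
  h : (Fin (2 * n) → ℂ) → (Fin m → ℝ) → ℂ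
  continuousOn : ContinuousOn (fun p : (Fin (2 * n) → ℂ) × (Fin m → ℝ) => h p.1 p.2) (S.U ×ˢ Par)
  holomorphic : ∀ lam ∈ Par, DifferentiableOn ℂ (fun z => h z lam) S.U
  real : ∀ lam ∈ Par, ∀ x : Fin (2 * n) → ℝ, complexify x ∈ S.U → (h (complexify x) lam).im = 0

/-- The Hamiltonian vector field `X_h(z; λ) = Ω(z)⁻¹ (D_z h(z; λ))ᵀ`. -/
def HamiltonianFamily.X {n m : ℕ} {S : SymplecticSetting n} (H : HamiltonianFamily S m)
    (lam : Fin m → ℝ) (z : Fin (2 * n) → ℂ) : Fin (2 * n) → ℂ :=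
  (S.Ω z)⁻¹ *ᵥ fun s => fderiv ℂ (fun w => H.h w lam) z (Pi.single s 1)

/-! ### Frequencies and the normal form matrices -/

/-- The Diophantine-Melnikov conditions of type `(γ, τ)` on `(ω, β)`. -/
structure DiophantineMelnikov {d m : ℕ} (γ τ : ℝ) (ω : Fin d → ℝ) (β : Fin m → ℝ) : Prop where
  γ_pos : 0 < γ
  lt_τ : (d : ℝ) - 1 < τ
  β_ne_zero : ∀ i, β i ≠ 0
  abs_β_ne : ∀ i j, i ≠ j → |β i| ≠ |β j|
  diophantine : ∀ k : Fin d → ℤ, k ≠ 0 →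
    γ / (∑ l, |(k l : ℝ)|) ^ τ ≤ |∑ l, (k l : ℝ) * ω l|
  melnikov_first : ∀ k : Fin d → ℤ, k ≠ 0 → ∀ i,
    γ / (∑ l, |(k l : ℝ)|) ^ τ ≤ |(∑ l, (k l : ℝ) * ω l) - β i|
  melnikov_second_add : ∀ k : Fin d → ℤ, k ≠ 0 → ∀ i j, i ≠ j →
    γ / (∑ l, |(k l : ℝ)|) ^ τ ≤ |(∑ l, (k l : ℝ) * ω l) - β i + β j|
  melnikov_second_sub : ∀ k : Fin d → ℤ, k ≠ 0 → ∀ i j, i ≠ j →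
    γ / (∑ l, |(k l : ℝ)|) ^ τ ≤ |(∑ l, (k l : ℝ) * ω l) - β i - β j|

/-- `Γ_{α,β} = ((diag α, -diag β), (diag β, diag α))`. -/
def Gam {m : ℕ} (α β : Fin m → ℝ) : Matrix (Fin m ⊕ Fin m) (Fin m ⊕ Fin m) ℂ :=
  Matrix.fromBlocks (Matrix.diagonal (complexify α)) (-Matrix.diagonal (complexify β))
    (Matrix.diagonal (complexify β)) (Matrix.diagonal (complexify α))

/-! ### Invariance errors and the reducibility frame -/

section Frame

variable {d n m : ℕ}

/-- `V₁ᵀ (M ∘ K) V₂`; for `M = Ω` and `M = G` this is `Ω_{V₁V₂}` and `G_{V₁V₂}`. -/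
def pull {κ₁ κ₂ : Type} (M : (Fin (2 * n) → ℂ) → Matrix (Fin (2 * n)) (Fin (2 * n)) ℂ)
    (K : (Fin d → ℂ) → (Fin (2 * n) → ℂ))
    (V₁ : (Fin d → ℂ) → Matrix (Fin (2 * n)) κ₁ ℂ)
    (V₂ : (Fin d → ℂ) → Matrix (Fin (2 * n)) κ₂ ℂ) (θ : Fin d → ℂ) : Matrix κ₁ κ₂ ℂ :=
  (V₁ θ)ᵀ * M (K θ) * V₂ θ

/-- The operator `𝒳_V = L_ω V + D_z X_h ∘ (K; λ) V`. -/
def linOp {κ : Type} {S : SymplecticSetting n} (H : HamiltonianFamily S m) (ω : Fin d → ℝ)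
    (K : (Fin d → ℂ) → (Fin (2 * n) → ℂ)) (lam : Fin m → ℝ)
    (V : (Fin d → ℂ) → Matrix (Fin (2 * n)) κ ℂ) (θ : Fin d → ℂ) :
    Matrix (Fin (2 * n)) κ ℂ :=
  lieMat ω V θ + jacobian (H.X lam) (K θ) * V θ

/-- The invariance error `E_K = L_ω K + X_h ∘ (K; λ)` of the torus. -/
def errK {S : SymplecticSetting n} (H : HamiltonianFamily S m) (ω : Fin d → ℝ)
    (K : (Fin d → ℂ) → (Fin (2 * n) → ℂ)) (lam : Fin m → ℝ) (θ : Fin d → ℂ) :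
    Fin (2 * n) → ℂ :=
  lieVec ω K θ + H.X lam (K θ)

/-- The invariance error `E_W = L_ω W + D_z X_h ∘ (K; λ) W - W Γ_{α,β}` of the normal bundle. -/
def errW {S : SymplecticSetting n} (H : HamiltonianFamily S m) (ω : Fin d → ℝ)
    (β : Fin m → ℝ) (K : (Fin d → ℂ) → (Fin (2 * n) → ℂ))
    (W : (Fin d → ℂ) → Matrix (Fin (2 * n)) (Fin m ⊕ Fin m) ℂ) (lam α : Fin m → ℝ)
    (θ : Fin d → ℂ) : Matrix (Fin (2 * n)) (Fin m ⊕ Fin m) ℂ :=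
  linOp H ω K lam W θ - W θ * Gam α β

/-- `B = G_{LL}⁻¹`, with `L = DK`. -/
def frameB (S : SymplecticSetting n) (K : (Fin d → ℂ) → (Fin (2 * n) → ℂ)) (θ : Fin d → ℂ) :
    Matrix (Fin d) (Fin d) ℂ :=
  (pull S.G K (jacobian K) (jacobian K) θ)⁻¹

/-- `C = Ω_{WW}⁻¹ G_{WL} B`. -/
def frameC (S : SymplecticSetting n) (K : (Fin d → ℂ) → (Fin (2 * n) → ℂ))
    (W : (Fin d → ℂ) → Matrix (Fin (2 * n)) (Fin m ⊕ Fin m) ℂ) (θ : Fin d → ℂ) :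
    Matrix (Fin m ⊕ Fin m) (Fin d) ℂ :=
  (pull S.Ω K W W θ)⁻¹ * pull S.G K W (jacobian K) θ * frameB S K θ

/-- `A = ½ Cᵀ Ω_{WW} C`. -/
def frameA (S : SymplecticSetting n) (K : (Fin d → ℂ) → (Fin (2 * n) → ℂ))
    (W : (Fin d → ℂ) → Matrix (Fin (2 * n)) (Fin m ⊕ Fin m) ℂ) (θ : Fin d → ℂ) :
    Matrix (Fin d) (Fin d) ℂ :=
  (1 / 2 : ℂ) • ((frameC S K W θ)ᵀ * pull S.Ω K W W θ * frameC S K W θ)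

/-- `N = L A + (J ∘ K) L B + W C`. -/
def frameN (S : SymplecticSetting n) (K : (Fin d → ℂ) → (Fin (2 * n) → ℂ))
    (W : (Fin d → ℂ) → Matrix (Fin (2 * n)) (Fin m ⊕ Fin m) ℂ) (θ : Fin d → ℂ) :
    Matrix (Fin (2 * n)) (Fin d) ℂ :=
  jacobian K θ * frameA S K W θ + S.J (K θ) * jacobian K θ * frameB S K θ
    + W θ * frameC S K W θ

/-- The frame `P = (L N W)`. -/
def frameP (S : SymplecticSetting n) (K : (Fin d → ℂ) → (Fin (2 * n) → ℂ))
    (W : (Fin d → ℂ) → Matrix (Fin (2 * n)) (Fin m ⊕ Fin m) ℂ) (θ : Fin d → ℂ) :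
    Matrix (Fin (2 * n)) (Fin d ⊕ (Fin d ⊕ (Fin m ⊕ Fin m))) ℂ :=
  Matrix.fromCols (jacobian K θ) (Matrix.fromCols (frameN S K W θ) (W θ))

/-- The torsion matrix `T = Nᵀ (Ω ∘ K) 𝒳_N`. -/
def torsion {S : SymplecticSetting n} (H : HamiltonianFamily S m) (ω : Fin d → ℝ)
    (K : (Fin d → ℂ) → (Fin (2 * n) → ℂ))
    (W : (Fin d → ℂ) → Matrix (Fin (2 * n)) (Fin m ⊕ Fin m) ℂ) (lam : Fin m → ℝ)
    (θ : Fin d → ℂ) : Matrix (Fin d) (Fin d) ℂ :=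
  pull S.Ω K (frameN S K W) (linOp H ω K lam (frameN S K W)) θ

/-- The block matrix `Λ = ((0, T, 0), (0, 0, 0), (0, 0, Γ_{0,β}))`. -/
def reducedMatrix {S : SymplecticSetting n} (H : HamiltonianFamily S m) (ω : Fin d → ℝ)
    (β : Fin m → ℝ) (K : (Fin d → ℂ) → (Fin (2 * n) → ℂ))
    (W : (Fin d → ℂ) → Matrix (Fin (2 * n)) (Fin m ⊕ Fin m) ℂ) (lam : Fin m → ℝ)
    (θ : Fin d → ℂ) :
    Matrix (Fin d ⊕ (Fin d ⊕ (Fin m ⊕ Fin m))) (Fin d ⊕ (Fin d ⊕ (Fin m ⊕ Fin m))) ℂ :=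
  Matrix.fromBlocks 0 (Matrix.fromCols (torsion H ω K W lam θ) 0)
    0 (Matrix.fromBlocks 0 0 0 (Gam 0 β))

end Frame

end EllipticTorus

end

open EllipticTorus

noncomputable section

namespace EllipticTorus

open Filter Topology Metric Set MeasureTheory

/-! ### Holomorphic functions of several complex variables -/

section SeveralVariables

variable {k : ℕ} {U : Set (Fin k → ℂ)} {f : (Fin k → ℂ) → ℂ}

/-! The Hamiltonian flow preserves the symplectic form, so `Ω`-products along an approximately
invariant torus satisfy an approximate transport equation: L_ω(V₁ᵀΩV₂) equals 𝒳_{V₁}ᵀΩV₂ +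
V₁ᵀΩ𝒳_{V₂} plus a term linear in E_K (`lieMat_pull_Ω`). Here 𝒳_L = DE_K and 𝒳_W = WΓ + E_W. After
the constant change of frame V that diagonalizes Γ, every entry u of Ω_LL, Ω_LV and Ω_VV solves
-Du·ω - μu = O(err), with μ a sum of eigenvalues (`pull_Ω_equation`). The Fourier divisors are, up
to sign, ik·ω + μ. The Diophantine and Melnikov conditions bound the imaginary parts that occur from
below, whatever α is, so u is O(err)-close to its average c and μc = O(err)
(`exists_small_divisor_bound`).

The averages need separate reasons. For Ω_LL the average is zero, because the pull-back of an exact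
form is exact. For Ω_LV, and for entries of Ω_VV with different frequency indices, Im μ is a fixed
nonzero number, so c = O(err). For a conjugate pair, μ = 2α_j, and c cannot be small, since Ω_WW has
a bounded inverse while the rest of that row of Ω_VV is small; hence α_j itself is O(err)
(`α_small`). This is why Γ_{0,β} may replace Γ_{α,β}.

N is built so that Ω_NL = 1, Ω_NW = 0 and Ω_NN = 0 hold modulo terms containing Ω_LL, Ω_LW or Ω_WL
(`FrameRelations`). Thus NᵀΩ, -LᵀΩ and Ω_WW⁻¹WᵀΩ are the rows of an approximate left inverse of P.
Applied to 𝒳_P it gives Λ up to O(err): T is one of the blocks by definition, and LᵀΩ𝒳_N and WᵀΩ𝒳_N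
are small by differentiating Ω_LN ≈ -1 and Ω_WN ≈ 0. Inverting a small perturbation of the identity
then yields the true inverse (`exists_reducibility_bound`).

Each Cauchy or small divisor estimate loses some width of the strip. `LocO` asks for a bound on
every smaller strip, uniform over the index type (in the application, `ApproxTorus`), so these
losses need no bookkeeping. -/

lemma hasDerivAt_line {z v : Fin k → ℂ} {t : ℂ} (hf : DifferentiableAt ℂ f (z + t • v)) :
    HasDerivAt (fun s : ℂ => f (z + s • v)) (fderiv ℂ f (z + t • v) v) t := by
  have h : HasDerivAt (fun s : ℂ => z + s • v) v t := by
    simpa using ((hasDerivAt_id t).smul_const v).const_add z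
  exact hf.hasFDerivAt.comp_hasDerivAt t h

lemma differentiableOn_line (hU : IsOpen U) (hf : DifferentiableOn ℂ f U) (z v : Fin k → ℂ) :
    DifferentiableOn ℂ (fun s : ℂ => f (z + s • v)) {s | z + s • v ∈ U} := fun _ hs =>
  (hasDerivAt_line ((hf _ hs).differentiableAt (hU.mem_nhds hs))).differentiableAt.differentiableWithinAt

/-- Cauchy's estimate for a directional derivative. -/
lemma norm_fderiv_apply_le (hU : IsOpen U) (hf : DifferentiableOn ℂ f U) {z v : Fin k → ℂ}
    {δ B : ℝ} (hδ : 0 < δ) (hz : ∀ t : ℂ, ‖t‖ ≤ δ → z + t • v ∈ U ∧ ‖f (z + t • v)‖ ≤ B) :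
    ‖fderiv ℂ f z v‖ ≤ B / δ := by
  have h0 := (hz 0 (by simpa using hδ.le)).1
  have hd := hasDerivAt_line (z := z) (v := v) (t := 0)
    ((hf _ h0).differentiableAt (hU.mem_nhds h0))
  have hd' : deriv (fun s : ℂ => f (z + s • v)) 0 = fderiv ℂ f z v := by
    rw [hd.deriv]; simp
  rw [← hd']
  refine Complex.norm_deriv_le_of_forall_mem_sphere_norm_le hδ ?_ fun t ht =>
    (hz t (by simpa using (mem_sphere_zero_iff_norm.1 ht).le)).2
  refine DifferentiableOn.diffContOnCl ?_
  rw [closure_ball _ hδ.ne']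
  exact (differentiableOn_line hU hf z v).mono fun t ht => (hz t (by simpa using ht)).1

lemma norm_fderiv_le (hU : IsOpen U) (hf : DifferentiableOn ℂ f U) {z : Fin k → ℂ}
    {δ B : ℝ} (hδ : 0 < δ) (hz : ∀ w ∈ closedBall z δ, w ∈ U ∧ ‖f w‖ ≤ B) :
    ‖fderiv ℂ f z‖ ≤ B / δ := by
  have hB : 0 ≤ B := (norm_nonneg _).trans (hz z (mem_closedBall_self hδ.le)).2
  refine ContinuousLinearMap.opNorm_le_bound _ (by positivity) fun v => ?_
  rcases eq_or_ne v 0 with rfl | hv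
  · simp
  have hv' : 0 < ‖v‖ := norm_pos_iff.2 hv
  have := norm_fderiv_apply_le hU hf (z := z) (v := v) (δ := δ / ‖v‖) (B := B) (by positivity)
    fun t ht => hz _ (by
      rw [mem_closedBall, dist_eq_norm, add_sub_cancel_left, norm_smul]
      rwa [le_div_iff₀ hv'] at ht)
  refine this.trans (le_of_eq ?_)
  field_simp

/-- The directional derivatives of a holomorphic function are holomorphic. -/
lemma differentiableOn_fderiv_apply (hU : IsOpen U) (hf : DifferentiableOn ℂ f U)
    (v : Fin k → ℂ) : DifferentiableOn ℂ (fun z => fderiv ℂ f z v) U := by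
  intro z₀ hz₀
  refine DifferentiableAt.differentiableWithinAt ?_
  obtain ⟨δ, hδ, hδU⟩ : ∃ δ > 0, closedBall z₀ δ ⊆ U :=
    nhds_basis_closedBall.mem_iff.1 (hU.mem_nhds hz₀)
  obtain ⟨B, hB⟩ := (isCompact_closedBall z₀ δ).exists_bound_of_continuousOn
    (hf.continuousOn.mono hδU)
  -- With this radius, a circle in direction `v` around a point within `δ / 3` of `z₀` stays within
  -- `2 * δ / 3`, which leaves `δ / 3` for Cauchy's bound on the derivative. The `+ 1` covers `v =
  -- 0`.
  set R : ℝ := δ / (3 * (‖v‖ + 1)) with hR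
  have hv : 0 ≤ ‖v‖ := norm_nonneg v
  have hRpos : 0 < R := by positivity
  have hRv : R * ‖v‖ ≤ δ / 3 := by
    rw [hR, div_mul_eq_mul_div, div_le_div_iff₀ (by positivity) (by norm_num)]
    nlinarith
  have hmem : ∀ z ∈ ball z₀ (δ / 3), ∀ t : ℂ, ‖t‖ ≤ R → z + t • v ∈ ball z₀ (2 * δ / 3) := by
    intro z hz t ht
    rw [mem_ball, dist_eq_norm] at hz ⊢
    calc ‖z + t • v - z₀‖ = ‖(z - z₀) + t • v‖ := by congr 1; abel
      _ ≤ ‖z - z₀‖ + ‖t • v‖ := norm_add_le _ _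
      _ ≤ ‖z - z₀‖ + R * ‖v‖ := by rw [norm_smul]; gcongr
      _ < 2 * δ / 3 := by linarith
  have hbig : ball z₀ (2 * δ / 3) ⊆ U :=
    (ball_subset_closedBall.trans (closedBall_subset_closedBall (by linarith))).trans hδU
  have hcirc : ∀ t : ℝ, ‖circleMap 0 R t‖ ≤ R := fun t => by simp [abs_of_pos hRpos]
  have hcirc0 : ∀ t : ℝ, circleMap 0 R t ≠ 0 := fun t => by
    simpa using circleMap_ne_center (c := 0) hRpos.ne' (θ := t)
  have hbd : ∀ w ∈ ball z₀ (2 * δ / 3), ‖fderiv ℂ f w‖ ≤ B / (δ / 3) := fun w hw =>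
    norm_fderiv_le hU hf (by positivity) fun y hy => by
      have : y ∈ closedBall z₀ δ := by
        rw [mem_closedBall] at hy ⊢
        rw [mem_ball] at hw
        linarith [dist_triangle y w z₀]
      exact ⟨hδU this, hB y this⟩
  -- Cauchy's kernel `dt / t²`, parametrized by the angle. Near `z₀` the derivative in direction `v`
  -- is `1 / (2πi)` times the integral of `q` against `f`, and this integral can be differentiated
  -- in `z` under the sign.
  let q : ℝ → ℂ := fun t => deriv (circleMap 0 R) t * ((circleMap 0 R t) ^ 2)⁻¹
  have hq : Continuous q := by
    have h1 : Continuous (deriv (circleMap 0 R)) := by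
      have : deriv (circleMap 0 R) = fun t => circleMap 0 R t * Complex.I := by
        ext t; simp [deriv_circleMap]
      rw [this]; fun_prop
    exact h1.mul (((continuous_circleMap 0 R).pow 2).inv₀ fun t => pow_ne_zero 2 (hcirc0 t))
  obtain ⟨Cq, hCq⟩ := (isCompact_Icc (a := (0 : ℝ)) (b := 2 * Real.pi)).exists_bound_of_continuousOn
    hq.continuousOn
  have hcont : ∀ z ∈ ball z₀ (δ / 3), Continuous fun t : ℝ => q t * f (z + circleMap 0 R t • v) := by
    intro z hz
    refine hq.mul ?_
    have h1 : Continuous fun t : ℝ => z + circleMap 0 R t • v := by fun_prop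
    exact hf.continuousOn.comp_continuous h1 fun t => hbig (hmem z hz _ (hcirc t))
  have key := intervalIntegral.hasFDerivAt_integral_of_dominated_of_fderiv_le (𝕜 := ℂ)
    (μ := volume) (a := 0) (b := 2 * Real.pi) (s := ball z₀ (δ / 3)) (x₀ := z₀)
    (F := fun z t => q t * f (z + circleMap 0 R t • v))
    (F' := fun z t => q t • fderiv ℂ f (z + circleMap 0 R t • v))
    (bound := fun _ => Cq * (B / (δ / 3)))
    (ball_mem_nhds _ (by positivity))
    (by
      filter_upwards [ball_mem_nhds z₀ (show 0 < δ / 3 by positivity)] with z hz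
      exact (hcont z hz).aestronglyMeasurable)
    ((hcont z₀ (mem_ball_self (by positivity))).intervalIntegrable _ _)
    (by
      refine AEStronglyMeasurable.smul hq.aestronglyMeasurable ?_
      have h1 : Measurable fun t : ℝ => z₀ + circleMap 0 R t • v :=
        Continuous.measurable (by fun_prop)
      exact ((measurable_fderiv ℂ f).comp h1).stronglyMeasurable.aestronglyMeasurable)
    (by
      refine Eventually.of_forall fun t ht z hz => ?_
      rw [norm_smul]
      have ht' : t ∈ Icc (0 : ℝ) (2 * Real.pi) := by
        rw [uIoc_of_le (by positivity)] at ht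
        exact Ioc_subset_Icc_self ht
      have := hCq t ht'
      have h2 := hbd _ (hmem z hz _ (hcirc t))
      gcongr
      exact (norm_nonneg _).trans this)
    intervalIntegrable_const
    (by
      refine Eventually.of_forall fun t _ z hz => ?_
      have hw := hbig (hmem z hz _ (hcirc t))
      have h1 := ((hf _ hw).differentiableAt (hU.mem_nhds hw)).hasFDerivAt
      have h2 : HasFDerivAt (fun z => f (z + circleMap 0 R t • v))
          (fderiv ℂ f (z + circleMap 0 R t • v)) z := by
        have h3 := h1.comp z ((hasFDerivAt_id z).add_const (circleMap 0 R t • v))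
        rw [ContinuousLinearMap.comp_id] at h3
        exact h3
      exact h2.const_mul (q t))
  have heq : (fun z => fderiv ℂ f z v) =ᶠ[𝓝 z₀] fun z =>
      (2 * Real.pi * Complex.I : ℂ)⁻¹ *
        ∫ t in (0 : ℝ)..2 * Real.pi, q t * f (z + circleMap 0 R t • v) := by
    filter_upwards [ball_mem_nhds z₀ (show 0 < δ / 3 by positivity)] with z hz
    have hz0 : z ∈ U := hbig (by simpa using hmem z hz 0 (by simpa using hRpos.le))
    have hd := hasDerivAt_line (z := z) (v := v) (t := 0)
      (by simpa using (hf _ hz0).differentiableAt (hU.mem_nhds hz0))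
    have h3 := Complex.two_pi_I_inv_smul_circleIntegral_sub_sq_inv_smul_of_differentiable
      (U := {s : ℂ | z + s • v ∈ U}) (c := 0) (w₀ := 0) (R := R)
      (f := fun s : ℂ => f (z + s • v))
      (hU.preimage (by fun_prop)) (fun t ht => hbig (hmem z hz t (by simpa using ht)))
      (differentiableOn_line hU hf z v) (mem_ball_self hRpos)
    rw [hd.deriv] at h3
    simp only [zero_smul, add_zero, sub_zero, smul_eq_mul] at h3
    rw [← h3, circleIntegral]
    congr 1
    refine intervalIntegral.integral_congr fun t _ => ?_
    simp only [q, smul_eq_mul, mul_assoc]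
  exact (key.differentiableAt.const_mul _).congr_of_eventuallyEq heq

lemma fderiv_eq_sum (L : (Fin k → ℂ) →L[ℂ] ℂ) :
    L = ∑ j, L (Pi.single j 1) • (ContinuousLinearMap.proj j : (Fin k → ℂ) →L[ℂ] ℂ) := by
  ext v
  conv_lhs => rw [pi_eq_sum_univ' v]
  simp [map_sum, mul_comm]

lemma clm_apply_eq_sum (L : (Fin k → ℂ) →L[ℂ] ℂ) (v : Fin k → ℂ) :
    L v = ∑ j, L (Pi.single j 1) * v j := by
  conv_lhs => rw [fderiv_eq_sum L]
  simp

lemma differentiableOn_fderiv (hU : IsOpen U) (hf : DifferentiableOn ℂ f U) :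
    DifferentiableOn ℂ (fderiv ℂ f) U := by
  have : fderiv ℂ f = fun z => ∑ j, fderiv ℂ f z (Pi.single j 1) •
      (ContinuousLinearMap.proj j : (Fin k → ℂ) →L[ℂ] ℂ) := by
    ext1 z; exact fderiv_eq_sum _
  rw [this]
  refine DifferentiableOn.fun_sum fun j _ => ?_
  exact (differentiableOn_fderiv_apply hU hf _).smul_const _

/-- Mixed second derivatives of a holomorphic function commute. -/
lemma fderiv_fderiv_comm (hU : IsOpen U) (hf : DifferentiableOn ℂ f U) {z : Fin k → ℂ}
    (hz : z ∈ U) (v w : Fin k → ℂ) :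
    fderiv ℂ (fun y => fderiv ℂ f y v) z w = fderiv ℂ (fun y => fderiv ℂ f y w) z v := by
  have hd := (differentiableOn_fderiv hU hf z hz).differentiableAt (hU.mem_nhds hz)
  have h := second_derivative_symmetric_of_eventually (𝕜 := ℂ) (f := f) (f' := fderiv ℂ f)
    (by filter_upwards [hU.mem_nhds hz] with y hy
        exact ((hf y hy).differentiableAt (hU.mem_nhds hy)).hasFDerivAt) hd.hasFDerivAt v w
  have e : ∀ u, fderiv ℂ (fun y => fderiv ℂ f y u) z = (fderiv ℂ (fderiv ℂ f) z).flip u := by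
    intro u
    have := hd.hasFDerivAt.clm_apply (hasFDerivAt_const u z)
    simpa using this.fderiv
  rw [e, e]
  simpa using h.symm

end SeveralVariables

/-! ### The complex strip -/

section Strip

variable {d : ℕ} {ρ : ℝ}

lemma isOpen_strip (d : ℕ) (ρ : ℝ) : IsOpen (strip d ρ) := by
  have : strip d ρ = ⋂ j, {θ | |(θ j).im| < ρ} := by ext; simp [strip]
  rw [this]
  exact isOpen_iInter_of_finite fun j => isOpen_lt (by fun_prop) continuous_const

lemma strip_mono {r : ℝ} (h : r ≤ ρ) : strip d r ⊆ strip d ρ := fun _ hθ j => (hθ j).trans_le h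

lemma complexify_mem_strip (hρ : 0 < ρ) (x : Fin d → ℝ) : complexify x ∈ strip d ρ := by
  intro j; simpa [complexify] using hρ

lemma add_complexify_mem_strip {θ : Fin d → ℂ} (h : θ ∈ strip d ρ) (x : Fin d → ℝ) :
    θ + complexify x ∈ strip d ρ := by
  intro j; simpa [complexify] using h j

/-- For real `x` and `v` only `Im s` matters, so the set is an intersection of convex bands.
Connectedness lets the one-variable identity theorem run along complex lines with real direction. -/
lemma isPreconnected_line_mem_strip (x v : Fin d → ℝ) :
    IsPreconnected {s : ℂ | complexify x + s • complexify v ∈ strip d ρ} := by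
  have : {s : ℂ | complexify x + s • complexify v ∈ strip d ρ}
      = ⋂ j, Complex.imLm ⁻¹' ((LinearMap.mulRight ℝ (v j)) ⁻¹' ball 0 ρ) := by
    ext s
    simp [strip, complexify]
  rw [this]
  exact (convex_iInter fun j =>
    ((convex_ball 0 ρ).linear_preimage _).linear_preimage _).isPreconnected

/-- A holomorphic function on the strip that vanishes at the real points vanishes. -/
lemma eq_zero_of_real {f : (Fin d → ℂ) → ℂ} (hρ : 0 < ρ)
    (hf : DifferentiableOn ℂ f (strip d ρ)) (h0 : ∀ x : Fin d → ℝ, f (complexify x) = 0) :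
    ∀ θ ∈ strip d ρ, f θ = 0 := by
  intro θ hθ
  -- On the complex line `s ↦ x + s • v` real `s` gives real points and `s = I` gives `θ`; the
  -- identity theorem in one variable carries the zero from the former to the latter.
  set x : Fin d → ℂ := complexify fun j => (θ j).re
  set v : Fin d → ℂ := complexify fun j => (θ j).im
  set V : Set ℂ := {s | x + s • v ∈ strip d ρ} with hV
  have hmem : ∀ s : ℂ, s ∈ V ↔ ∀ j, |s.im * (θ j).im| < ρ := by
    intro s
    simp [hV, strip, x, v, complexify]
  have hVo : IsOpen V := (isOpen_strip d ρ).preimage (by fun_prop)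
  have han := (differentiableOn_line (isOpen_strip d ρ) hf x v).analyticOnNhd hVo
  have h0V : (0 : ℂ) ∈ V := by rw [hmem]; simpa using fun _ => hρ
  have hfreq : ∃ᶠ s : ℂ in 𝓝[≠] 0, f (x + s • v) = 0 := by
    have ht : Tendsto (fun t : ℝ => (t : ℂ)) (𝓝[≠] 0) (𝓝[≠] 0) := by
      refine tendsto_nhdsWithin_iff.2 ⟨?_, ?_⟩
      · exact (Complex.continuous_ofReal.tendsto' 0 0 (by simp)).mono_left nhdsWithin_le_nhds
      · filter_upwards [self_mem_nhdsWithin] with t ht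
        simpa using ht
    refine ht.frequently (Eventually.frequently (Eventually.of_forall fun t => ?_))
    convert h0 (fun j => (θ j).re + t * (θ j).im) using 2
    ext j; simp [x, v, complexify]
  have := han.eqOn_zero_of_preconnected_of_frequently_eq_zero
    (isPreconnected_line_mem_strip _ _) h0V hfreq (x := Complex.I) (by rw [← hV, hmem]; simpa [strip] using hθ)
  have e : x + Complex.I • v = θ := by
    ext j
    simp only [x, v, complexify, Pi.add_apply, Pi.smul_apply, smul_eq_mul]
    rw [mul_comm, Complex.re_add_im]
  simpa [e] using this

end Strip

/-! ### Fourier analysis on the strip -/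

section Fourier

variable {d : ℕ} {ρ : ℝ}

/-- A holomorphic function on the strip of width `ρ`, `2π`-periodic in each variable. -/
structure IsStripPeriodic (ρ : ℝ) (u : (Fin d → ℂ) → ℂ) : Prop where
  holomorphic : DifferentiableOn ℂ u (strip d ρ)
  periodic : ∀ θ ∈ strip d ρ, ∀ j, u (θ + Pi.single j ((2 * Real.pi : ℝ) : ℂ)) = u θ

/-- Reality is dropped because the frame that diagonalizes `Γ` is not real at real points. -/
lemma IsTorusAnalytic.isStripPeriodic {u : (Fin d → ℂ) → ℂ} (h : IsTorusAnalytic ρ u) :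
    IsStripPeriodic ρ u := ⟨h.holomorphic, h.periodic⟩

lemma complexify_single (j : Fin d) (x : ℝ) :
    complexify (Pi.single j x) = Pi.single j (x : ℂ) := by
  ext i
  rcases eq_or_ne i j with rfl | h
  · simp [complexify]
  · simp [complexify, h]

lemma complexify_add (x y : Fin d → ℝ) : complexify (x + y) = complexify x + complexify y := by
  ext i; simp [complexify]

lemma complexify_zero : complexify (0 : Fin d → ℝ) = 0 := by ext i; simp [complexify]

namespace IsStripPeriodic

variable {u : (Fin d → ℂ) → ℂ}

lemma add_single_int (h : IsStripPeriodic ρ u) {θ : Fin d → ℂ} (hθ : θ ∈ strip d ρ) (j : Fin d)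
    (n : ℤ) : u (θ + complexify (Pi.single j (2 * Real.pi * n))) = u θ := by
  have step : ∀ m : ℤ, u (θ + complexify (Pi.single j (2 * Real.pi * (m + 1 : ℤ))))
      = u (θ + complexify (Pi.single j (2 * Real.pi * m))) := by
    intro m
    rw [← h.periodic _ (add_complexify_mem_strip hθ (Pi.single j (2 * Real.pi * m))) j,
      ← complexify_single, add_assoc, ← complexify_add, ← Pi.single_add]
    congr 4
    push_cast; ring
  induction n using Int.induction_on with
  | zero => simp [complexify_zero]
  | succ n ih => rw [step, ih]
  | pred n ih => rw [← ih, ← step]; simp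

lemma add_int (h : IsStripPeriodic ρ u) {θ : Fin d → ℂ} (hθ : θ ∈ strip d ρ) (n : Fin d → ℤ) :
    u (θ + complexify fun j => 2 * Real.pi * n j) = u θ := by
  have key : ∀ s : Finset (Fin d),
      u (θ + complexify (∑ j ∈ s, Pi.single j (2 * Real.pi * n j))) = u θ := by
    intro s
    induction s using Finset.induction_on with
    | empty => simp [complexify_zero]
    | insert j s hj ih =>
      rw [Finset.sum_insert hj, add_comm (Pi.single j _), complexify_add, ← add_assoc,
        h.add_single_int (add_complexify_mem_strip hθ _), ih]
  simpa only [Finset.univ_sum_single] using key Finset.univ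

lemma fderiv_apply (h : IsStripPeriodic ρ u) (v : Fin d → ℂ) :
    IsStripPeriodic ρ fun θ => fderiv ℂ u θ v := by
  refine ⟨differentiableOn_fderiv_apply (isOpen_strip d ρ) h.holomorphic v, fun θ hθ j => ?_⟩
  have : (fun η => u (η + Pi.single j ((2 * Real.pi : ℝ) : ℂ))) =ᶠ[𝓝 θ] u := by
    filter_upwards [(isOpen_strip d ρ).mem_nhds hθ] with η hη using h.periodic η hη j
  rw [← this.fderiv_eq, fderiv_comp_add_right]

lemma const (c : ℂ) : IsStripPeriodic ρ fun _ : Fin d → ℂ => c :=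
  ⟨differentiableOn_const c, fun _ _ _ => rfl⟩

lemma add {v : (Fin d → ℂ) → ℂ} (hu : IsStripPeriodic ρ u) (hv : IsStripPeriodic ρ v) :
    IsStripPeriodic ρ fun θ => u θ + v θ :=
  ⟨hu.holomorphic.add hv.holomorphic, fun θ hθ j => by
    rw [hu.periodic θ hθ j, hv.periodic θ hθ j]⟩

lemma mul {v : (Fin d → ℂ) → ℂ} (hu : IsStripPeriodic ρ u) (hv : IsStripPeriodic ρ v) :
    IsStripPeriodic ρ fun θ => u θ * v θ :=
  ⟨hu.holomorphic.mul hv.holomorphic, fun θ hθ j => by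
    rw [hu.periodic θ hθ j, hv.periodic θ hθ j]⟩

lemma sum {ι : Type*} (s : Finset ι) {v : ι → (Fin d → ℂ) → ℂ}
    (hv : ∀ i ∈ s, IsStripPeriodic ρ (v i)) : IsStripPeriodic ρ fun θ => ∑ i ∈ s, v i θ :=
  ⟨DifferentiableOn.fun_sum fun i hi => (hv i hi).holomorphic, fun θ hθ j =>
    Finset.sum_congr rfl fun i hi => (hv i hi).periodic θ hθ j⟩

end IsStripPeriodic

-- Volume on the circle is normalized Haar measure, so a Fourier coefficient is an average and is
-- bounded by the supremum.
local instance : MeasureSpace UnitAddCircle := ⟨AddCircle.haarAddCircle⟩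

local instance : Measure.IsAddHaarMeasure (volume : Measure UnitAddCircle) :=
  inferInstanceAs (Measure.IsAddHaarMeasure AddCircle.haarAddCircle)

local instance : IsProbabilityMeasure (volume : Measure UnitAddCircle) :=
  inferInstanceAs (IsProbabilityMeasure AddCircle.haarAddCircle)

/-- The representative in `[0, 2π)` of a point of the torus. -/
def torusRep (x : UnitAddTorus (Fin d)) : Fin d → ℝ :=
  fun j => 2 * Real.pi * (AddCircle.equivIco 1 0 (x j) : ℝ)

/-- The function `x ↦ u (w + x)` on the torus. -/
def torusFun (u : (Fin d → ℂ) → ℂ) (w : Fin d → ℂ) (x : UnitAddTorus (Fin d)) : ℂ :=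
  u (w + complexify (torusRep x))

/-- The Fourier coefficient of `x ↦ u (w + x)`. -/
def fourierAt (u : (Fin d → ℂ) → ℂ) (k : Fin d → ℤ) (w : Fin d → ℂ) : ℂ :=
  UnitAddTorus.mFourierCoeff (torusFun u w) k

/-- The projection from `ℝ^d` to the torus. -/
def torusMk (y : Fin d → ℝ) : UnitAddTorus (Fin d) := fun j => (y j : UnitAddCircle)

lemma isOpenQuotientMap_torusMk : IsOpenQuotientMap (torusMk : (Fin d → ℝ) → _) :=
  IsOpenQuotientMap.piMap fun _ => QuotientAddGroup.isOpenQuotientMap_mk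

/-- The representative in `[0, 2π)` jumps, but it differs from `2π y` by integer multiples of `2π`,
which periodicity absorbs. Continuity on the torus is checked through this formula. -/
lemma torusFun_mk {u : (Fin d → ℂ) → ℂ} (h : IsStripPeriodic ρ u) {w : Fin d → ℂ}
    (hw : w ∈ strip d ρ) (y : Fin d → ℝ) :
    torusFun u w (torusMk y) = u (w + complexify fun j => 2 * Real.pi * y j) := by
  have hn : ∀ j, ∃ n : ℤ, (AddCircle.equivIco 1 0 (torusMk y j) : ℝ) = y j + n := by
    intro j
    have h1 : ((AddCircle.equivIco 1 0 (torusMk y j) : ℝ) : UnitAddCircle) = (y j : ℝ) :=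
      AddCircle.coe_equivIco
    obtain ⟨n, hn⟩ := (QuotientAddGroup.eq_iff_sub_mem.1 h1)
    exact ⟨n, by simp at hn; linarith⟩
  choose n hn using hn
  rw [torusFun, ← h.add_int (add_complexify_mem_strip hw (fun j => 2 * Real.pi * y j)) n, add_assoc,
    ← complexify_add]
  congr 3
  ext j
  simp only [torusRep, hn, Pi.add_apply]
  ring

lemma continuous_torusFun {u : (Fin d → ℂ) → ℂ} (h : IsStripPeriodic ρ u) {w : Fin d → ℂ}
    (hw : w ∈ strip d ρ) : Continuous (torusFun u w) := by
  rw [isOpenQuotientMap_torusMk.isQuotientMap.continuous_iff]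
  have : torusFun u w ∘ torusMk = fun y => u (w + complexify fun j => 2 * Real.pi * y j) := by
    ext y; exact torusFun_mk h hw y
  rw [this]
  refine h.holomorphic.continuousOn.comp_continuous ?_ fun y => add_complexify_mem_strip hw _
  unfold complexify
  fun_prop

lemma mFourier_torusMk (k : Fin d → ℤ) (y : Fin d → ℝ) :
    UnitAddTorus.mFourier k (torusMk y) =
      Complex.exp (Complex.I * ∑ j, (k j : ℂ) * complexify (fun j => 2 * Real.pi * y j) j) := by
  simp only [UnitAddTorus.mFourier, ContinuousMap.coe_mk, torusMk, fourier_coe_apply,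
    ← Complex.exp_sum, Finset.mul_sum]
  congr 1
  refine Finset.sum_congr rfl fun j _ => ?_
  simp [complexify]
  ring

lemma norm_fourierAt_le {u : (Fin d → ℂ) → ℂ} {w : Fin d → ℂ} (hw : w ∈ strip d ρ) {B : ℝ}
    (hB : ∀ θ ∈ strip d ρ, ‖u θ‖ ≤ B) (k : Fin d → ℤ) : ‖fourierAt u k w‖ ≤ B := by
  rw [fourierAt, UnitAddTorus.mFourierCoeff]
  refine (norm_integral_le_of_norm_le_const (C := B) (Eventually.of_forall fun x => ?_)).trans ?_
  · rw [norm_smul]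
    have h1 : ‖UnitAddTorus.mFourier (-k) x‖ ≤ 1 :=
      ((UnitAddTorus.mFourier (-k)).norm_coe_le_norm x).trans_eq UnitAddTorus.mFourier_norm
    have h2 := hB _ (add_complexify_mem_strip hw (torusRep x))
    calc _ ≤ 1 * B := mul_le_mul h1 h2 (norm_nonneg _) zero_le_one
      _ = B := one_mul B
  · simp

/-- Translation invariance of Haar measure: a real shift of the base point only multiplies by the
character. -/
lemma fourierAt_add_real {u : (Fin d → ℂ) → ℂ} (h : IsStripPeriodic ρ u) {w : Fin d → ℂ}
    (hw : w ∈ strip d ρ) (k : Fin d → ℤ) (y : Fin d → ℝ) :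
    fourierAt u k (w + complexify y) =
      Complex.exp (Complex.I * ∑ j, (k j : ℂ) * complexify y j) * fourierAt u k w := by
  set s : Fin d → ℝ := fun j => y j / (2 * Real.pi)
  have hs : (fun j => 2 * Real.pi * s j) = y := by
    ext j; simp only [s]; field_simp
  have h1 : ∀ x, torusFun u (w + complexify y) x = torusFun u w (x + torusMk s) := by
    intro x
    obtain ⟨z, rfl⟩ := isOpenQuotientMap_torusMk.surjective x
    have e : torusMk z + torusMk s = torusMk (z + s) := by
      ext j; simp [torusMk]
    rw [e, torusFun_mk h (add_complexify_mem_strip hw y), torusFun_mk h hw, add_assoc,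
      ← complexify_add]
    congr 3
    ext j
    simp only [Pi.add_apply, mul_add, congrFun hs j]
    ring
  have h2 : ∀ x, UnitAddTorus.mFourier (-k) x = UnitAddTorus.mFourier k (torusMk s) *
      UnitAddTorus.mFourier (-k) (x + torusMk s) := by
    intro x
    obtain ⟨z, rfl⟩ := isOpenQuotientMap_torusMk.surjective x
    have e : torusMk z + torusMk s = torusMk (z + s) := by
      ext j; simp [torusMk]
    rw [e, mFourier_torusMk, mFourier_torusMk, mFourier_torusMk, ← Complex.exp_add, ← mul_add,
      ← Finset.sum_add_distrib]
    congr 2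
    refine Finset.sum_congr rfl fun j _ => ?_
    simp [complexify]
    ring
  simp only [fourierAt, UnitAddTorus.mFourierCoeff]
  simp_rw [h1]
  have h3 : (fun x => UnitAddTorus.mFourier (-k) x • torusFun u w (x + torusMk s)) =
      fun x => UnitAddTorus.mFourier k (torusMk s) *
        ((fun x => UnitAddTorus.mFourier (-k) x • torusFun u w x) (x + torusMk s)) := by
    ext x
    rw [h2 x]
    simp [mul_assoc]
  rw [h3, integral_const_mul, integral_add_right_eq_self
    (fun x => UnitAddTorus.mFourier (-k) x • torusFun u w x), mFourier_torusMk, hs]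

lemma integrable_torusFun {u : (Fin d → ℂ) → ℂ} (h : IsStripPeriodic ρ u) {w : Fin d → ℂ}
    (hw : w ∈ strip d ρ) (k : Fin d → ℤ) :
    Integrable fun x => UnitAddTorus.mFourier (-k) x • torusFun u w x :=
  ((UnitAddTorus.mFourier (-k)).continuous.smul (continuous_torusFun h hw)).integrable_of_hasCompactSupport
    (HasCompactSupport.of_compactSpace _)

/-- Differentiation under the integral sign; the dominating constant is a maximum over a closed disc
times the cube containing all representatives. Its purpose is to make coefficients holomorphic in
the base point along complex lines. -/
lemma hasDerivAt_fourierAt {u : (Fin d → ℂ) → ℂ} (h : IsStripPeriodic ρ u) {w v : Fin d → ℂ}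
    {t₀ : ℂ} (ht₀ : w + t₀ • v ∈ strip d ρ) (k : Fin d → ℤ) :
    HasDerivAt (fun t : ℂ => fourierAt u k (w + t • v))
      (fourierAt (fun θ => fderiv ℂ u θ v) k (w + t₀ • v)) t₀ := by
  have hVo : IsOpen {t : ℂ | w + t • v ∈ strip d ρ} := (isOpen_strip d ρ).preimage (by fun_prop)
  obtain ⟨δ, hδ, hδV⟩ : ∃ δ > 0, closedBall t₀ δ ⊆ {t : ℂ | w + t • v ∈ strip d ρ} :=
    nhds_basis_closedBall.mem_iff.1 (hVo.mem_nhds ht₀)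
  have h' := h.fderiv_apply v
  obtain ⟨B, hB⟩ := ((isCompact_closedBall t₀ δ).prod
    (isCompact_Icc (a := (0 : Fin d → ℝ)) (b := fun _ => 2 * Real.pi))).exists_bound_of_continuousOn
    (f := fun p : ℂ × (Fin d → ℝ) => fderiv ℂ u (w + p.1 • v + complexify p.2) v) (by
      refine h'.holomorphic.continuousOn.comp (Continuous.continuousOn ?_) fun p hp =>
        add_complexify_mem_strip (hδV hp.1) _
      unfold complexify
      fun_prop)
  have hrep : ∀ x : UnitAddTorus (Fin d), torusRep x ∈ Icc (0 : Fin d → ℝ) fun _ => 2 * Real.pi := by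
    intro x
    constructor <;> intro j
    · have := (AddCircle.equivIco (1 : ℝ) 0 (x j)).2.1
      simp only [torusRep, Pi.zero_apply]
      positivity
    · have := (AddCircle.equivIco (1 : ℝ) 0 (x j)).2.2
      simp only [torusRep]
      nlinarith [Real.pi_pos]
  exact (hasDerivAt_integral_of_dominated_loc_of_deriv_le (μ := volume)
    (F := fun t x => UnitAddTorus.mFourier (-k) x • torusFun u (w + t • v) x)
    (F' := fun t x => UnitAddTorus.mFourier (-k) x •
      torusFun (fun θ => fderiv ℂ u θ v) (w + t • v) x)
    (bound := fun _ => B) (s := ball t₀ δ) (x₀ := t₀) (ball_mem_nhds _ hδ)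
    (by
      filter_upwards [ball_mem_nhds t₀ hδ] with t ht
      exact (integrable_torusFun h (hδV (ball_subset_closedBall ht)) k).aestronglyMeasurable)
    (integrable_torusFun h ht₀ k)
    (integrable_torusFun h' ht₀ k).aestronglyMeasurable
    (by
      refine Eventually.of_forall fun x t ht => ?_
      rw [norm_smul]
      have h1 : ‖UnitAddTorus.mFourier (-k) x‖ ≤ 1 :=
        ((UnitAddTorus.mFourier (-k)).norm_coe_le_norm x).trans_eq UnitAddTorus.mFourier_norm
      have h2 := hB (t, torusRep x) ⟨ball_subset_closedBall ht, hrep x⟩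
      calc _ ≤ 1 * B := mul_le_mul h1 h2 (norm_nonneg _) zero_le_one
        _ = B := one_mul B)
    (integrable_const B)
    (by
      refine Eventually.of_forall fun x t ht => ?_
      refine HasDerivAt.const_mul (UnitAddTorus.mFourier (-k) x) ?_
      have hm := add_complexify_mem_strip (hδV (ball_subset_closedBall ht)) (torusRep x)
      have := hasDerivAt_line (f := u) (z := w + complexify (torusRep x)) (v := v) (t := t) (by
        rw [add_right_comm]
        exact (h.holomorphic _ hm).differentiableAt ((isOpen_strip d ρ).mem_nhds hm))
      simpa only [torusFun, add_right_comm] using this)).2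

/-- Shifting the contour of integration of a Fourier coefficient. -/
lemma fourierAt_eq {u : (Fin d → ℂ) → ℂ} (h : IsStripPeriodic ρ u) (hρ : 0 < ρ)
    {w : Fin d → ℂ} (hw : w ∈ strip d ρ) (k : Fin d → ℤ) :
    fourierAt u k w = Complex.exp (Complex.I * ∑ j, (k j : ℂ) * w j) * fourierAt u k 0 := by
  have h0 : (0 : Fin d → ℂ) ∈ strip d ρ := by simpa [strip] using fun _ => hρ
  set v : Fin d → ℝ := fun j => (w j).im with hv
  set V : Set ℂ := {s | complexify (0 : Fin d → ℝ) + s • complexify v ∈ strip d ρ} with hV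
  have hVo : IsOpen V := (isOpen_strip d ρ).preimage (by fun_prop)
  -- The defect of the claimed formula along `t ↦ t • v`, `v` being the imaginary part of `w`. It
  -- vanishes for real `t` by `fourierAt_add_real`, hence at `t = I`; the real part of `w` is then a
  -- real shift.
  set F : ℂ → ℂ := fun t => fourierAt u k (complexify 0 + t • complexify v) -
    Complex.exp (Complex.I * ∑ j, (k j : ℂ) * (t • complexify v) j) * fourierAt u k 0 with hF
  have hFd : DifferentiableOn ℂ F V := by
    intro t ht
    refine DifferentiableWithinAt.sub
      (hasDerivAt_fourierAt h ht k).differentiableAt.differentiableWithinAt ?_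
    simp only [Pi.smul_apply, smul_eq_mul]
    fun_prop
  have h0V : (0 : ℂ) ∈ V := by simpa [hV, complexify_zero] using h0
  have hfreq : ∃ᶠ s : ℂ in 𝓝[≠] 0, F s = 0 := by
    have ht : Tendsto (fun t : ℝ => (t : ℂ)) (𝓝[≠] 0) (𝓝[≠] 0) := by
      refine tendsto_nhdsWithin_iff.2 ⟨?_, ?_⟩
      · exact (Complex.continuous_ofReal.tendsto' 0 0 (by simp)).mono_left nhdsWithin_le_nhds
      · filter_upwards [self_mem_nhdsWithin] with t ht
        simpa using ht
    refine ht.frequently (Eventually.frequently (Eventually.of_forall fun t => ?_))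
    have e : (t : ℂ) • complexify v = complexify (t • v) := by ext j; simp [complexify]
    simp only [hF]
    rw [e, complexify_zero, fourierAt_add_real h h0, sub_self]
  have hI : Complex.I ∈ V := by simpa [hV, strip, complexify] using hw
  have h1 := (hFd.analyticOnNhd hVo).eqOn_zero_of_preconnected_of_frequently_eq_zero
    (isPreconnected_line_mem_strip 0 v) h0V hfreq hI
  have h2 : w = Complex.I • complexify v + complexify fun j => (w j).re := by
    ext j
    simp only [hv, complexify, Pi.add_apply, Pi.smul_apply, smul_eq_mul]
    rw [mul_comm, add_comm, Complex.re_add_im]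
  have hI' : Complex.I • complexify v ∈ strip d ρ := by
    simpa [hV, complexify_zero] using hI
  simp only [hF, complexify_zero, zero_add, Pi.zero_apply, sub_eq_zero] at h1
  conv_lhs => rw [h2]
  rw [fourierAt_add_real h hI', h1, ← mul_assoc, ← Complex.exp_add, ← mul_add,
    ← Finset.sum_add_distrib]
  congr 3
  refine Finset.sum_congr rfl fun j _ => ?_
  conv_rhs => rw [h2]
  simp only [Pi.add_apply]
  ring

/-- Obtained without integration by parts: both sides are the derivative at `t = 0` of the
coefficient at base point `t • v`, known explicitly from `fourierAt_eq`. -/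
lemma fourierAt_fderiv {u : (Fin d → ℂ) → ℂ} (h : IsStripPeriodic ρ u) (hρ : 0 < ρ)
    (v : Fin d → ℂ) (k : Fin d → ℤ) :
    fourierAt (fun θ => fderiv ℂ u θ v) k 0 =
      Complex.I * (∑ j, (k j : ℂ) * v j) * fourierAt u k 0 := by
  have h0 : (0 : Fin d → ℂ) ∈ strip d ρ := by simpa [strip] using fun _ => hρ
  have h1 := hasDerivAt_fourierAt h (w := 0) (v := v) (t₀ := 0) (by simpa using h0) k
  have hVo : IsOpen {t : ℂ | (0 : Fin d → ℂ) + t • v ∈ strip d ρ} :=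
    (isOpen_strip d ρ).preimage (by fun_prop)
  have h2 : (fun t : ℂ => fourierAt u k (0 + t • v)) =ᶠ[𝓝 0]
      fun t => Complex.exp (t * (Complex.I * ∑ j, (k j : ℂ) * v j)) * fourierAt u k 0 := by
    filter_upwards [hVo.mem_nhds (show (0 : ℂ) ∈ _ by simpa using h0)] with t ht
    rw [fourierAt_eq h hρ ht]
    congr 2
    simp only [zero_add, Pi.smul_apply, smul_eq_mul, Finset.mul_sum]
    exact Finset.sum_congr rfl fun j _ => by ring
  have h3 : HasDerivAt (fun t : ℂ => Complex.exp (t * (Complex.I * ∑ j, (k j : ℂ) * v j)) *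
      fourierAt u k 0) (Complex.I * (∑ j, (k j : ℂ) * v j) * fourierAt u k 0) 0 := by
    have := ((hasDerivAt_id (0 : ℂ)).mul_const
      (Complex.I * ∑ j, (k j : ℂ) * v j)).cexp.mul_const (fourierAt u k 0)
    simpa using this
  simpa using (h1.congr_of_eventuallyEq h2.symm).unique h3

lemma fourierAt_const_mul (u : (Fin d → ℂ) → ℂ) (c : ℂ) (k : Fin d → ℤ) (w : Fin d → ℂ) :
    fourierAt (fun θ => c * u θ) k w = c * fourierAt u k w := by
  simp only [fourierAt, UnitAddTorus.mFourierCoeff, ← integral_const_mul]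
  congr 1
  ext x
  simp [torusFun]
  ring

lemma fourierAt_add {u v : (Fin d → ℂ) → ℂ} (hu : IsStripPeriodic ρ u) (hv : IsStripPeriodic ρ v)
    (k : Fin d → ℤ) {w : Fin d → ℂ} (hw : w ∈ strip d ρ) :
    fourierAt (fun θ => u θ + v θ) k w = fourierAt u k w + fourierAt v k w := by
  simp only [fourierAt, UnitAddTorus.mFourierCoeff]
  rw [← integral_add (integrable_torusFun hu hw k) (integrable_torusFun hv hw k)]
  congr 1
  ext x
  simp [torusFun]
  ring

/-- The Fourier series of a function on the torus. -/
lemma hasSum_fourierAt {u : (Fin d → ℂ) → ℂ} (h : IsStripPeriodic ρ u) {w : Fin d → ℂ}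
    (hw : w ∈ strip d ρ) (hs : Summable fun k => fourierAt u k w) :
    HasSum (fun k => fourierAt u k w) (u w) := by
  have := UnitAddTorus.hasSum_mFourier_series_apply_of_summable
    (f := ⟨torusFun u w, continuous_torusFun h hw⟩) hs (torusMk 0)
  have e : torusFun u w (torusMk 0) = u w := by
    rw [torusFun_mk h hw]
    congr 1
    ext j; simp [complexify]
  simp only [ContinuousMap.coe_mk, e] at this
  convert this using 2 with k
  rw [mFourier_torusMk]
  simp [complexify, fourierAt]

end Fourier

/-! ### The small divisor estimate -/

section SmallDivisors

variable {d : ℕ} {ρ : ℝ}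

/-- The `ℓ¹` norm of an integer vector. -/
def l1 (k : Fin d → ℤ) : ℝ := ∑ l, |(k l : ℝ)|

lemma l1_nonneg (k : Fin d → ℤ) : 0 ≤ l1 k := Finset.sum_nonneg fun _ _ => abs_nonneg _

lemma one_le_l1 {k : Fin d → ℤ} (hk : k ≠ 0) : 1 ≤ l1 k := by
  obtain ⟨j, hj⟩ := Function.ne_iff.1 hk
  have h1 : (1 : ℝ) ≤ |(k j : ℝ)| := by exact_mod_cast Int.one_le_abs hj
  exact h1.trans (Finset.single_le_sum (f := fun l => |(k l : ℝ)|) (fun _ _ => abs_nonneg _)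
    (Finset.mem_univ j))

/-- A finite set of indices lies in a box, and over a box the sum of products factors. -/
lemma summable_prod_pi {ι α : Type*} [Fintype ι] [DecidableEq ι] [DecidableEq α] {f : α → ℝ}
    (hf : Summable f) (h0 : ∀ a, 0 ≤ f a) : Summable fun k : ι → α => ∏ i, f (k i) := by
  refine summable_of_sum_le (c := ∏ _i : ι, ∑' a, f a)
    (fun k => Finset.prod_nonneg fun i _ => h0 _) fun s => ?_
  have hsub : s ⊆ Fintype.piFinset fun i => s.image fun k => k i := fun k hk =>
    Fintype.mem_piFinset.2 fun i => Finset.mem_image_of_mem _ hk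
  refine (Finset.sum_le_sum_of_subset_of_nonneg hsub fun k _ _ =>
    Finset.prod_nonneg fun i _ => h0 _).trans ?_
  rw [← Finset.prod_univ_sum (fun i => s.image fun k => k i) fun _ a => f a]
  exact Finset.prod_le_prod (fun i _ => Finset.sum_nonneg fun a _ => h0 a) fun i _ =>
    hf.sum_le_tsum _ fun a _ => h0 a

lemma summable_exp_neg_abs {s : ℝ} (hs : 0 < s) :
    Summable fun n : ℤ => Real.exp (-s * |(n : ℝ)|) := by
  have h : Summable fun n : ℕ => Real.exp (-s * n) := by
    have := Real.summable_exp_nat_mul_iff.2 (show -s < 0 by linarith)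
    simpa only [mul_comm] using this
  refine Summable.of_nat_of_neg ?_ ?_ <;> simpa using h

/-- Half of the exponential absorbs the power outside the finite set where `l1 k` is below a
threshold; the other half is a product of geometric series. -/
lemma summable_rpow_mul_exp_l1 (τ : ℝ) {s : ℝ} (hs : 0 < s) :
    Summable fun k : Fin d → ℤ => l1 k ^ τ * Real.exp (-s * l1 k) := by
  classical
  have h1 : Summable fun k : Fin d → ℤ => Real.exp (-(s / 2) * l1 k) := by
    have := summable_prod_pi (ι := Fin d) (summable_exp_neg_abs (half_pos hs))
      fun _ => (Real.exp_pos _).le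
    refine this.congr fun k => ?_
    rw [← Real.exp_sum, l1, Finset.mul_sum]
  have h2 : (fun x : ℝ => x ^ τ) =o[atTop] fun x => Real.exp ((s / 2) * x) :=
    isLittleO_rpow_exp_pos_mul_atTop τ (half_pos hs)
  obtain ⟨A, hA⟩ := eventually_atTop.1 (h2.bound one_pos)
  have hfin : {k : Fin d → ℤ | l1 k < A}.Finite := by
    refine (Set.Finite.pi' (t := fun _ => Set.Icc (-⌈A⌉) ⌈A⌉) fun _ => Set.finite_Icc _ _).subset ?_
    intro k hk j
    have : |(k j : ℝ)| ≤ l1 k :=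
      Finset.single_le_sum (f := fun l => |(k l : ℝ)|) (fun _ _ => abs_nonneg _) (Finset.mem_univ j)
    have h3 : |(k j : ℝ)| ≤ ⌈A⌉ := (this.trans (le_of_lt hk)).trans (Int.le_ceil A)
    have h4 : |k j| ≤ ⌈A⌉ := by exact_mod_cast h3
    exact abs_le.1 h4
  refine Summable.of_norm_bounded_eventually h1 ?_
  refine hfin.subset fun k hk => ?_
  by_contra hlt
  apply hk
  have h5 := hA (l1 k) (not_lt.1 hlt)
  rw [Real.norm_of_nonneg (Real.rpow_nonneg (l1_nonneg k) _), Real.norm_of_nonneg (Real.exp_pos _).le,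
    one_mul] at h5
  change ‖l1 k ^ τ * Real.exp (-s * l1 k)‖ ≤ Real.exp (-(s / 2) * l1 k)
  rw [Real.norm_of_nonneg (mul_nonneg (Real.rpow_nonneg (l1_nonneg k) _) (Real.exp_pos _).le)]
  calc l1 k ^ τ * Real.exp (-s * l1 k)
      ≤ Real.exp (s / 2 * l1 k) * Real.exp (-s * l1 k) := by gcongr
    _ = Real.exp (-(s / 2) * l1 k) := by rw [← Real.exp_add]; congr 1; ring

/-- Exponential decay by shifting the contour to `w = -i r sign(k)`, where the factor `exp(i k·w)`
equals `exp(r |k|₁)`. This point lies in the open strip because `r < ρ`. -/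
lemma norm_fourierAt_zero_le {u : (Fin d → ℂ) → ℂ} (h : IsStripPeriodic ρ u) {r : ℝ} (hr : 0 < r)
    (hrρ : r < ρ) {B : ℝ} (hB : ∀ θ ∈ strip d ρ, ‖u θ‖ ≤ B) (k : Fin d → ℤ) :
    ‖fourierAt u k 0‖ ≤ B * Real.exp (-r * l1 k) := by
  set w : Fin d → ℂ := fun j => ((SignType.sign (-(k j : ℝ)) : ℝ) * r : ℝ) * Complex.I with hw
  have hwρ : w ∈ strip d ρ := by
    intro j
    have h1 : |((SignType.sign (-(k j : ℝ)) : ℝ))| ≤ 1 := by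
      rcases SignType.sign (-(k j : ℝ)) with _ | _ | _ <;> simp
    simp only [hw, Complex.mul_im, Complex.ofReal_re, Complex.I_im, Complex.ofReal_im, Complex.I_re,
      mul_one, mul_zero, add_zero, abs_mul, abs_of_pos hr]
    nlinarith
  have h1 := norm_fourierAt_le hwρ hB k
  rw [fourierAt_eq h (hr.trans hrρ) hwρ, norm_mul, Complex.norm_exp] at h1
  have h2 : (Complex.I * ∑ j, (k j : ℂ) * w j).re = r * l1 k := by
    simp only [l1, Finset.mul_sum, Complex.re_sum]
    refine Finset.sum_congr rfl fun j _ => ?_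
    have e : Complex.I * ((k j : ℂ) * w j) =
        (-((k j : ℝ) * ((SignType.sign (-(k j : ℝ)) : ℝ) * r)) : ℝ) := by
      simp only [hw]
      push_cast
      linear_combination (k j * ((SignType.sign (-(k j : ℝ)) : ℝ) * r) : ℂ) * Complex.I_mul_I
    rw [e, Complex.ofReal_re, ← abs_neg (k j : ℝ), ← self_mul_sign]
    ring
  rw [h2] at h1
  calc ‖fourierAt u k 0‖ = Real.exp (r * l1 k) * ‖fourierAt u k 0‖ * Real.exp (-r * l1 k) := by
        rw [mul_right_comm, ← Real.exp_add]; simp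
    _ ≤ B * Real.exp (-r * l1 k) := by gcongr

/-- Small divisor estimate for the equation `- Du · ω = μ u + g`. -/
theorem exists_small_divisor_bound (d : ℕ) {ρ ρ' γ : ℝ} (τ : ℝ) (hρ : 0 < ρ) (hρ' : ρ' < ρ)
    (hγ : 0 < γ) :
    ∃ C : ℝ, ∀ (ω : Fin d → ℝ) (u : (Fin d → ℂ) → ℂ) (μ : ℂ) (η : ℝ), IsStripPeriodic ρ u →
      (∀ k : Fin d → ℤ, k ≠ 0 → γ / l1 k ^ τ ≤ |(∑ l, (k l : ℝ) * ω l) + μ.im|) →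
      (∀ θ ∈ strip d ρ, ‖-fderiv ℂ u θ (complexify ω) - μ * u θ‖ ≤ η) →
      ‖μ‖ * ‖fourierAt u 0 0‖ ≤ η ∧ ∀ θ ∈ strip d ρ', ‖u θ - fourierAt u 0 0‖ ≤ C * η := by
  classical
  -- An intermediate width: coefficients decay at rate `r`, characters grow at rate at most `ρ'` on
  -- the small strip, and the gap `r - ρ'` pays for the small divisors. The maximum keeps `r`
  -- positive when `ρ'` is not.
  set r := (max ρ' 0 + ρ) / 2 with hr
  have hr0 : 0 < r := by have := le_max_right ρ' 0; linarith
  have hrρ : r < ρ := by have := max_lt hρ' hρ; linarith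
  have hrρ' : ρ' < r := by have := le_max_left ρ' 0; linarith
  set S : (Fin d → ℤ) → ℝ := fun k => l1 k ^ τ * Real.exp (-(r - ρ') * l1 k) with hS
  have hSs : Summable S := summable_rpow_mul_exp_l1 τ (by linarith)
  have hS0 : ∀ k, 0 ≤ S k := fun k => mul_nonneg (Real.rpow_nonneg (l1_nonneg k) _)
    (Real.exp_pos _).le
  refine ⟨(∑' k, S k) / γ, fun ω u μ η hu hdiv hg => ?_⟩
  have h0 : (0 : Fin d → ℂ) ∈ strip d ρ := by simpa [strip] using fun _ => hρ
  set g : (Fin d → ℂ) → ℂ := fun θ => (-1) * fderiv ℂ u θ (complexify ω) + (-μ) * u θ with hg'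
  have hη : ∀ θ ∈ strip d ρ, ‖g θ‖ ≤ η := fun θ hθ => by
    convert hg θ hθ using 2
    simp only [hg']; ring
  have hη0 : 0 ≤ η := (norm_nonneg _).trans (hη 0 h0)
  have hD := hu.fderiv_apply (complexify ω)
  have hgp : IsStripPeriodic ρ g :=
    ((IsStripPeriodic.const _).mul hD).add ((IsStripPeriodic.const _).mul hu)
  have hcoef : ∀ k, fourierAt g k 0 =
      -(Complex.I * (∑ j, (k j : ℂ) * complexify ω j) + μ) * fourierAt u k 0 := by
    intro k
    rw [hg', fourierAt_add ((IsStripPeriodic.const _).mul hD) ((IsStripPeriodic.const _).mul hu) k h0,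
      fourierAt_const_mul, fourierAt_const_mul, fourierAt_fderiv hu hρ]
    ring
  have hck : ∀ k, k ≠ 0 → ‖fourierAt u k 0‖ ≤ l1 k ^ τ / γ * (η * Real.exp (-r * l1 k)) := by
    intro k hk
    have hpos : 0 < l1 k ^ τ := Real.rpow_pos_of_pos (by linarith [one_le_l1 hk]) _
    -- Only the imaginary part of the divisor is used, so the real part of `μ` is unrestricted.
    have h1 : γ / l1 k ^ τ ≤ ‖-(Complex.I * (∑ j, (k j : ℂ) * complexify ω j) + μ)‖ := by
      rw [norm_neg]
      refine (hdiv k hk).trans (le_trans (le_of_eq ?_) (Complex.abs_im_le_norm _))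
      have e : (∑ j, (k j : ℂ) * complexify ω j) = ((∑ l, (k l : ℝ) * ω l : ℝ) : ℂ) := by
        simp [complexify]
      rw [e]
      simp
    have h2 := norm_fourierAt_zero_le hgp hr0 hrρ hη k
    rw [hcoef, norm_mul] at h2
    have h3 : γ / l1 k ^ τ * ‖fourierAt u k 0‖ ≤ η * Real.exp (-r * l1 k) :=
      (mul_le_mul_of_nonneg_right h1 (norm_nonneg _)).trans h2
    rw [div_mul_eq_mul_div, div_le_iff₀ hpos] at h3
    rw [div_mul_eq_mul_div, le_div_iff₀ hγ]
    linarith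
  constructor
  · have h1 := norm_fourierAt_le h0 hη 0
    rw [hcoef] at h1
    simpa using h1
  intro θ hθ
  have hθ' := strip_mono hρ'.le hθ
  have hbound : ∀ k, k ≠ 0 → ‖fourierAt u k θ‖ ≤ S k * (η / γ) := by
    intro k hk
    rw [fourierAt_eq hu hρ hθ', norm_mul, Complex.norm_exp]
    have h1 : (Complex.I * ∑ j, (k j : ℂ) * θ j).re ≤ ρ' * l1 k := by
      simp only [l1, Finset.mul_sum, Complex.re_sum]
      refine Finset.sum_le_sum fun j _ => ?_
      have e : (Complex.I * ((k j : ℂ) * θ j)).re = -((k j : ℝ) * (θ j).im) := by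
        simp [Complex.mul_re, Complex.mul_im]
      rw [e]
      calc -((k j : ℝ) * (θ j).im) ≤ |(k j : ℝ) * (θ j).im| := neg_le_abs _
        _ = |(θ j).im| * |(k j : ℝ)| := by rw [abs_mul, mul_comm]
        _ ≤ ρ' * |(k j : ℝ)| := by have := (hθ j).le; gcongr
    calc _ ≤ Real.exp (ρ' * l1 k) * (l1 k ^ τ / γ * (η * Real.exp (-r * l1 k))) :=
          mul_le_mul (Real.exp_le_exp.2 h1) (hck k hk) (norm_nonneg _) (Real.exp_pos _).le
      _ = S k * (η / γ) := by
          have : Real.exp (-(r - ρ') * l1 k) = Real.exp (ρ' * l1 k) * Real.exp (-r * l1 k) := by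
            rw [← Real.exp_add]; congr 1; ring
          simp only [hS, this]; ring
  have hsum : Summable fun k => fourierAt u k θ := by
    refine Summable.of_norm_bounded_eventually (hSs.mul_right (η / γ)) ?_
    refine (Set.finite_singleton (0 : Fin d → ℤ)).subset fun k hk => ?_
    by_contra hne
    exact hk (hbound k hne)
  have hHas := hasSum_fourierAt hu hθ' hsum
  have e0 : fourierAt u 0 θ = fourierAt u 0 0 := by
    rw [fourierAt_eq hu hρ hθ']; simp
  -- Replacing the zeroth term by `0` subtracts the average from the Fourier series; the small
  -- divisor bound covers exactly the remaining terms.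
  have hHas' := hHas.update 0 0
  rw [e0] at hHas'
  have hval : (0 - fourierAt u 0 0 + u θ) = u θ - fourierAt u 0 0 := by ring
  rw [hval] at hHas'
  rw [← hHas'.tsum_eq]
  refine (tsum_of_norm_bounded (hSs.mul_right (η / γ)).hasSum fun k => ?_).trans (le_of_eq ?_)
  · rcases eq_or_ne k 0 with rfl | hk
    · simpa using mul_nonneg (hS0 0) (by positivity)
    · rw [Function.update_of_ne hk]
      exact hbound k hk
  · rw [tsum_mul_right]; ring

lemma fourierAt_fderiv_zero {u : (Fin d → ℂ) → ℂ} (h : IsStripPeriodic ρ u) (hρ : 0 < ρ)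
    (v : Fin d → ℂ) : fourierAt (fun θ => fderiv ℂ u θ v) 0 0 = 0 := by
  rw [fourierAt_fderiv h hρ]; simp

lemma fourierAt_congr {u v : (Fin d → ℂ) → ℂ} {w : Fin d → ℂ} (hw : w ∈ strip d ρ)
    (h : ∀ θ ∈ strip d ρ, u θ = v θ) (k : Fin d → ℤ) : fourierAt u k w = fourierAt v k w := by
  have : torusFun u w = torusFun v w := by
    ext x; exact h _ (add_complexify_mem_strip hw _)
  rw [fourierAt, fourierAt, this]

end SmallDivisors

/-! ### Holomorphic matrices -/

section MatHol

variable {k : ℕ} {s : Set (Fin k → ℂ)} {κ κ₁ κ₂ : Type}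

/-- All entries of the matrix-valued map `A` are holomorphic on `s`. -/
def MatHol (s : Set (Fin k → ℂ)) (A : (Fin k → ℂ) → Matrix κ₁ κ₂ ℂ) : Prop :=
  ∀ r c, DifferentiableOn ℂ (fun z => A z r c) s

lemma MatHol.mul [Fintype κ] {A : (Fin k → ℂ) → Matrix κ₁ κ ℂ} {B : (Fin k → ℂ) → Matrix κ κ₂ ℂ}
    (hA : MatHol s A) (hB : MatHol s B) : MatHol s fun z => A z * B z := by
  intro r c
  simp only [Matrix.mul_apply]
  exact DifferentiableOn.fun_sum fun j _ => (hA r j).mul (hB j c)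

lemma MatHol.add {A B : (Fin k → ℂ) → Matrix κ₁ κ₂ ℂ}
    (hA : MatHol s A) (hB : MatHol s B) : MatHol s fun z => A z + B z :=
  fun r c => (hA r c).add (hB r c)

lemma MatHol.const_smul {A : (Fin k → ℂ) → Matrix κ₁ κ₂ ℂ} (hA : MatHol s A) (a : ℂ) :
    MatHol s fun z => a • A z :=
  fun r c => (hA r c).const_mul a

lemma MatHol.transpose {A : (Fin k → ℂ) → Matrix κ₁ κ₂ ℂ} (hA : MatHol s A) :
    MatHol s fun z => (A z)ᵀ :=
  fun r c => hA c r

lemma MatHol.const (A : Matrix κ₁ κ₂ ℂ) : MatHol s fun _ => A :=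
  fun _ _ => differentiableOn_const _

lemma MatHol.det [Fintype κ] [DecidableEq κ] {A : (Fin k → ℂ) → Matrix κ κ ℂ} (hA : MatHol s A) :
    DifferentiableOn ℂ (fun z => (A z).det) s := by
  simp only [Matrix.det_apply]
  refine DifferentiableOn.fun_sum fun σ _ => DifferentiableOn.const_smul ?_ _
  exact fun z hz => (HasFDerivWithinAt.finsetProd (g := fun i z => A z (σ i) i) fun i _ =>
    (hA (σ i) i z hz).hasFDerivWithinAt).differentiableWithinAt

lemma MatHol.inv [Fintype κ] [DecidableEq κ] {A : (Fin k → ℂ) → Matrix κ κ ℂ} (hA : MatHol s A)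
    (h : ∀ z ∈ s, IsUnit (A z)) : MatHol s fun z => (A z)⁻¹ := by
  intro r c
  simp only [Matrix.inv_def, Ring.inverse_eq_inv', Matrix.smul_apply, Matrix.adjugate_apply,
    smul_eq_mul]
  refine (hA.det.inv fun z hz => ?_).mul (MatHol.det fun i j => ?_)
  · exact ((Matrix.isUnit_iff_isUnit_det _).1 (h z hz)).ne_zero
  · by_cases hi : i = c
    · subst hi
      simp only [Matrix.updateRow_self]
      exact differentiableOn_const _
    · simp only [Matrix.updateRow_ne hi]
      exact hA i j

lemma MatHol.differentiableAt {A : (Fin k → ℂ) → Matrix κ₁ κ₂ ℂ} (hA : MatHol s A)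
    (hs : IsOpen s) {z : Fin k → ℂ} (hz : z ∈ s) (r : κ₁) (c : κ₂) :
    DifferentiableAt ℂ (fun w => A w r c) z := (hA r c z hz).differentiableAt (hs.mem_nhds hz)

lemma fderiv_comp_apply {d : ℕ} {f : (Fin k → ℂ) → ℂ} {K : (Fin d → ℂ) → (Fin k → ℂ)} {θ : Fin d → ℂ}
    (hf : DifferentiableAt ℂ f (K θ)) (hK : ∀ r, DifferentiableAt ℂ (fun η => K η r) θ)
    (v : Fin d → ℂ) :
    fderiv ℂ (fun η => f (K η)) θ v = fderiv ℂ f (K θ) fun r => fderiv ℂ (fun η => K η r) θ v := by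
  have h1 : HasFDerivAt K (ContinuousLinearMap.pi fun r => fderiv ℂ (fun η => K η r) θ) θ :=
    hasFDerivAt_pi'' fun r => (hK r).hasFDerivAt
  have h2 := (hf.hasFDerivAt.comp θ h1).fderiv
  have e : f ∘ K = fun η => f (K η) := rfl
  rw [e] at h2
  rw [h2]
  rfl

lemma differentiableOn_comp {d : ℕ} {U : Set (Fin k → ℂ)} {s : Set (Fin d → ℂ)}
    {f : (Fin k → ℂ) → ℂ} {K : (Fin d → ℂ) → (Fin k → ℂ)}
    (hf : DifferentiableOn ℂ f U) (hK : ∀ r, DifferentiableOn ℂ (fun η => K η r) s)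
    (hKU : ∀ θ ∈ s, K θ ∈ U) : DifferentiableOn ℂ (fun η => f (K η)) s :=
  hf.comp (differentiableOn_pi.2 hK) hKU

lemma MatHol.comp {d : ℕ} {U : Set (Fin k → ℂ)} {s : Set (Fin d → ℂ)}
    {A : (Fin k → ℂ) → Matrix κ₁ κ₂ ℂ} {K : (Fin d → ℂ) → (Fin k → ℂ)}
    (hA : MatHol U A) (hK : ∀ r, DifferentiableOn ℂ (fun η => K η r) s)
    (hKU : ∀ θ ∈ s, K θ ∈ U) : MatHol s fun η => A (K η) :=
  fun r c => differentiableOn_comp (hA r c) hK hKU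

lemma matHol_jacobian {κ : Type} {f : (Fin k → ℂ) → κ → ℂ} (hs : IsOpen s)
    (hf : ∀ r, DifferentiableOn ℂ (fun z => f z r) s) : MatHol s (jacobian f) :=
  fun r c => differentiableOn_fderiv_apply hs (hf r) (Pi.single c 1)

lemma fderiv_sum_mul {ι : Type*} [Fintype ι] {f g : ι → (Fin k → ℂ) → ℂ} {z : Fin k → ℂ}
    (hf : ∀ i, DifferentiableAt ℂ (f i) z) (hg : ∀ i, DifferentiableAt ℂ (g i) z) (v : Fin k → ℂ) :
    fderiv ℂ (fun y => ∑ i, f i y * g i y) z v =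
      ∑ i, (fderiv ℂ (f i) z v * g i z + f i z * fderiv ℂ (g i) z v) := by
  rw [fderiv_fun_sum fun i _ => (hf i).fun_mul (hg i)]
  simp only [sum_apply]
  refine Finset.sum_congr rfl fun i _ => ?_
  rw [fderiv_fun_mul (hf i) (hg i)]
  simp only [add_apply, smul_apply, smul_eq_mul]
  ring

lemma lieMat_mul [Fintype κ] {ω : Fin k → ℝ} {A : (Fin k → ℂ) → Matrix κ₁ κ ℂ}
    {B : (Fin k → ℂ) → Matrix κ κ₂ ℂ} (hs : IsOpen s) (hA : MatHol s A) (hB : MatHol s B)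
    {θ : Fin k → ℂ} (hθ : θ ∈ s) :
    lieMat ω (fun η => A η * B η) θ = lieMat ω A θ * B θ + A θ * lieMat ω B θ := by
  ext r c
  simp only [lieMat, Matrix.of_apply, Matrix.add_apply, Matrix.mul_apply]
  rw [← Finset.sum_add_distrib]
  refine (congrArg Neg.neg (fderiv_sum_mul (f := fun j w => A w r j) (g := fun j w => B w j c)
    (hA.differentiableAt hs hθ r) (fun j => hB.differentiableAt hs hθ j c) (complexify ω))).trans ?_
  rw [← Finset.sum_neg_distrib]
  refine Finset.sum_congr rfl fun j _ => ?_
  ring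

lemma lieMat_transpose {ω : Fin k → ℝ} (A : (Fin k → ℂ) → Matrix κ₁ κ₂ ℂ) (θ : Fin k → ℂ) :
    lieMat ω (fun η => (A η)ᵀ) θ = (lieMat ω A θ)ᵀ := rfl

end MatHol

/-! ### Identities of Hamiltonian dynamics -/

section Hamiltonian

variable {d n m : ℕ} {S : SymplecticSetting n}

lemma SymplecticSetting.Ω_apply (S : SymplecticSetting n) (z : Fin (2 * n) → ℂ)
    (r s : Fin (2 * n)) : S.Ω z r s =
      fderiv ℂ (fun w => S.a w s) z (Pi.single r 1) - fderiv ℂ (fun w => S.a w r) z (Pi.single s 1) := by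
  simp [SymplecticSetting.Ω, symplecticMatrix, jacobian]

lemma SymplecticSetting.a_apply_holomorphic (S : SymplecticSetting n) (r : Fin (2 * n)) :
    DifferentiableOn ℂ (fun z => S.a z r) S.U :=
  differentiableOn_pi.1 S.a_holomorphic r

lemma SymplecticSetting.matHol_Ω (S : SymplecticSetting n) : MatHol S.U S.Ω := by
  intro r s
  simp only [S.Ω_apply]
  exact (differentiableOn_fderiv_apply S.isOpen_U (S.a_apply_holomorphic s) _).sub
    (differentiableOn_fderiv_apply S.isOpen_U (S.a_apply_holomorphic r) _)

lemma SymplecticSetting.Ω_transpose (S : SymplecticSetting n) (z : Fin (2 * n) → ℂ) :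
    (S.Ω z)ᵀ = -S.Ω z := by
  simp [SymplecticSetting.Ω, symplecticMatrix]

lemma SymplecticSetting.isUnit_Ω (S : SymplecticSetting n) {z : Fin (2 * n) → ℂ} (hz : z ∈ S.U) :
    IsUnit (S.Ω z) :=
  (Matrix.isUnit_iff_isUnit_det _).2 (isUnit_iff_ne_zero.2 (S.det_ne_zero z hz))

/-- The derivative of the matrix of the symplectic form in the direction `v`. -/
def SymplecticSetting.dΩ (S : SymplecticSetting n) (z v : Fin (2 * n) → ℂ) :
    Matrix (Fin (2 * n)) (Fin (2 * n)) ℂ :=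
  Matrix.of fun r s => fderiv ℂ (fun w => S.Ω w r s) z v

/-- The symplectic form is closed. -/
lemma SymplecticSetting.dΩ_cyclic (S : SymplecticSetting n) {z : Fin (2 * n) → ℂ} (hz : z ∈ S.U)
    (i j r : Fin (2 * n)) :
    S.dΩ z (Pi.single i 1) j r + S.dΩ z (Pi.single j 1) r i + S.dΩ z (Pi.single r 1) i j = 0 := by
  have hd : ∀ p q, DifferentiableAt ℂ (fun y => fderiv ℂ (fun w => S.a w p) y (Pi.single q 1)) z :=
    fun p q => (differentiableOn_fderiv_apply S.isOpen_U (S.a_apply_holomorphic p) _ z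
      hz).differentiableAt (S.isOpen_U.mem_nhds hz)
  -- After swapping mixed derivatives, each second derivative of `a` occurs twice with opposite
  -- signs: `d² = 0`.
  have hc : ∀ p q t, fderiv ℂ (fun y => fderiv ℂ (fun w => S.a w p) y (Pi.single q 1)) z
      (Pi.single t 1) = fderiv ℂ (fun y => fderiv ℂ (fun w => S.a w p) y (Pi.single t 1)) z
      (Pi.single q 1) := fun p q t =>
    fderiv_fderiv_comm S.isOpen_U (S.a_apply_holomorphic p) hz _ _
  have e : ∀ i j r, S.dΩ z (Pi.single i 1) j r =
      fderiv ℂ (fun y => fderiv ℂ (fun w => S.a w r) y (Pi.single j 1)) z (Pi.single i 1) -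
      fderiv ℂ (fun y => fderiv ℂ (fun w => S.a w j) y (Pi.single r 1)) z (Pi.single i 1) := by
    intro i j r
    simp only [SymplecticSetting.dΩ, Matrix.of_apply, S.Ω_apply]
    rw [fderiv_fun_sub (hd _ _) (hd _ _)]
    rfl
  rw [e, e, e, hc r j i, hc j r i, hc i r j]
  ring

lemma SymplecticSetting.dΩ_apply (S : SymplecticSetting n) (z v : Fin (2 * n) → ℂ)
    (r s : Fin (2 * n)) : S.dΩ z v r s = ∑ t, S.dΩ z (Pi.single t 1) r s * v t := by
  simp only [SymplecticSetting.dΩ, Matrix.of_apply]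
  exact clm_apply_eq_sum _ _

lemma SymplecticSetting.dΩ_transpose (S : SymplecticSetting n) (z v : Fin (2 * n) → ℂ)
    (r s : Fin (2 * n)) : S.dΩ z v s r = - S.dΩ z v r s := by
  have : (fun w => S.Ω w s r) = fun w => - S.Ω w r s := by
    ext w
    have := congrFun (congrFun (S.Ω_transpose w) r) s
    simpa using this
  simp only [SymplecticSetting.dΩ, Matrix.of_apply, this, fderiv_fun_neg]
  rfl

lemma SymplecticSetting.dΩ_sub (S : SymplecticSetting n) (z v w : Fin (2 * n) → ℂ) :
    S.dΩ z (v - w) = S.dΩ z v - S.dΩ z w := by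
  ext r s; simp [SymplecticSetting.dΩ]

variable (H : HamiltonianFamily S m)

lemma HamiltonianFamily.grad_holomorphic {lam : Fin m → ℝ} (hlam : lam ∈ H.Par) (s : Fin (2 * n)) :
    DifferentiableOn ℂ (fun z => fderiv ℂ (fun w => H.h w lam) z (Pi.single s 1)) S.U :=
  differentiableOn_fderiv_apply S.isOpen_U (H.holomorphic lam hlam) _

lemma HamiltonianFamily.X_holomorphic {lam : Fin m → ℝ} (hlam : lam ∈ H.Par) (r : Fin (2 * n)) :
    DifferentiableOn ℂ (fun z => H.X lam z r) S.U := by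
  simp only [HamiltonianFamily.X, Matrix.mulVec, dotProduct]
  exact DifferentiableOn.fun_sum fun s _ =>
    (S.matHol_Ω.inv (fun z hz => S.isUnit_Ω hz) r s).mul (H.grad_holomorphic hlam s)

lemma HamiltonianFamily.Ω_mulVec_X (lam : Fin m → ℝ) {z : Fin (2 * n) → ℂ} (hz : z ∈ S.U)
    (i : Fin (2 * n)) :
    ∑ r, S.Ω z i r * H.X lam z r = fderiv ℂ (fun w => H.h w lam) z (Pi.single i 1) := by
  have h : S.Ω z *ᵥ H.X lam z = fun s => fderiv ℂ (fun w => H.h w lam) z (Pi.single s 1) := by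
    rw [HamiltonianFamily.X, Matrix.mulVec_mulVec,
      Matrix.mul_nonsing_inv _ ((Matrix.isUnit_iff_isUnit_det _).1 (S.isUnit_Ω hz)),
      Matrix.one_mulVec]
  exact congrFun h i

/-- The Lie derivative of the symplectic form along a Hamiltonian vector field vanishes. -/
lemma HamiltonianFamily.lie_Ω {lam : Fin m → ℝ} (hlam : lam ∈ H.Par) {z : Fin (2 * n) → ℂ}
    (hz : z ∈ S.U) :
    S.dΩ z (H.X lam z) + (jacobian (H.X lam) z)ᵀ * S.Ω z + S.Ω z * jacobian (H.X lam) z = 0 := by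
  have hΩ := fun r s => S.matHol_Ω.differentiableAt S.isOpen_U hz r s
  have hX := fun r => ((H.X_holomorphic hlam r) z hz).differentiableAt (S.isOpen_U.mem_nhds hz)
  -- The Hessian of `h`, computed by differentiating `Ω X = ∇h`. Its symmetry, combined with
  -- closedness of `Ω`, is Cartan's formula for this Lie derivative.
  have hder : ∀ i j, fderiv ℂ (fun y => fderiv ℂ (fun w => H.h w lam) y (Pi.single i 1)) z
      (Pi.single j 1) = ∑ r, (S.dΩ z (Pi.single j 1) i r * H.X lam z r +
        S.Ω z i r * jacobian (H.X lam) z r j) := by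
    intro i j
    have heq : (fun y => fderiv ℂ (fun w => H.h w lam) y (Pi.single i 1)) =ᶠ[𝓝 z]
        fun y => ∑ r, S.Ω y i r * H.X lam y r := by
      filter_upwards [S.isOpen_U.mem_nhds hz] with y hy using (H.Ω_mulVec_X lam hy i).symm
    rw [heq.fderiv_eq]
    exact fderiv_sum_mul (f := fun r y => S.Ω y i r) (g := fun r y => H.X lam y r) (hΩ i) hX _
  ext i j
  have hsym := fderiv_fderiv_comm S.isOpen_U (H.holomorphic lam hlam) hz (Pi.single i 1) (Pi.single j 1)
  rw [hder, hder] at hsym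
  have hT : ∀ r, S.Ω z r j = - S.Ω z j r := fun r => by
    have := congrFun (congrFun (S.Ω_transpose z) j) r
    simpa using this
  simp only [Matrix.add_apply, Matrix.mul_apply, Matrix.transpose_apply, Matrix.zero_apply]
  rw [S.dΩ_apply, ← Finset.sum_add_distrib, ← Finset.sum_add_distrib]
  rw [← sub_eq_zero, ← Finset.sum_sub_distrib] at hsym
  rw [← hsym]
  refine Finset.sum_congr rfl fun r _ => ?_
  rw [hT r]
  have hc := S.dΩ_cyclic hz i j r
  rw [S.dΩ_transpose z (Pi.single j 1) i r] at hc
  linear_combination (H.X lam z r) * hc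

variable {ρ : ℝ} {K : (Fin d → ℂ) → (Fin (2 * n) → ℂ)} {lam : Fin m → ℝ} (ω : Fin d → ℝ)

lemma errK_holomorphic (hlam : lam ∈ H.Par) (hK : ∀ r, DifferentiableOn ℂ (fun θ => K θ r) (strip d ρ))
    (hKU : ∀ θ ∈ strip d ρ, K θ ∈ S.U) (r : Fin (2 * n)) :
    DifferentiableOn ℂ (fun θ => errK H ω K lam θ r) (strip d ρ) :=
  ((differentiableOn_fderiv_apply (isOpen_strip d ρ) (hK r) _).neg).add
    (differentiableOn_comp (H.X_holomorphic hlam r) hK hKU)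

/-- The linearized operator on the tangent bundle of the torus is the derivative of the error. -/
lemma linOp_jacobian (hlam : lam ∈ H.Par)
    (hK : ∀ r, DifferentiableOn ℂ (fun θ => K θ r) (strip d ρ))
    (hKU : ∀ θ ∈ strip d ρ, K θ ∈ S.U) {θ : Fin d → ℂ} (hθ : θ ∈ strip d ρ) :
    linOp H ω K lam (jacobian K) θ = jacobian (errK H ω K lam) θ := by
  have ho := isOpen_strip d ρ
  have hU := S.isOpen_U.mem_nhds (hKU θ hθ)
  ext r j
  simp only [linOp, lieMat, jacobian, errK, lieVec, Matrix.add_apply, Matrix.of_apply,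
    Matrix.mul_apply, Pi.add_apply]
  rw [fderiv_fun_add, fderiv_fun_neg, add_apply, fderiv_comp_apply (f := fun z => H.X lam z r)
    ((H.X_holomorphic hlam r _ (hKU θ hθ)).differentiableAt hU)
    (fun r => (hK r θ hθ).differentiableAt (ho.mem_nhds hθ))]
  · rw [neg_apply, fderiv_fderiv_comm ho (hK r) hθ, clm_apply_eq_sum (fderiv ℂ (fun z => H.X lam z r) (K θ))]
  · exact (((differentiableOn_fderiv_apply ho (hK r) _).neg) θ hθ).differentiableAt
      (ho.mem_nhds hθ)
  · exact (differentiableOn_comp (H.X_holomorphic hlam r) hK hKU θ hθ).differentiableAt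
      (ho.mem_nhds hθ)

/-- The chain rule, with the velocity `-DK·ω` rewritten as `E_K - X_h ∘ K`. -/
lemma lieMat_Ω_comp (hK : ∀ r, DifferentiableOn ℂ (fun θ => K θ r) (strip d ρ))
    (hKU : ∀ θ ∈ strip d ρ, K θ ∈ S.U) {θ : Fin d → ℂ} (hθ : θ ∈ strip d ρ) :
    lieMat ω (fun η => S.Ω (K η)) θ =
      S.dΩ (K θ) (errK H ω K lam θ) - S.dΩ (K θ) (H.X lam (K θ)) := by
  rw [← S.dΩ_sub]
  ext r s
  simp only [lieMat, SymplecticSetting.dΩ, Matrix.of_apply]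
  rw [fderiv_comp_apply (f := fun z => S.Ω z r s)
    (S.matHol_Ω.differentiableAt S.isOpen_U (hKU θ hθ) r s)
    (fun r => (hK r θ hθ).differentiableAt ((isOpen_strip d ρ).mem_nhds hθ)), ← map_neg]
  congr 1
  ext t
  simp [errK, lieVec]

/-- Derivative of the symplectic products of two matrix-valued maps along the torus. -/
lemma lieMat_pull_Ω {κ₁ κ₂ : Type} (hlam : lam ∈ H.Par)
    (hK : ∀ r, DifferentiableOn ℂ (fun θ => K θ r) (strip d ρ))
    (hKU : ∀ θ ∈ strip d ρ, K θ ∈ S.U)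
    {V₁ : (Fin d → ℂ) → Matrix (Fin (2 * n)) κ₁ ℂ} {V₂ : (Fin d → ℂ) → Matrix (Fin (2 * n)) κ₂ ℂ}
    (hV₁ : MatHol (strip d ρ) V₁) (hV₂ : MatHol (strip d ρ) V₂)
    {θ : Fin d → ℂ} (hθ : θ ∈ strip d ρ) :
    lieMat ω (pull S.Ω K V₁ V₂) θ =
      (linOp H ω K lam V₁ θ)ᵀ * S.Ω (K θ) * V₂ θ + (V₁ θ)ᵀ * S.Ω (K θ) * linOp H ω K lam V₂ θ +
        (V₁ θ)ᵀ * S.dΩ (K θ) (errK H ω K lam θ) * V₂ θ := by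
  have ho := isOpen_strip d ρ
  have hΩ : MatHol (strip d ρ) fun η => S.Ω (K η) := S.matHol_Ω.comp hK hKU
  have h1 : lieMat ω (pull S.Ω K V₁ V₂) θ = lieMat ω (fun η => (V₁ η)ᵀ * S.Ω (K η) * V₂ η) θ := rfl
  rw [h1, lieMat_mul ho (hV₁.transpose.mul hΩ) hV₂ hθ, lieMat_mul ho hV₁.transpose hΩ hθ,
    lieMat_transpose, lieMat_Ω_comp H ω (lam := lam) hK hKU hθ]
  -- Invariance of `Ω` cancels the derivative along `X_h` against the terms in `D X_h`; only the
  -- derivative along `E_K` survives.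
  have hlie := H.lie_Ω hlam (hKU θ hθ)
  rw [add_assoc, add_eq_zero_iff_eq_neg] at hlie
  rw [hlie]
  simp only [linOp, Matrix.transpose_add, Matrix.transpose_mul, Matrix.add_mul, Matrix.mul_add,
    Matrix.mul_assoc, sub_neg_eq_add]
  abel

/-- The coefficients of the pull-back to the torus of the primitive of the symplectic form. -/
def pullPrimitive (S : SymplecticSetting n) (K : (Fin d → ℂ) → (Fin (2 * n) → ℂ)) (j : Fin d)
    (θ : Fin d → ℂ) : ℂ :=
  ∑ r, S.a (K θ) r * jacobian K θ r j

/-- The pull-back of the symplectic form to the torus is exact. -/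
lemma pull_Ω_jacobian (hK : ∀ r, DifferentiableOn ℂ (fun θ => K θ r) (strip d ρ))
    (hKU : ∀ θ ∈ strip d ρ, K θ ∈ S.U) {θ : Fin d → ℂ} (hθ : θ ∈ strip d ρ) (i j : Fin d) :
    pull S.Ω K (jacobian K) (jacobian K) θ i j =
      fderiv ℂ (pullPrimitive S K j) θ (Pi.single i 1) -
        fderiv ℂ (pullPrimitive S K i) θ (Pi.single j 1) := by
  have ho := isOpen_strip d ρ
  have hL := matHol_jacobian ho hK
  have hder : ∀ i j, fderiv ℂ (pullPrimitive S K j) θ (Pi.single i 1) =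
      ∑ r, ∑ s, jacobian K θ s i * jacobian S.a (K θ) r s * jacobian K θ r j +
      ∑ r, S.a (K θ) r * fderiv ℂ (fun η => jacobian K η r j) θ (Pi.single i 1) := by
    intro i j
    have ha : ∀ r, DifferentiableAt ℂ (fun η => S.a (K η) r) θ := fun r =>
      (differentiableOn_comp (S.a_apply_holomorphic r) hK hKU θ hθ).differentiableAt
        (ho.mem_nhds hθ)
    unfold pullPrimitive
    refine (fderiv_sum_mul (f := fun r η => S.a (K η) r) (g := fun r η => jacobian K η r j) ha
      (fun r => hL.differentiableAt ho hθ r j) _).trans ?_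
    rw [← Finset.sum_add_distrib]
    refine Finset.sum_congr rfl fun r _ => ?_
    rw [fderiv_comp_apply (f := fun z => S.a z r)
        ((S.a_apply_holomorphic r _ (hKU θ hθ)).differentiableAt (S.isOpen_U.mem_nhds (hKU θ hθ)))
        (fun r => (hK r θ hθ).differentiableAt (ho.mem_nhds hθ))]
    rw [clm_apply_eq_sum (fderiv ℂ (fun z => S.a z r) (K θ)), Finset.sum_mul]
    congr 1
    refine Finset.sum_congr rfl fun s _ => ?_
    simp only [jacobian, Matrix.of_apply]
    ring
  -- The second derivatives of `K` are symmetric and drop out on antisymmetrizing, leaving the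
  -- pull-back of `(Da)ᵀ - Da`.
  have hcomm : ∀ r, fderiv ℂ (fun η => jacobian K η r j) θ (Pi.single i 1) =
      fderiv ℂ (fun η => jacobian K η r i) θ (Pi.single j 1) := fun r =>
    fderiv_fderiv_comm ho (hK r) hθ _ _
  rw [hder, hder]
  simp only [hcomm, add_sub_add_right_eq_sub]
  simp only [pull, Matrix.mul_apply, Matrix.transpose_apply, Finset.sum_mul]
  rw [Finset.sum_comm (f := fun r s => jacobian K θ s j * jacobian S.a (K θ) r s * jacobian K θ r i),
    ← Finset.sum_sub_distrib]
  refine Finset.sum_congr rfl fun r _ => ?_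
  rw [← Finset.sum_sub_distrib]
  refine Finset.sum_congr rfl fun s _ => ?_
  simp only [SymplecticSetting.Ω, symplecticMatrix, Matrix.sub_apply, Matrix.transpose_apply]
  ring

end Hamiltonian

/-! ### Uniform bounds on compact sets -/

section CompactBounds

variable {n m : ℕ} {S : SymplecticSetting n}

lemma norm_fderiv_single_le {k : ℕ} {U : Set (Fin k → ℂ)} {f : (Fin k → ℂ) → ℂ} (hU : IsOpen U)
    (hf : DifferentiableOn ℂ f U) {z : Fin k → ℂ} {δ B : ℝ} (hδ : 0 < δ)
    (hz : ∀ w ∈ closedBall z δ, w ∈ U ∧ ‖f w‖ ≤ B) (s : Fin k) :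
    ‖fderiv ℂ f z (Pi.single s 1)‖ ≤ B / δ :=
  norm_fderiv_apply_le hU hf hδ fun t ht => hz _ (by
    rw [mem_closedBall, dist_eq_norm, add_sub_cancel_left, norm_smul, Pi.norm_single]
    simpa using ht)

lemma closedBall_subset_cthickening_add {E : Type*} [PseudoMetricSpace E] {Z : Set E} {a b : ℝ}
    (ha : 0 ≤ a) (hb : 0 ≤ b) {z : E} (hz : z ∈ cthickening a Z) :
    closedBall z b ⊆ cthickening (a + b) Z := by
  rw [add_comm]
  exact (closedBall_subset_cthickening hz b).trans (cthickening_cthickening_subset hb ha Z)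

/-- The derivative of the Hamiltonian vector field is bounded on compact sets. -/
lemma HamiltonianFamily.exists_jacobian_X_bound (H : HamiltonianFamily S m)
    {Z : Set (Fin (2 * n) → ℂ)} (hZ : IsCompact Z) (hZU : Z ⊆ S.U)
    {Q : Set (Fin m → ℝ)} (hQ : IsCompact Q) (hQP : Q ⊆ H.Par) :
    ∃ C : ℝ, 0 ≤ C ∧ ∀ lam ∈ Q, ∀ z ∈ Z, ∀ r j, ‖jacobian (H.X lam) z r j‖ ≤ C := by
  -- Only `h` is continuous in `λ` by hypothesis, so its derivatives are bounded by two Cauchy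
  -- estimates, each costing `δ / 2`: from `h` on the `δ`-thickening to `X_h` on the `δ /
  -- 2`-thickening, then to `D X_h` on `Z`.
  obtain ⟨δ, hδ, hδU⟩ := hZ.exists_cthickening_subset_open S.isOpen_U hZU
  have hδ2 : 0 < δ / 2 := half_pos hδ
  have hsub : cthickening (δ / 2) Z ⊆ S.U :=
    (cthickening_mono (by linarith) Z).trans hδU
  obtain ⟨B, hB⟩ := ((hZ.cthickening (r := δ)).prod hQ).exists_bound_of_continuousOn
    (H.continuousOn.mono (prod_mono hδU hQP))
  have hgrad : ∀ lam ∈ Q, ∀ z ∈ cthickening (δ / 2) Z, ∀ s,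
      ‖fderiv ℂ (fun w => H.h w lam) z (Pi.single s 1)‖ ≤ B / (δ / 2) := by
    intro lam hlam z hz s
    refine norm_fderiv_single_le S.isOpen_U (H.holomorphic lam (hQP hlam)) hδ2 (fun w hw => ?_) s
    have hw' : w ∈ cthickening δ Z := by
      have := closedBall_subset_cthickening_add hδ2.le hδ2.le hz hw
      rwa [add_halves] at this
    exact ⟨hδU hw', hB (w, lam) ⟨hw', hlam⟩⟩
  have hinv := fun r s => (hZ.cthickening (r := δ / 2)).exists_bound_of_continuousOn
    (((S.matHol_Ω.inv fun z hz => S.isUnit_Ω hz) r s).continuousOn.mono hsub)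
  choose D hD using hinv
  set C : Fin (2 * n) → ℝ := fun r => ∑ s, |D r s| * |B / (δ / 2)| with hC
  have hX : ∀ lam ∈ Q, ∀ z ∈ cthickening (δ / 2) Z, ∀ r, ‖H.X lam z r‖ ≤ ∑ r, C r := by
    intro lam hlam z hz r
    have h1 : ‖H.X lam z r‖ ≤ C r := by
      simp only [HamiltonianFamily.X, Matrix.mulVec, dotProduct]
      refine (norm_sum_le _ _).trans (Finset.sum_le_sum fun s _ => ?_)
      rw [norm_mul]
      exact mul_le_mul ((hD r s z hz).trans (le_abs_self _))
        ((hgrad lam hlam z hz s).trans (le_abs_self _)) (norm_nonneg _) (abs_nonneg _)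
    exact h1.trans (Finset.single_le_sum (f := C)
      (fun r _ => Finset.sum_nonneg fun s _ => mul_nonneg (abs_nonneg _) (abs_nonneg _))
      (Finset.mem_univ r))
  have hC0 : 0 ≤ ∑ r, C r := Finset.sum_nonneg fun r _ =>
    Finset.sum_nonneg fun s _ => mul_nonneg (abs_nonneg _) (abs_nonneg _)
  refine ⟨(∑ r, C r) / (δ / 2), div_nonneg hC0 hδ2.le, fun lam hlam z hz r j => ?_⟩
  refine norm_fderiv_single_le S.isOpen_U (H.X_holomorphic (hQP hlam) r) hδ2 (fun w hw => ?_) j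
  have hw' : w ∈ cthickening (δ / 2) Z := by
    have := closedBall_subset_cthickening_add le_rfl hδ2.le
      (self_subset_cthickening Z hz) hw
    rwa [zero_add] at this
  exact ⟨hsub hw', hX lam hlam w hw' r⟩

end CompactBounds

/-! ### The compatible triple on the complexified torus -/

section Compatible

variable {d n : ℕ} {ρ : ℝ} {K : (Fin d → ℂ) → (Fin (2 * n) → ℂ)}

lemma exists_complexify_eq (hK : ∀ r, IsTorusAnalytic ρ fun θ => K θ r) (x : Fin d → ℝ) :
    ∃ y : Fin (2 * n) → ℝ, K (complexify x) = complexify y :=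
  ⟨fun r => (K (complexify x) r).re, by
    ext r
    exact Complex.ext (by simp [complexify]) (by simpa [complexify] using (hK r).real x)⟩

/-- The identities of the compatible triple are given only at real points, and components of `U`
need not meet these. They are therefore propagated along the strip: `K` is real on the real torus,
where the composed identity holds, and the strip obeys the identity theorem. -/
lemma matrix_eq_of_real (S : SymplecticSetting n) (hρ : 0 < ρ)
    (hK : ∀ r, IsTorusAnalytic ρ fun θ => K θ r) (hKU : ∀ θ ∈ strip d ρ, K θ ∈ S.U)
    {κ₁ κ₂ : Type} {A B : (Fin (2 * n) → ℂ) → Matrix κ₁ κ₂ ℂ} (hA : MatHol S.U A) (hB : MatHol S.U B)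
    (h : ∀ x : Fin (2 * n) → ℝ, complexify x ∈ S.U → A (complexify x) = B (complexify x))
    {θ : Fin d → ℂ} (hθ : θ ∈ strip d ρ) : A (K θ) = B (K θ) := by
  have hKd := fun r => (hK r).holomorphic
  ext r s
  refine sub_eq_zero.1 (eq_zero_of_real (f := fun η => A (K η) r s - B (K η) r s) hρ
    (((hA.comp hKd hKU) r s).sub ((hB.comp hKd hKU) r s)) (fun x => ?_) θ hθ)
  obtain ⟨y, hy⟩ := exists_complexify_eq hK x
  have hmem := hKU _ (complexify_mem_strip hρ x)
  rw [hy] at hmem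
  simp only [hy, h y hmem, sub_self]

lemma compatible_on_strip (S : SymplecticSetting n) (hρ : 0 < ρ)
    (hK : ∀ r, IsTorusAnalytic ρ fun θ => K θ r) (hKU : ∀ θ ∈ strip d ρ, K θ ∈ S.U)
    {θ : Fin d → ℂ} (hθ : θ ∈ strip d ρ) :
    (S.J (K θ))ᵀ * S.Ω (K θ) = S.G (K θ) :=
  matrix_eq_of_real S hρ hK hKU (MatHol.mul (MatHol.transpose S.J_holomorphic) S.matHol_Ω)
    S.G_holomorphic S.compatible hθ

lemma J_sq_on_strip (S : SymplecticSetting n) (hρ : 0 < ρ)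
    (hK : ∀ r, IsTorusAnalytic ρ fun θ => K θ r) (hKU : ∀ θ ∈ strip d ρ, K θ ∈ S.U)
    {θ : Fin d → ℂ} (hθ : θ ∈ strip d ρ) :
    S.J (K θ) * S.J (K θ) = -1 :=
  matrix_eq_of_real S hρ hK hKU (MatHol.mul S.J_holomorphic S.J_holomorphic)
    (B := fun _ => -1) (MatHol.const _) S.J_sq hθ

lemma G_symm_on_strip (S : SymplecticSetting n) (hρ : 0 < ρ)
    (hK : ∀ r, IsTorusAnalytic ρ fun θ => K θ r) (hKU : ∀ θ ∈ strip d ρ, K θ ∈ S.U)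
    {θ : Fin d → ℂ} (hθ : θ ∈ strip d ρ) :
    (S.G (K θ))ᵀ = S.G (K θ) := by
  refine matrix_eq_of_real S hρ hK hKU (A := fun z => (S.G z)ᵀ) (MatHol.transpose S.G_holomorphic)
    S.G_holomorphic (fun x hx => ?_) hθ
  have h := (S.G_posDef x hx).isHermitian
  ext r s
  have h1 := congrFun (congrFun h r) s
  simp only [Matrix.conjTranspose_apply, Matrix.map_apply, star_trivial] at h1
  exact Complex.ext (by simpa using h1) (by simp [S.G_real x hx])

end Compatible

/-! ### Uniform estimates for families -/

section Estimates

variable {ι : Type*} {d : ℕ} {err w w₁ w₂ : ι → ℝ} {ρ : ℝ}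

/-- The family `f` of functions on the strip of width `ρ` is, on all smaller strips, uniformly
bounded by a multiple of `w`, as soon as `err` is small enough. -/
def LocO (err : ι → ℝ) (ρ : ℝ) (w : ι → ℝ) (f : ι → (Fin d → ℂ) → ℂ) : Prop :=
  ∀ r < ρ, ∃ C, 0 ≤ C ∧ ∃ ε, 0 < ε ∧ ∀ i, err i ≤ ε → ∀ θ ∈ strip d r, ‖f i θ‖ ≤ C * w i

namespace LocO

variable {f g : ι → (Fin d → ℂ) → ℂ}

lemma of_bound {C : ℝ} (hC : 0 ≤ C) (h : ∀ i, ∀ θ ∈ strip d ρ, ‖f i θ‖ ≤ C * w i) :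
    LocO err ρ w f :=
  fun _ hr => ⟨C, hC, 1, one_pos, fun i _ θ hθ => h i θ (strip_mono hr.le hθ)⟩

lemma congr (h : ∀ i, ∀ θ ∈ strip d ρ, g i θ = f i θ) (hf : LocO err ρ w f) :
    LocO err ρ w g := fun r hr => by
  obtain ⟨C, hC, ε, hε, H⟩ := hf r hr
  exact ⟨C, hC, ε, hε, fun i hi θ hθ => by rw [h i θ (strip_mono hr.le hθ)]; exact H i hi θ hθ⟩

lemma add (hf : LocO err ρ w f) (hg : LocO err ρ w g) :
    LocO err ρ w fun i θ => f i θ + g i θ := fun r hr => by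
  obtain ⟨C, hC, ε, hε, H⟩ := hf r hr
  obtain ⟨C', hC', ε', hε', H'⟩ := hg r hr
  refine ⟨C + C', add_nonneg hC hC', min ε ε', lt_min hε hε', fun i hi θ hθ => ?_⟩
  rw [add_mul]
  exact (norm_add_le _ _).trans (add_le_add (H i (hi.trans (min_le_left _ _)) θ hθ)
    (H' i (hi.trans (min_le_right _ _)) θ hθ))

lemma mul (hf : LocO err ρ w₁ f) (hg : LocO err ρ w₂ g) (hw : ∀ i, w₁ i * w₂ i = w i) :
    LocO err ρ w fun i θ => f i θ * g i θ := fun r hr => by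
  obtain ⟨C, hC, ε, hε, H⟩ := hf r hr
  obtain ⟨C', hC', ε', hε', H'⟩ := hg r hr
  refine ⟨C * C', mul_nonneg hC hC', min ε ε', lt_min hε hε', fun i hi θ hθ => ?_⟩
  have h1 := H i (hi.trans (min_le_left _ _)) θ hθ
  have h2 := H' i (hi.trans (min_le_right _ _)) θ hθ
  rw [norm_mul, ← hw i, mul_mul_mul_comm]
  exact mul_le_mul h1 h2 (norm_nonneg _) ((norm_nonneg _).trans h1)

lemma neg (hf : LocO err ρ w f) : LocO err ρ w fun i θ => - f i θ := fun r hr => by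
  obtain ⟨C, hC, ε, hε, H⟩ := hf r hr
  exact ⟨C, hC, ε, hε, fun i hi θ hθ => by rw [norm_neg]; exact H i hi θ hθ⟩

lemma sub (hf : LocO err ρ w f) (hg : LocO err ρ w g) :
    LocO err ρ w fun i θ => f i θ - g i θ := by
  simpa only [sub_eq_add_neg] using hf.add hg.neg

lemma zero : LocO err ρ w fun (_ : ι) (_ : Fin d → ℂ) => (0 : ℂ) :=
  of_bound le_rfl fun i θ _ => by simp

lemma const (c : ℂ) : LocO err ρ (fun _ => 1) fun (_ : ι) (_ : Fin d → ℂ) => c :=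
  of_bound (norm_nonneg c) fun i θ _ => by simp

lemma const_mul (c : ℂ) (hf : LocO err ρ w f) : LocO err ρ w fun i θ => c * f i θ :=
  (const c).mul hf fun i => one_mul (w i)

lemma sum {κ : Type*} (s : Finset κ) {f : κ → ι → (Fin d → ℂ) → ℂ}
    (hf : ∀ a ∈ s, LocO err ρ w (f a)) : LocO err ρ w fun i θ => ∑ a ∈ s, f a i θ := by
  classical
  induction s using Finset.induction_on with
  | empty => simpa using zero
  | insert a s ha ih =>
    simp only [Finset.sum_insert ha]
    exact (hf a (Finset.mem_insert_self a s)).add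
      (ih fun b hb => hf b (Finset.mem_insert_of_mem hb))

/-- Once the error is below `ε`, the bound `C * err` is at most the constant `C * ε`. -/
lemma toBounded (hf : LocO err ρ err f) : LocO err ρ (fun _ => 1) f := fun r hr => by
  obtain ⟨C, hC, ε, hε, H⟩ := hf r hr
  refine ⟨C * ε, mul_nonneg hC hε.le, ε, hε, fun i hi θ hθ => (H i hi θ hθ).trans ?_⟩
  rw [mul_one]
  gcongr

/-- Cauchy estimates. -/
lemma fderiv (hf : LocO err ρ w f) (hol : ∀ i, DifferentiableOn ℂ (f i) (strip d ρ))
    (v : Fin d → ℂ) : LocO err ρ w fun i θ => fderiv ℂ (f i) θ v := fun r hr => by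
  obtain ⟨C, hC, ε, hε, H⟩ := hf ((r + ρ) / 2) (by linarith)
  have hv : 0 ≤ ‖v‖ := norm_nonneg v
  -- A disc of this radius in direction `v` moves imaginary parts by at most half the gap, so it
  -- stays in the middle strip.
  set δ := (ρ - r) / (2 * (‖v‖ + 1)) with hδ
  have hδ0 : 0 < δ := div_pos (by linarith) (by linarith)
  have hδv : δ * ‖v‖ ≤ (ρ - r) / 2 := by
    rw [hδ, div_mul_eq_mul_div, div_le_div_iff₀ (by positivity) (by norm_num)]
    nlinarith
  refine ⟨C / δ, by positivity, ε, hε, fun i hi θ hθ => ?_⟩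
  have := norm_fderiv_apply_le (isOpen_strip d ρ) (hol i) (z := θ) (v := v) (B := C * w i) hδ0
    fun t ht => by
      have hmem : θ + t • v ∈ strip d ((r + ρ) / 2) := fun j => by
        calc |((θ + t • v) j).im| = |(θ j).im + (t * v j).im| := by simp
          _ ≤ |(θ j).im| + ‖t * v j‖ := (abs_add_le _ _).trans
              (add_le_add le_rfl (Complex.abs_im_le_norm _))
          _ ≤ |(θ j).im| + δ * ‖v‖ := by rw [norm_mul]; gcongr; exact norm_le_pi_norm v j
          _ < (r + ρ) / 2 := by linarith [hθ j]
      exact ⟨strip_mono (by linarith) hmem, H i hi _ hmem⟩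
  rwa [div_mul_eq_mul_div]

lemma of_bound_const {c : ι → ℂ} {C ε : ℝ} (hC : 0 ≤ C) (hε : 0 < ε)
    (h : ∀ i, err i ≤ ε → ‖c i‖ ≤ C * w i) : LocO (d := d) err ρ w fun i _ => c i :=
  fun _ _ => ⟨C, hC, ε, hε, fun i hi _ _ => h i hi⟩

end LocO

lemma IsStripPeriodic.mono {u : (Fin d → ℂ) → ℂ} {r : ℝ} (h : IsStripPeriodic ρ u) (hr : r ≤ ρ) :
    IsStripPeriodic r u :=
  ⟨h.holomorphic.mono (strip_mono hr), fun θ hθ j => h.periodic θ (strip_mono hr hθ) j⟩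

/-- The small divisor estimate for families. -/
lemma LocO.small_divisor {γ τ : ℝ} (hγ : 0 < γ) (hρ : 0 < ρ) {ω : Fin d → ℝ}
    {u : ι → (Fin d → ℂ) → ℂ} {μ : ι → ℂ} (hu : ∀ i, IsStripPeriodic ρ (u i))
    (hdiv : ∀ i, ∀ k : Fin d → ℤ, k ≠ 0 → γ / l1 k ^ τ ≤ |(∑ l, (k l : ℝ) * ω l) + (μ i).im|)
    (hg : LocO err ρ err fun i θ => -_root_.fderiv ℂ (u i) θ (complexify ω) - μ i * u i θ) :
    LocO (d := d) err ρ err (fun i _ => μ i * fourierAt (u i) 0 0) ∧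
      LocO err ρ err fun i θ => u i θ - fourierAt (u i) 0 0 := by
  constructor
  · obtain ⟨C, hC, ε, hε, H⟩ := hg (ρ / 2) (by linarith)
    -- Only the bound on the average is used here, so the inner width is irrelevant and `0` serves.
    obtain ⟨C', hC'⟩ := exists_small_divisor_bound d (ρ := ρ / 2) (ρ' := 0) τ (half_pos hρ)
      (half_pos hρ) hγ
    refine LocO.of_bound_const hC hε fun i hi => ?_
    rw [norm_mul]
    exact (hC' ω (u i) (μ i) _ ((hu i).mono (by linarith)) (hdiv i) (H i hi)).1
  · intro r hr
    have hm := max_lt hr hρ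
    have h1 := le_max_left r 0
    have h2 := le_max_right r 0
    obtain ⟨C, hC, ε, hε, H⟩ := hg ((max r 0 + ρ) / 2) (by linarith)
    obtain ⟨C', hC'⟩ := exists_small_divisor_bound d (ρ := (max r 0 + ρ) / 2) (ρ' := r) τ
      (by linarith) (by linarith) hγ
    refine ⟨|C'| * C, by positivity, ε, hε, fun i hi θ hθ => ?_⟩
    have h0 : (0 : Fin d → ℂ) ∈ strip d ((max r 0 + ρ) / 2) := fun j => by
      simp only [Pi.zero_apply, Complex.zero_im, abs_zero]; linarith
    -- The sign of `C'` is unknown; replacing it by its absolute value requires the bound `C * err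
    -- i` to be nonnegative, which is read off at the origin.
    have hnn := (norm_nonneg _).trans (H i hi 0 h0)
    refine ((hC' ω (u i) (μ i) _ ((hu i).mono (by linarith)) (hdiv i) (H i hi)).2 θ hθ).trans ?_
    rw [mul_assoc]
    exact mul_le_mul_of_nonneg_right (le_abs_self C') hnn

/-- Entrywise version of `LocO`. -/
def MatO {κ₁ κ₂ : Type} (err : ι → ℝ) (ρ : ℝ) (w : ι → ℝ)
    (A : ι → (Fin d → ℂ) → Matrix κ₁ κ₂ ℂ) : Prop :=
  ∀ a b, LocO err ρ w fun i θ => A i θ a b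

namespace MatO

variable {κ κ₁ κ₂ κ₃ κ₄ : Type} {A B : ι → (Fin d → ℂ) → Matrix κ₁ κ₂ ℂ}

lemma congr (h : ∀ i, ∀ θ ∈ strip d ρ, B i θ = A i θ) (hA : MatO err ρ w A) : MatO err ρ w B :=
  fun a b => (hA a b).congr fun i θ hθ => by rw [h i θ hθ]

lemma add (hA : MatO err ρ w A) (hB : MatO err ρ w B) : MatO err ρ w fun i θ => A i θ + B i θ :=
  fun a b => (hA a b).add (hB a b)

lemma sub (hA : MatO err ρ w A) (hB : MatO err ρ w B) : MatO err ρ w fun i θ => A i θ - B i θ :=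
  fun a b => (hA a b).sub (hB a b)

lemma neg (hA : MatO err ρ w A) : MatO err ρ w fun i θ => - A i θ := fun a b => (hA a b).neg

lemma transpose (hA : MatO err ρ w A) : MatO err ρ w fun i θ => (A i θ)ᵀ := fun a b => hA b a

lemma const (A : Matrix κ₁ κ₂ ℂ) : MatO err ρ (fun _ => 1) fun (_ : ι) (_ : Fin d → ℂ) => A :=
  fun _ _ => LocO.const _

lemma const_smul (c : ℂ) (hA : MatO err ρ w A) : MatO err ρ w fun i θ => c • A i θ :=
  fun a b => (hA a b).const_mul c

lemma mul' [Fintype κ] {A : ι → (Fin d → ℂ) → Matrix κ₁ κ ℂ} {B : ι → (Fin d → ℂ) → Matrix κ κ₂ ℂ}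
    (hA : MatO err ρ w₁ A) (hB : MatO err ρ w₂ B) (hw : ∀ i, w₁ i * w₂ i = w i) :
    MatO err ρ w fun i θ => A i θ * B i θ := by
  intro a b
  simp only [Matrix.mul_apply]
  exact LocO.sum _ fun j _ => (hA a j).mul (hB j b) hw

lemma mul_bounded [Fintype κ] {A : ι → (Fin d → ℂ) → Matrix κ₁ κ ℂ}
    {B : ι → (Fin d → ℂ) → Matrix κ κ₂ ℂ}
    (hA : MatO err ρ w A) (hB : MatO err ρ (fun _ => 1) B) : MatO err ρ w fun i θ => A i θ * B i θ :=
  hA.mul' hB (fun i => mul_one (w i))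

lemma bounded_mul [Fintype κ] {A : ι → (Fin d → ℂ) → Matrix κ₁ κ ℂ}
    {B : ι → (Fin d → ℂ) → Matrix κ κ₂ ℂ}
    (hA : MatO err ρ (fun _ => 1) A) (hB : MatO err ρ w B) : MatO err ρ w fun i θ => A i θ * B i θ :=
  hA.mul' hB (fun i => one_mul (w i))

lemma toBounded (hA : MatO err ρ err A) : MatO err ρ (fun _ => 1) A := fun a b => (hA a b).toBounded

lemma lieMat {ω : Fin d → ℝ} (hA : MatO err ρ w A) (hol : ∀ i, MatHol (strip d ρ) (A i)) :
    MatO err ρ w fun i θ => lieMat ω (A i) θ :=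
  fun a b => ((hA a b).fderiv (fun i => hol i a b) _).neg

/-- All entries at once. -/
lemma exists_bound [Finite κ₁] [Finite κ₂] (h0 : ∀ i, 0 ≤ w i) (hA : MatO err ρ w A) {r : ℝ}
    (hr : r < ρ) :
    ∃ C, 0 ≤ C ∧ ∃ ε, 0 < ε ∧ ∀ i, err i ≤ ε → ∀ θ ∈ strip d r, ∀ a b, ‖A i θ a b‖ ≤ C * w i := by
  classical
  have := Fintype.ofFinite κ₁
  have := Fintype.ofFinite κ₂
  choose C hC ε hε H using fun p : κ₁ × κ₂ => hA p.1 p.2 r hr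
  have hle : ∀ s : Finset (κ₁ × κ₂), ∃ e, 0 < e ∧ ∀ p ∈ s, e ≤ ε p := by
    intro s
    induction s using Finset.induction_on with
    | empty => exact ⟨1, one_pos, by simp⟩
    | insert p s hp ih =>
      obtain ⟨e, he, h⟩ := ih
      refine ⟨min e (ε p), lt_min he (hε p), fun q hq => ?_⟩
      rcases Finset.mem_insert.1 hq with rfl | hq
      · exact min_le_right _ _
      · exact (min_le_left _ _).trans (h q hq)
  obtain ⟨e, he, h⟩ := hle Finset.univ
  refine ⟨∑ p, C p, Finset.sum_nonneg fun p _ => hC p, e, he, fun i hi θ hθ a b => ?_⟩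
  refine (H (a, b) i (hi.trans (h _ (Finset.mem_univ _))) θ hθ).trans ?_
  exact mul_le_mul_of_nonneg_right
    (Finset.single_le_sum (fun p _ => hC p) (Finset.mem_univ (a, b))) (h0 i)

end MatO

end Estimates

/-! ### Algebra of the frame -/

section FrameAlgebra

variable {ν δ κ : Type} [Fintype ν] [DecidableEq ν] [Fintype δ] [DecidableEq δ] [Fintype κ]
  {Ω G J : Matrix ν ν ℂ} {L N : Matrix ν δ ℂ} {W : Matrix ν κ ℂ}
  {A B : Matrix δ δ ℂ} {C : Matrix κ δ ℂ}

/-- The algebraic relations between the ingredients of the frame. -/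
structure FrameRelations (Ω G J : Matrix ν ν ℂ) (L : Matrix ν δ ℂ) (W : Matrix ν κ ℂ)
    (A B : Matrix δ δ ℂ) (C : Matrix κ δ ℂ) (N : Matrix ν δ ℂ) : Prop where
  Ω_transpose : Ωᵀ = -Ω
  compatible : Jᵀ * Ω = G
  J_sq : J * J = -1
  G_symm : Gᵀ = G
  GLL_mul_B : Lᵀ * G * L * B = 1
  ΩWW_mul_C : Wᵀ * Ω * W * C = Wᵀ * G * L * B
  A_eq : A = (1 / 2 : ℂ) • (Cᵀ * (Wᵀ * Ω * W) * C)
  N_eq : N = L * A + J * L * B + W * C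

namespace FrameRelations

lemma Ω_mul_J (h : FrameRelations Ω G J L W A B C N) : Ω * J = -G := by
  have h1 := congrArg Matrix.transpose h.compatible
  rw [Matrix.transpose_mul, Matrix.transpose_transpose, h.Ω_transpose, h.G_symm, Matrix.neg_mul] at h1
  rw [← h1, neg_neg]

lemma G_mul_J (h : FrameRelations Ω G J L W A B C N) : G * J = Ω := by
  have h1 : G = -(Ω * J) := by rw [h.Ω_mul_J, neg_neg]
  rw [h1, Matrix.neg_mul, Matrix.mul_assoc, h.J_sq, Matrix.mul_neg, Matrix.mul_one, neg_neg]

lemma Bt_mul_GLL (h : FrameRelations Ω G J L W A B C N) : Bᵀ * (Lᵀ * G * L) = 1 := by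
  have h1 := congrArg Matrix.transpose h.GLL_mul_B
  simpa [Matrix.transpose_mul, h.G_symm, Matrix.mul_assoc] using h1

lemma Ct_mul_ΩWW (h : FrameRelations Ω G J L W A B C N) :
    Cᵀ * (Wᵀ * Ω * W) = -(Bᵀ * (Lᵀ * G * W)) := by
  have h1 := congrArg Matrix.transpose h.ΩWW_mul_C
  simp only [Matrix.transpose_mul, h.G_symm, h.Ω_transpose, Matrix.transpose_transpose,
    Matrix.mul_assoc, Matrix.neg_mul, Matrix.mul_neg] at h1
  simp only [Matrix.mul_assoc]
  rw [← h1, neg_neg]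

/-- `A` inherits antisymmetry from `Ω_WW`. -/
lemma A_transpose (h : FrameRelations Ω G J L W A B C N) : Aᵀ = -A := by
  rw [h.A_eq]
  simp [Matrix.transpose_mul, h.Ω_transpose, Matrix.mul_assoc]

lemma Nt_mul_Ω (h : FrameRelations Ω G J L W A B C N) :
    Nᵀ * Ω = Aᵀ * (Lᵀ * Ω) + Bᵀ * (Lᵀ * G) + Cᵀ * (Wᵀ * Ω) := by
  rw [h.N_eq]
  simp only [Matrix.transpose_add, Matrix.transpose_mul, Matrix.add_mul, Matrix.mul_assoc,
    h.compatible]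

/-- The summand `J L B` pairs with `L` to `Bᵀ G_LL = 1`, by compatibility; the other two leave only
`Ω_LL` and `Ω_WL`. -/
lemma ΩNL (h : FrameRelations Ω G J L W A B C N) :
    Nᵀ * Ω * L = 1 + (Aᵀ * (Lᵀ * Ω * L) + Cᵀ * (Wᵀ * Ω * L)) := by
  have h1 := h.Bt_mul_GLL
  simp only [Matrix.mul_assoc] at h1
  rw [h.Nt_mul_Ω]
  simp only [Matrix.add_mul, Matrix.mul_assoc, h1]
  abel

/-- `C` is chosen for this: `Cᵀ Ω_WW` cancels the pairing `Bᵀ G_LW` of `J L B` with `W`. -/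
lemma ΩNW (h : FrameRelations Ω G J L W A B C N) :
    Nᵀ * Ω * W = Aᵀ * (Lᵀ * Ω * W) := by
  have h1 := h.Ct_mul_ΩWW
  simp only [Matrix.mul_assoc] at h1
  rw [h.Nt_mul_Ω]
  simp only [Matrix.add_mul, Matrix.mul_assoc, h1]
  abel

/-- Since `ΩJ = -G`, the summand `L A` contributes `A` and the summand `W C` contributes `-Cᵀ Ω_WW C
= -2A`; since `GJ = Ω`, the summand `J L B` contributes the `Ω_LL` term. -/
lemma ΩNJLB (h : FrameRelations Ω G J L W A B C N) :
    Nᵀ * Ω * (J * L * B) = -A + Bᵀ * (Lᵀ * Ω * L) * B := by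
  have h1 : Aᵀ * (Lᵀ * (Ω * (J * (L * B)))) = A := by
    have h2 := h.GLL_mul_B
    simp only [Matrix.mul_assoc] at h2
    rw [← Matrix.mul_assoc Ω, h.Ω_mul_J, Matrix.neg_mul, Matrix.mul_neg, h2, h.A_transpose]
    simp
  have h3 : Cᵀ * (Wᵀ * (Ω * (J * (L * B)))) = -(A + A) := by
    have h2 := h.ΩWW_mul_C
    simp only [Matrix.mul_assoc] at h2
    rw [← Matrix.mul_assoc Ω, h.Ω_mul_J, Matrix.neg_mul, Matrix.mul_neg, ← h2, Matrix.mul_neg,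
      h.A_eq, ← add_smul]
    norm_num [Matrix.mul_assoc]
  rw [h.Nt_mul_Ω]
  simp only [Matrix.add_mul, Matrix.mul_assoc]
  rw [h1, h3, ← Matrix.mul_assoc G, h.G_mul_J]
  abel

/-- The `-A` of `ΩNJLB` cancels the main term of `Ω_NL A`. This is what the factor `1/2` in `A`
achieves: `N` is Lagrangian up to the isotropy and orthogonality defects. -/
lemma ΩNN (h : FrameRelations Ω G J L W A B C N) :
    Nᵀ * Ω * N = Aᵀ * (Lᵀ * Ω * L) * A + Cᵀ * (Wᵀ * Ω * L) * A + Bᵀ * (Lᵀ * Ω * L) * B +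
      Aᵀ * (Lᵀ * Ω * W) * C := by
  have h1 : Nᵀ * Ω * N = Nᵀ * Ω * L * A + Nᵀ * Ω * (J * L * B) + Nᵀ * Ω * W * C := by
    refine (congrArg (Nᵀ * Ω * ·) h.N_eq).trans ?_
    simp only [Matrix.mul_add, Matrix.mul_assoc]
  rw [h1, h.ΩNL, h.ΩNJLB, h.ΩNW]
  simp only [Matrix.add_mul, Matrix.one_mul]
  abel

end FrameRelations

end FrameAlgebra

/-! ### Approximately invariant tori -/

section Admissible

variable {d n m : ℕ} {S : SymplecticSetting n}

/-- A torus and a bundle subject to the hypotheses of the reducibility lemma, with a common bound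
`err` for the invariance errors. -/
structure ApproxTorus (H : HamiltonianFamily S m) (ω : Fin d → ℝ) (β : Fin m → ℝ)
    (Z : Set (Fin (2 * n) → ℂ)) (Q : Set (Fin m → ℝ)) (ρ M : ℝ) where
  K : (Fin d → ℂ) → (Fin (2 * n) → ℂ)
  W : (Fin d → ℂ) → Matrix (Fin (2 * n)) (Fin m ⊕ Fin m) ℂ
  lam : Fin m → ℝ
  α : Fin m → ℝ
  err : ℝ
  K_analytic : ∀ r, IsTorusAnalytic ρ fun θ => K θ r
  W_analytic : ∀ r s, IsTorusAnalytic ρ fun θ => W θ r s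
  K_mem : ∀ θ ∈ strip d ρ, K θ ∈ Z
  K_mem_U : ∀ θ ∈ strip d ρ, K θ ∈ S.U
  lam_mem : lam ∈ Q
  lam_mem_Par : lam ∈ H.Par
  err_nonneg : 0 ≤ err
  W_le : ∀ θ ∈ strip d ρ, ∀ r s, ‖W θ r s‖ ≤ M
  isUnit_GLL : ∀ θ ∈ strip d ρ, IsUnit (pull S.G K (jacobian K) (jacobian K) θ)
  isUnit_ΩWW : ∀ θ ∈ strip d ρ, IsUnit (pull S.Ω K W W θ)
  inv_GLL_le : ∀ θ ∈ strip d ρ, ∀ r s, ‖(pull S.G K (jacobian K) (jacobian K) θ)⁻¹ r s‖ ≤ M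
  inv_ΩWW_le : ∀ θ ∈ strip d ρ, ∀ r s, ‖(pull S.Ω K W W θ)⁻¹ r s‖ ≤ M
  errK_le : ∀ θ ∈ strip d ρ, ∀ r, ‖errK H ω K lam θ r‖ ≤ err
  errW_le : ∀ θ ∈ strip d ρ, ∀ r s, ‖errW H ω β K W lam α θ r s‖ ≤ err

variable {H : HamiltonianFamily S m} {ω : Fin d → ℝ} {β : Fin m → ℝ}
  {Z : Set (Fin (2 * n) → ℂ)} {Q : Set (Fin m → ℝ)} {ρ M : ℝ}

namespace ApproxTorus

section Holomorphy

variable (T : ApproxTorus H ω β Z Q ρ M)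

/-- The tangent frame. -/
def L : (Fin d → ℂ) → Matrix (Fin (2 * n)) (Fin d) ℂ := jacobian T.K

/-- The normal frame. -/
def N : (Fin d → ℂ) → Matrix (Fin (2 * n)) (Fin d) ℂ := frameN S T.K T.W

lemma K_hol (r : Fin (2 * n)) : DifferentiableOn ℂ (fun θ => T.K θ r) (strip d ρ) :=
  (T.K_analytic r).holomorphic

lemma comp_hol {κ₁ κ₂ : Type} {F : (Fin (2 * n) → ℂ) → Matrix κ₁ κ₂ ℂ} (hF : MatHol S.U F) :
    MatHol (strip d ρ) fun θ => F (T.K θ) := hF.comp T.K_hol T.K_mem_U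

lemma L_hol : MatHol (strip d ρ) T.L := matHol_jacobian (isOpen_strip d ρ) T.K_hol

lemma W_hol : MatHol (strip d ρ) T.W := fun r s => (T.W_analytic r s).holomorphic

lemma pull_hol {κ₁ κ₂ : Type} {F : (Fin (2 * n) → ℂ) → Matrix (Fin (2 * n)) (Fin (2 * n)) ℂ}
    (hF : MatHol S.U F) {V₁ : (Fin d → ℂ) → Matrix (Fin (2 * n)) κ₁ ℂ}
    {V₂ : (Fin d → ℂ) → Matrix (Fin (2 * n)) κ₂ ℂ} (h₁ : MatHol (strip d ρ) V₁)
    (h₂ : MatHol (strip d ρ) V₂) : MatHol (strip d ρ) (pull F T.K V₁ V₂) :=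
  (h₁.transpose.mul (T.comp_hol hF)).mul h₂

lemma B_hol : MatHol (strip d ρ) (frameB S T.K) :=
  (T.pull_hol S.G_holomorphic T.L_hol T.L_hol).inv T.isUnit_GLL

lemma C_hol : MatHol (strip d ρ) (frameC S T.K T.W) :=
  (((T.pull_hol S.matHol_Ω T.W_hol T.W_hol).inv T.isUnit_ΩWW).mul
    (T.pull_hol S.G_holomorphic T.W_hol T.L_hol)).mul T.B_hol

lemma A_hol : MatHol (strip d ρ) (frameA S T.K T.W) :=
  ((T.C_hol.transpose.mul (T.pull_hol S.matHol_Ω T.W_hol T.W_hol)).mul T.C_hol).const_smul _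

lemma N_hol : MatHol (strip d ρ) T.N :=
  ((T.L_hol.mul T.A_hol).add (((T.comp_hol S.J_holomorphic).mul T.L_hol).mul T.B_hol)).add
    (T.W_hol.mul T.C_hol)

lemma frameRelations (hρ : 0 < ρ) {θ : Fin d → ℂ} (hθ : θ ∈ strip d ρ) :
    FrameRelations (S.Ω (T.K θ)) (S.G (T.K θ)) (S.J (T.K θ)) (T.L θ) (T.W θ)
      (frameA S T.K T.W θ) (frameB S T.K θ) (frameC S T.K T.W θ) (T.N θ) where
  Ω_transpose := S.Ω_transpose _
  compatible := compatible_on_strip S hρ T.K_analytic T.K_mem_U hθ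
  J_sq := J_sq_on_strip S hρ T.K_analytic T.K_mem_U hθ
  G_symm := G_symm_on_strip S hρ T.K_analytic T.K_mem_U hθ
  GLL_mul_B := Matrix.mul_nonsing_inv _ ((Matrix.isUnit_iff_isUnit_det _).1 (T.isUnit_GLL θ hθ))
  ΩWW_mul_C := by
    have h := Matrix.mul_nonsing_inv _ ((Matrix.isUnit_iff_isUnit_det _).1 (T.isUnit_ΩWW θ hθ))
    change pull S.Ω T.K T.W T.W θ * frameC S T.K T.W θ = pull S.G T.K T.W T.L θ * frameB S T.K θ
    rw [frameC, ← Matrix.mul_assoc, ← Matrix.mul_assoc, h, Matrix.one_mul]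
    rfl
  A_eq := rfl
  N_eq := rfl

end Holomorphy

variable (H ω β Z Q ρ M)

/-- Uniformly bounded families. -/
abbrev Bdd {κ₁ κ₂ : Type}
    (A : ApproxTorus H ω β Z Q ρ M → (Fin d → ℂ) → Matrix κ₁ κ₂ ℂ) : Prop :=
  MatO err ρ (fun _ => 1) A

/-- Families bounded by a multiple of the error. -/
abbrev Small {κ₁ κ₂ : Type}
    (A : ApproxTorus H ω β Z Q ρ M → (Fin d → ℂ) → Matrix κ₁ κ₂ ℂ) : Prop :=
  MatO err ρ err A

variable {H ω β Z Q ρ M}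

section Bounds

lemma comp_bounded (hZ : IsCompact Z) (hZU : Z ⊆ S.U) {κ₁ κ₂ : Type}
    {F : (Fin (2 * n) → ℂ) → Matrix κ₁ κ₂ ℂ} (hF : MatHol S.U F) :
    Bdd H ω β Z Q ρ M fun T θ => F (T.K θ) := by
  intro a b
  obtain ⟨C, hC⟩ := hZ.exists_bound_of_continuousOn ((hF a b).continuousOn.mono hZU)
  refine LocO.of_bound (abs_nonneg C) fun T θ hθ => ?_
  rw [mul_one]
  exact (hC _ (T.K_mem θ hθ)).trans (le_abs_self C)

/-- No bound on `DK` is assumed: it follows from `K` taking values in a compact set, by Cauchy's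
estimate. -/
lemma L_bounded (hZ : IsCompact Z) : Bdd H ω β Z Q ρ M fun T => T.L := by
  intro r j
  obtain ⟨C, hC⟩ := hZ.exists_bound_of_continuousOn
    (f := fun z : Fin (2 * n) → ℂ => z r) (by fun_prop)
  have h : LocO (ApproxTorus.err (H := H) (ω := ω) (β := β) (Z := Z) (Q := Q) (ρ := ρ) (M := M)) ρ
      (fun _ => 1) fun T θ => T.K θ r := by
    refine LocO.of_bound (abs_nonneg C) fun T θ hθ => ?_
    rw [mul_one]
    exact (hC _ (T.K_mem θ hθ)).trans (le_abs_self C)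
  exact h.fderiv (fun T => T.K_hol r) _

lemma W_bounded (hM : 0 ≤ M) : Bdd H ω β Z Q ρ M fun T => T.W := fun r s =>
  LocO.of_bound hM fun T θ hθ => by rw [mul_one]; exact T.W_le θ hθ r s

lemma B_bounded (hM : 0 ≤ M) : Bdd H ω β Z Q ρ M fun T => frameB S T.K := fun r s =>
  LocO.of_bound hM fun T θ hθ => by rw [mul_one]; exact T.inv_GLL_le θ hθ r s

lemma inv_ΩWW_bounded (hM : 0 ≤ M) :
    Bdd H ω β Z Q ρ M fun T θ => (pull S.Ω T.K T.W T.W θ)⁻¹ := fun r s =>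
  LocO.of_bound hM fun T θ hθ => by rw [mul_one]; exact T.inv_ΩWW_le θ hθ r s

lemma pull_bounded (hZ : IsCompact Z) (hZU : Z ⊆ S.U) {κ₁ κ₂ : Type}
    {F : (Fin (2 * n) → ℂ) → Matrix (Fin (2 * n)) (Fin (2 * n)) ℂ} (hF : MatHol S.U F)
    {V₁ : ApproxTorus H ω β Z Q ρ M → (Fin d → ℂ) → Matrix (Fin (2 * n)) κ₁ ℂ}
    {V₂ : ApproxTorus H ω β Z Q ρ M → (Fin d → ℂ) → Matrix (Fin (2 * n)) κ₂ ℂ}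
    (h₁ : Bdd H ω β Z Q ρ M V₁) (h₂ : Bdd H ω β Z Q ρ M V₂) :
    Bdd H ω β Z Q ρ M fun T => pull F T.K (V₁ T) (V₂ T) :=
  (h₁.transpose.mul_bounded (comp_bounded hZ hZU hF)).mul_bounded h₂

lemma C_bounded (hZ : IsCompact Z) (hZU : Z ⊆ S.U) (hM : 0 ≤ M) :
    Bdd H ω β Z Q ρ M fun T => frameC S T.K T.W :=
  ((inv_ΩWW_bounded hM).mul_bounded (pull_bounded hZ hZU S.G_holomorphic (W_bounded hM)
    (L_bounded hZ))).mul_bounded (B_bounded hM)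

lemma A_bounded (hZ : IsCompact Z) (hZU : Z ⊆ S.U) (hM : 0 ≤ M) :
    Bdd H ω β Z Q ρ M fun T => frameA S T.K T.W :=
  (((C_bounded hZ hZU hM).transpose.mul_bounded (pull_bounded hZ hZU S.matHol_Ω (W_bounded hM)
    (W_bounded hM))).mul_bounded (C_bounded hZ hZU hM)).const_smul _

lemma N_bounded (hZ : IsCompact Z) (hZU : Z ⊆ S.U) (hM : 0 ≤ M) :
    Bdd H ω β Z Q ρ M fun T => T.N :=
  (((L_bounded hZ).mul_bounded (A_bounded hZ hZU hM)).add
    (((comp_bounded hZ hZU S.J_holomorphic).mul_bounded (L_bounded hZ)).mul_bounded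
      (B_bounded hM))).add ((W_bounded hM).mul_bounded (C_bounded hZ hZU hM))

lemma linOp_N_bounded (hZ : IsCompact Z) (hZU : Z ⊆ S.U) (hQ : IsCompact Q) (hQP : Q ⊆ H.Par)
    (hM : 0 ≤ M) : Bdd H ω β Z Q ρ M fun T => linOp H ω T.K T.lam T.N := by
  obtain ⟨C, hC0, hC⟩ := H.exists_jacobian_X_bound hZ hZU hQ hQP
  have h : Bdd H ω β Z Q ρ M fun T θ => jacobian (H.X T.lam) (T.K θ) := fun r s =>
    LocO.of_bound hC0 fun T θ hθ => by rw [mul_one]; exact hC _ T.lam_mem _ (T.K_mem θ hθ) r s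
  exact ((N_bounded hZ hZU hM).lieMat fun T => T.N_hol).add (h.mul_bounded (N_bounded hZ hZU hM))

lemma errW_small : Small H ω β Z Q ρ M fun T => errW H ω β T.K T.W T.lam T.α := fun r s =>
  LocO.of_bound zero_le_one fun T θ hθ => by rw [one_mul]; exact T.errW_le θ hθ r s

lemma errK_small (r : Fin (2 * n)) :
    LocO (ApproxTorus.err (H := H) (ω := ω) (β := β) (Z := Z) (Q := Q) (ρ := ρ) (M := M)) ρ
      ApproxTorus.err fun T θ => errK H ω T.K T.lam θ r :=
  LocO.of_bound zero_le_one fun T θ hθ => by rw [one_mul]; exact T.errK_le θ hθ r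

/-- `𝒳_L = D E_K`, so Cauchy's estimate applies to the error. -/
lemma linOp_L_small : Small H ω β Z Q ρ M fun T => linOp H ω T.K T.lam T.L :=
  MatO.congr (fun T _ hθ => linOp_jacobian H ω T.lam_mem_Par T.K_hol T.K_mem_U hθ)
    fun r _ => (errK_small r).fderiv
      (fun T => errK_holomorphic H ω T.lam_mem_Par T.K_hol T.K_mem_U r) _

lemma dΩ_errK_small (hZ : IsCompact Z) (hZU : Z ⊆ S.U) :
    Small H ω β Z Q ρ M fun T θ => S.dΩ (T.K θ) (errK H ω T.K T.lam θ) := by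
  intro r s
  refine LocO.congr (fun T θ _ => S.dΩ_apply _ _ r s) (LocO.sum _ fun t _ => ?_)
  have hF : MatHol S.U fun z => S.dΩ z (Pi.single t 1) := fun r s =>
    differentiableOn_fderiv_apply S.isOpen_U (S.matHol_Ω r s) _
  exact (comp_bounded hZ hZU hF r s).mul (errK_small t) fun T => one_mul _

end Bounds

end ApproxTorus

end Admissible

/-! ### Small divisors of the normal frequencies -/

section Divisors

variable {d m : ℕ} {γ τ : ℝ} {ω : Fin d → ℝ} {β : Fin m → ℝ}

/-- The normal frequencies with both signs. -/
def signedFreq (β : Fin m → ℝ) : Fin m ⊕ Fin m → ℝ := Sum.elim (fun j => -β j) β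

/-- The index of a normal frequency. -/
def freqIndex : Fin m ⊕ Fin m → Fin m := Sum.elim id id

lemma l1_neg (k : Fin d → ℤ) : l1 (-k) = l1 k := by simp [l1]

lemma sum_neg_mul (k : Fin d → ℤ) (ω : Fin d → ℝ) :
    ∑ l, ((-k) l : ℝ) * ω l = -∑ l, (k l : ℝ) * ω l := by
  simp

lemma DiophantineMelnikov.divisor_zero (h : DiophantineMelnikov γ τ ω β) {k : Fin d → ℤ} (hk : k ≠ 0) :
    γ / l1 k ^ τ ≤ |(∑ l, (k l : ℝ) * ω l) + 0| := by
  simpa [l1] using h.diophantine k hk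

/-- The hypothesis has only the sign `-β`; the other sign comes from replacing `k` by `-k`. -/
lemma DiophantineMelnikov.divisor_first (h : DiophantineMelnikov γ τ ω β) {k : Fin d → ℤ} (hk : k ≠ 0)
    (a : Fin m ⊕ Fin m) : γ / l1 k ^ τ ≤ |(∑ l, (k l : ℝ) * ω l) + signedFreq β a| := by
  rcases a with j | j
  · simpa [signedFreq, sub_eq_add_neg, l1] using h.melnikov_first k hk j
  · have h1 : γ / l1 (-k) ^ τ ≤ |(∑ l, ((-k) l : ℝ) * ω l) - β j| := by
      simpa [l1] using h.melnikov_first (-k) (neg_ne_zero.2 hk) j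
    rw [l1_neg, sum_neg_mul, ← neg_add', abs_neg] at h1
    exact h1

/-- Of the four sign patterns, two are hypotheses; the pattern `(+, -)` exchanges the indices and
`(+, +)` replaces `k` by `-k`. -/
lemma DiophantineMelnikov.divisor_second (h : DiophantineMelnikov γ τ ω β) {k : Fin d → ℤ}
    (hk : k ≠ 0) {a b : Fin m ⊕ Fin m} (hab : freqIndex a ≠ freqIndex b) :
    γ / l1 k ^ τ ≤ |(∑ l, (k l : ℝ) * ω l) + (signedFreq β a + signedFreq β b)| := by
  rcases a with i | i <;> rcases b with j | j
  · refine (h.melnikov_second_sub k hk i j hab).trans (le_of_eq ?_)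
    congr 1; simp only [signedFreq, Sum.elim_inl]; ring
  · refine (h.melnikov_second_add k hk i j hab).trans (le_of_eq ?_)
    congr 1; simp only [signedFreq, Sum.elim_inl, Sum.elim_inr]; ring
  · refine (h.melnikov_second_add k hk j i hab.symm).trans (le_of_eq ?_)
    congr 1; simp only [signedFreq, Sum.elim_inl, Sum.elim_inr]; ring
  · have h1 : γ / l1 (-k) ^ τ ≤ |(∑ l, ((-k) l : ℝ) * ω l) - β i - β j| := by
      simpa [l1] using h.melnikov_second_sub (-k) (neg_ne_zero.2 hk) i j hab
    rw [l1_neg, sum_neg_mul, ← abs_neg] at h1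
    refine h1.trans (le_of_eq ?_)
    congr 1; simp only [signedFreq, Sum.elim_inr]; ring

lemma DiophantineMelnikov.signedFreq_ne (h : DiophantineMelnikov γ τ ω β) (a : Fin m ⊕ Fin m) :
    signedFreq β a ≠ 0 := by
  rcases a with j | j
  · simpa [signedFreq] using h.β_ne_zero j
  · simpa [signedFreq] using h.β_ne_zero j

lemma DiophantineMelnikov.signedFreq_add_ne (h : DiophantineMelnikov γ τ ω β) {a b : Fin m ⊕ Fin m}
    (hab : freqIndex a ≠ freqIndex b) : signedFreq β a + signedFreq β b ≠ 0 := by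
  have habs : ∀ a, |signedFreq β a| = |β (freqIndex a)| := by
    rintro (j | j) <;> simp [signedFreq, freqIndex]
  intro h0
  apply h.abs_β_ne _ _ hab
  rw [← habs, ← habs, eq_neg_of_add_eq_zero_left h0, abs_neg]

/-- The eigenvalues of `Γ_{α,β}`. -/
def gamEig (α β : Fin m → ℝ) (a : Fin m ⊕ Fin m) : ℂ :=
  (α (freqIndex a) : ℂ) + (signedFreq β a : ℂ) * Complex.I

/-- The eigenvectors of `Γ_{α,β}`. -/
def gamVec (m : ℕ) : Matrix (Fin m ⊕ Fin m) (Fin m ⊕ Fin m) ℂ :=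
  Matrix.fromBlocks 1 1 (Complex.I • 1) (-Complex.I • 1)

/-- The inverse of the matrix of eigenvectors. -/
def gamVecInv (m : ℕ) : Matrix (Fin m ⊕ Fin m) (Fin m ⊕ Fin m) ℂ :=
  (1 / 2 : ℂ) • Matrix.fromBlocks 1 (-Complex.I • 1) 1 (Complex.I • 1)

lemma gamVec_mul_inv : gamVec m * gamVecInv m = 1 := by
  rw [gamVec, gamVecInv, Matrix.mul_smul, Matrix.fromBlocks_multiply, ← Matrix.fromBlocks_one,
    Matrix.fromBlocks_smul]
  congr 1 <;> simp only [Matrix.mul_one, Matrix.mul_smul, smul_smul,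
    ← add_smul, smul_add, neg_mul, Complex.I_mul_I, mul_neg, neg_neg] <;> norm_num

/-- In each plane `Γ` is a rotation-scaling, with eigenvectors `(1, ±i)` and eigenvalues `α ∓ iβ`.
-/
lemma Gam_mul_gamVec (α β : Fin m → ℝ) :
    Gam α β * gamVec m = gamVec m * Matrix.diagonal (gamEig α β) := by
  ext a b
  rw [Matrix.mul_diagonal]
  have hI := Complex.I_mul_I
  rcases a with i | i <;> rcases b with j | j <;>
    simp only [Gam, gamVec, Matrix.fromBlocks_multiply, Matrix.fromBlocks_apply₁₁,
      Matrix.fromBlocks_apply₁₂, Matrix.fromBlocks_apply₂₁, Matrix.fromBlocks_apply₂₂,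
      Matrix.add_apply, Matrix.mul_one, Matrix.mul_smul, Matrix.smul_apply, Matrix.neg_apply,
      gamEig, freqIndex, signedFreq, Sum.elim_inl, Sum.elim_inr, id, smul_eq_mul] <;>
    rcases eq_or_ne i j with rfl | hij
  all_goals first
    | simp [hij]
    | simp only [Matrix.diagonal_apply_eq, Matrix.one_apply_eq, complexify]
      push_cast
      first
        | ring1
        | linear_combination (β i : ℂ) * hI

end Divisors

/-! ### Approximate symplectic orthogonality -/

section Periodic

variable {k d : ℕ} {ρ : ℝ} {κ κ₁ κ₂ : Type}

/-- All entries of a matrix-valued map are holomorphic and periodic on the strip. -/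
def MatPer (ρ : ℝ) (A : (Fin d → ℂ) → Matrix κ₁ κ₂ ℂ) : Prop :=
  ∀ r c, IsStripPeriodic ρ fun θ => A θ r c

lemma MatPer.matHol {A : (Fin d → ℂ) → Matrix κ₁ κ₂ ℂ} (hA : MatPer ρ A) : MatHol (strip d ρ) A :=
  fun r c => (hA r c).holomorphic

lemma MatPer.transpose {A : (Fin d → ℂ) → Matrix κ₁ κ₂ ℂ} (hA : MatPer ρ A) :
    MatPer ρ fun θ => (A θ)ᵀ := fun r c => hA c r

lemma MatPer.const (A : Matrix κ₁ κ₂ ℂ) : MatPer ρ fun _ : Fin d → ℂ => A :=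
  fun _ _ => IsStripPeriodic.const _

lemma MatPer.mul [Fintype κ] {A : (Fin d → ℂ) → Matrix κ₁ κ ℂ} {B : (Fin d → ℂ) → Matrix κ κ₂ ℂ}
    (hA : MatPer ρ A) (hB : MatPer ρ B) : MatPer ρ fun θ => A θ * B θ := by
  intro r c
  simp only [Matrix.mul_apply]
  exact IsStripPeriodic.sum _ fun j _ => (hA r j).mul (hB j c)

lemma IsStripPeriodic.comp {U : Set (Fin k → ℂ)} {f : (Fin k → ℂ) → ℂ}
    {K : (Fin d → ℂ) → (Fin k → ℂ)} (hf : DifferentiableOn ℂ f U)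
    (hK : ∀ r, IsStripPeriodic ρ fun θ => K θ r) (hKU : ∀ θ ∈ strip d ρ, K θ ∈ U) :
    IsStripPeriodic ρ fun θ => f (K θ) :=
  ⟨differentiableOn_comp hf (fun r => (hK r).holomorphic) hKU, fun θ hθ j => by
    rw [show K (θ + Pi.single j ((2 * Real.pi : ℝ) : ℂ)) = K θ from
      funext fun r => (hK r).periodic θ hθ j]⟩

end Periodic

namespace ApproxTorus

variable {d n m : ℕ} {S : SymplecticSetting n} {H : HamiltonianFamily S m} {ω : Fin d → ℝ}
  {β : Fin m → ℝ} {Z : Set (Fin (2 * n) → ℂ)} {Q : Set (Fin m → ℝ)} {ρ M : ℝ} {κ κ₁ κ₂ : Type}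

section

variable (T : ApproxTorus H ω β Z Q ρ M)

lemma K_per (r : Fin (2 * n)) : IsStripPeriodic ρ fun θ => T.K θ r := (T.K_analytic r).isStripPeriodic

lemma L_per : MatPer ρ T.L := fun r c => (T.K_per r).fderiv_apply (Pi.single c 1)

lemma W_per : MatPer ρ T.W := fun r s => (T.W_analytic r s).isStripPeriodic

/-- The complex frame of the normal bundle that diagonalizes `Γ_{α,β}`. -/
def V (θ : Fin d → ℂ) : Matrix (Fin (2 * n)) (Fin m ⊕ Fin m) ℂ := T.W θ * gamVec m

lemma V_per : MatPer ρ T.V := T.W_per.mul (MatPer.const _)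

lemma pull_Ω_per {V₁ : (Fin d → ℂ) → Matrix (Fin (2 * n)) κ₁ ℂ}
    {V₂ : (Fin d → ℂ) → Matrix (Fin (2 * n)) κ₂ ℂ} (h₁ : MatPer ρ V₁) (h₂ : MatPer ρ V₂) :
    MatPer ρ (pull S.Ω T.K V₁ V₂) :=
  (h₁.transpose.mul fun r s => IsStripPeriodic.comp (S.matHol_Ω r s) T.K_per T.K_mem_U).mul h₂

lemma pullPrimitive_per (j : Fin d) : IsStripPeriodic ρ (pullPrimitive S T.K j) :=
  IsStripPeriodic.sum _ fun r _ =>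
    (IsStripPeriodic.comp (S.a_apply_holomorphic r) T.K_per T.K_mem_U).mul (T.L_per r j)

lemma linOp_V {θ : Fin d → ℂ} (hθ : θ ∈ strip d ρ) :
    linOp H ω T.K T.lam T.V θ - T.V θ * Matrix.diagonal (gamEig T.α β) =
      errW H ω β T.K T.W T.lam T.α θ * gamVec m := by
  have h1 : lieMat ω T.V θ = lieMat ω T.W θ * gamVec m := by
    have h0 : lieMat ω (fun _ : Fin d → ℂ => gamVec m) θ = 0 := by
      ext r c; simp [lieMat]
    change lieMat ω (fun η => T.W η * gamVec m) θ = _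
    rw [lieMat_mul (isOpen_strip d ρ) T.W_hol (MatHol.const _) hθ, h0, Matrix.mul_zero, add_zero]
  simp only [errW, linOp, h1, V]
  rw [Matrix.mul_assoc, ← Gam_mul_gamVec]
  simp only [Matrix.add_mul, Matrix.sub_mul, Matrix.mul_assoc]

end

lemma V_bounded (hM : 0 ≤ M) : Bdd H ω β Z Q ρ M fun T => T.V :=
  (W_bounded hM).mul_bounded (MatO.const _)

lemma linOp_V_small :
    Small H ω β Z Q ρ M fun T θ =>
      linOp H ω T.K T.lam T.V θ - T.V θ * Matrix.diagonal (gamEig T.α β) :=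
  MatO.congr (fun T _ hθ => T.linOp_V hθ) (errW_small.mul_bounded (MatO.const _))

/-- The tangent frame regarded as an approximate eigenframe with eigenvalue zero, so that one
equation serves the products `LL`, `LV` and `VV`. -/
lemma linOp_L_small' :
    Small H ω β Z Q ρ M fun T θ =>
      linOp H ω T.K T.lam T.L θ - T.L θ * Matrix.diagonal (fun _ : Fin d => (0 : ℂ)) :=
  MatO.congr (fun T θ _ => by simp) linOp_L_small

/-- Symplectic products of approximately invariant frames satisfy an approximate
cohomological equation. -/
lemma pull_Ω_equation [Fintype κ₁] [DecidableEq κ₁] [Fintype κ₂] [DecidableEq κ₂]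
    (hZ : IsCompact Z) (hZU : Z ⊆ S.U)
    {V₁ : ApproxTorus H ω β Z Q ρ M → (Fin d → ℂ) → Matrix (Fin (2 * n)) κ₁ ℂ}
    {V₂ : ApproxTorus H ω β Z Q ρ M → (Fin d → ℂ) → Matrix (Fin (2 * n)) κ₂ ℂ}
    {D₁ : ApproxTorus H ω β Z Q ρ M → κ₁ → ℂ} {D₂ : ApproxTorus H ω β Z Q ρ M → κ₂ → ℂ}
    (hV₁ : ∀ T, MatPer ρ (V₁ T)) (hV₂ : ∀ T, MatPer ρ (V₂ T))
    (hb₁ : Bdd H ω β Z Q ρ M V₁) (hb₂ : Bdd H ω β Z Q ρ M V₂)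
    (h₁ : Small H ω β Z Q ρ M fun T θ =>
      linOp H ω T.K T.lam (V₁ T) θ - V₁ T θ * Matrix.diagonal (D₁ T))
    (h₂ : Small H ω β Z Q ρ M fun T θ =>
      linOp H ω T.K T.lam (V₂ T) θ - V₂ T θ * Matrix.diagonal (D₂ T)) (a : κ₁) (b : κ₂) :
    LocO err ρ err fun (T : ApproxTorus H ω β Z Q ρ M) θ =>
      -fderiv ℂ (fun η => pull S.Ω T.K (V₁ T) (V₂ T) η a b) θ (complexify ω) -
        (D₁ T a + D₂ T b) * pull S.Ω T.K (V₁ T) (V₂ T) θ a b := by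
  have hΩ := comp_bounded (H := H) (ω := ω) (β := β) (Q := Q) (ρ := ρ) (M := M) hZ hZU S.matHol_Ω
  have key := ((((h₁.transpose).mul_bounded hΩ).mul_bounded hb₂).add
    ((hb₁.transpose.mul_bounded hΩ).bounded_mul h₂)).add
    ((hb₁.transpose.bounded_mul (dΩ_errK_small hZ hZU)).mul_bounded hb₂)
  refine LocO.congr (fun T θ hθ => ?_) (key a b)
  have hlie := lieMat_pull_Ω H ω T.lam_mem_Par T.K_hol T.K_mem_U (hV₁ T).matHol (hV₂ T).matHol hθ
  have e1 : -fderiv ℂ (fun η => pull S.Ω T.K (V₁ T) (V₂ T) η a b) θ (complexify ω) =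
    lieMat ω (pull S.Ω T.K (V₁ T) (V₂ T)) θ a b := rfl
  have e2 : (D₁ T a + D₂ T b) * pull S.Ω T.K (V₁ T) (V₂ T) θ a b =
      (Matrix.diagonal (D₁ T) * pull S.Ω T.K (V₁ T) (V₂ T) θ +
        pull S.Ω T.K (V₁ T) (V₂ T) θ * Matrix.diagonal (D₂ T)) a b := by
    rw [Matrix.add_apply, Matrix.diagonal_mul, Matrix.mul_diagonal]; ring
  rw [e1, e2, hlie, ← Matrix.sub_apply]
  refine congrFun (congrFun ?_ a) b
  simp only [pull, Matrix.transpose_sub, Matrix.transpose_mul, Matrix.diagonal_transpose,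
    Matrix.sub_mul, Matrix.mul_sub, Matrix.mul_assoc]
  abel

/-- Division by `μ`, which stays uniformly away from zero, makes the average `c` small, and with it
`u`. -/
lemma small_of_average {u : ApproxTorus H ω β Z Q ρ M → (Fin d → ℂ) → ℂ}
    {μ : ApproxTorus H ω β Z Q ρ M → ℂ} {c : ApproxTorus H ω β Z Q ρ M → ℂ} {δ : ℝ} (hδ : 0 < δ)
    (hμ : ∀ T, δ ≤ ‖μ T‖) (h : LocO (d := d) err ρ err (fun T _ => μ T * c T))
    (hu : LocO err ρ err fun T θ => u T θ - c T) : LocO err ρ err u := by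
  have hc : LocO (d := d) err ρ err fun T _ => c T := by
    have hinv : LocO (d := d) (ApproxTorus.err (H := H) (ω := ω) (β := β) (Z := Z) (Q := Q) (ρ := ρ)
        (M := M)) ρ (fun _ => 1) fun T _ => (μ T)⁻¹ :=
      LocO.of_bound (inv_nonneg.2 hδ.le) fun T θ _ => by
        rw [norm_inv, mul_one]; exact inv_anti₀ hδ (hμ T)
    refine LocO.congr (fun T θ _ => ?_) (hinv.mul h fun T => one_mul _)
    rw [inv_mul_cancel_left₀ (norm_pos_iff.1 (hδ.trans_le (hμ T)))]
  exact LocO.congr (fun T θ _ => by ring) (hu.add hc)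

variable {γ τ : ℝ}

/-- The approximately invariant torus is approximately isotropic. -/
lemma pull_Ω_LL_small (hDM : DiophantineMelnikov γ τ ω β) (hρ : 0 < ρ) (hZ : IsCompact Z)
    (hZU : Z ⊆ S.U) : Small H ω β Z Q ρ M fun T => pull S.Ω T.K T.L T.L := by
  intro a b
  have h1 := pull_Ω_equation (M := M) (Q := Q) (ρ := ρ) (H := H) (ω := ω) (β := β) hZ hZU
    (fun T => T.L_per) (fun T => T.L_per) (L_bounded hZ) (L_bounded hZ) linOp_L_small' linOp_L_small' a b
  have h2 := (LocO.small_divisor (γ := γ) (τ := τ) hDM.γ_pos hρ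
    (fun T => T.pull_Ω_per T.L_per T.L_per a b)
    (fun T k hk => by simpa using hDM.divisor_zero hk) h1).2
  refine LocO.congr (fun T θ _ => ?_) h2
  have h0 : (0 : Fin d → ℂ) ∈ strip d ρ := by simpa [strip] using fun _ => hρ
  -- Here `μ = 0` gives no control of the average; instead it vanishes, because the entry is a
  -- combination of derivatives of periodic functions.
  have havg : fourierAt (fun η => pull S.Ω T.K T.L T.L η a b) 0 0 = 0 := by
    rw [fourierAt_congr h0 (fun η hη => show pull S.Ω T.K T.L T.L η a b =
      fderiv ℂ (pullPrimitive S T.K b) η (Pi.single a 1) +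
        (-1) * fderiv ℂ (pullPrimitive S T.K a) η (Pi.single b 1) from
        (pull_Ω_jacobian T.K_hol T.K_mem_U hη a b).trans (by ring)),
      fourierAt_add ((T.pullPrimitive_per b).fderiv_apply _)
        ((IsStripPeriodic.const _).mul ((T.pullPrimitive_per a).fderiv_apply _)) 0 h0,
      fourierAt_const_mul, fourierAt_fderiv_zero (T.pullPrimitive_per b) hρ,
      fourierAt_fderiv_zero (T.pullPrimitive_per a) hρ]
    simp
  rw [havg, sub_zero]

lemma im_gamEig (α β : Fin m → ℝ) (a : Fin m ⊕ Fin m) : (gamEig α β a).im = signedFreq β a := by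
  simp [gamEig]

/-- The eigenvalue has imaginary part `±β_i ≠ 0` independently of `α`, so the average is controlled
before anything is known about `α`. -/
lemma pull_Ω_LV_small (hDM : DiophantineMelnikov γ τ ω β) (hρ : 0 < ρ) (hZ : IsCompact Z)
    (hZU : Z ⊆ S.U) (hM : 0 ≤ M) : Small H ω β Z Q ρ M fun T => pull S.Ω T.K T.L T.V := by
  intro a b
  have h1 := pull_Ω_equation (M := M) (Q := Q) (ρ := ρ) (H := H) (ω := ω) (β := β) hZ hZU
    (fun T => T.L_per) (fun T => T.V_per) (L_bounded hZ) (V_bounded hM) linOp_L_small' linOp_V_small a b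
  have h2 := LocO.small_divisor (γ := γ) (τ := τ) hDM.γ_pos hρ
    (fun T => T.pull_Ω_per T.L_per T.V_per a b)
    (fun T k hk => by simpa [im_gamEig] using hDM.divisor_first hk b) h1
  refine small_of_average (abs_pos.2 (hDM.signedFreq_ne b)) (fun T => ?_) h2.1 h2.2
  refine le_trans (le_of_eq ?_) (Complex.abs_im_le_norm _)
  simp [im_gamEig]

/-- The normal bundle is approximately symplectically orthogonal to the torus. -/
lemma pull_Ω_LW_small (hDM : DiophantineMelnikov γ τ ω β) (hρ : 0 < ρ) (hZ : IsCompact Z)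
    (hZU : Z ⊆ S.U) (hM : 0 ≤ M) : Small H ω β Z Q ρ M fun T => pull S.Ω T.K T.L T.W := by
  refine MatO.congr (fun T θ _ => ?_)
    ((pull_Ω_LV_small hDM hρ hZ hZU hM).mul_bounded (MatO.const (gamVecInv m)))
  simp only [pull, V, Matrix.mul_assoc, gamVec_mul_inv, Matrix.mul_one]

lemma pull_Ω_transpose {V₁ : (Fin d → ℂ) → Matrix (Fin (2 * n)) κ₁ ℂ}
    {V₂ : (Fin d → ℂ) → Matrix (Fin (2 * n)) κ₂ ℂ} (K : (Fin d → ℂ) → (Fin (2 * n) → ℂ))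
    (θ : Fin d → ℂ) : (pull S.Ω K V₁ V₂ θ)ᵀ = -pull S.Ω K V₂ V₁ θ := by
  simp [pull, Matrix.transpose_mul, S.Ω_transpose, Matrix.mul_assoc]

/-- Distinct indices make the sum of the two signed frequencies nonzero, because `|β_i| ≠ |β_j|`. -/
lemma pull_Ω_VV_small (hDM : DiophantineMelnikov γ τ ω β) (hρ : 0 < ρ) (hZ : IsCompact Z)
    (hZU : Z ⊆ S.U) (hM : 0 ≤ M) {a b : Fin m ⊕ Fin m} (hab : freqIndex a ≠ freqIndex b) :
    LocO err ρ err fun (T : ApproxTorus H ω β Z Q ρ M) θ => pull S.Ω T.K T.V T.V θ a b := by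
  have h1 := pull_Ω_equation (M := M) (Q := Q) (ρ := ρ) (H := H) (ω := ω) (β := β) hZ hZU
    (fun T => T.V_per) (fun T => T.V_per) (V_bounded hM) (V_bounded hM) linOp_V_small linOp_V_small a b
  have h2 := LocO.small_divisor (γ := γ) (τ := τ) hDM.γ_pos hρ
    (fun T => T.pull_Ω_per T.V_per T.V_per a b)
    (fun T k hk => by simpa [im_gamEig] using hDM.divisor_second hk hab) h1
  refine small_of_average (abs_pos.2 (hDM.signedFreq_add_ne hab)) (fun T => ?_) h2.1 h2.2
  refine le_trans (le_of_eq ?_) (Complex.abs_im_le_norm _)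
  simp [im_gamEig]

/-- The exponents of the normal bundle are bounded by the error. -/
lemma α_small (hDM : DiophantineMelnikov γ τ ω β) (hρ : 0 < ρ) (hZ : IsCompact Z)
    (hZU : Z ⊆ S.U) (hM : 0 ≤ M) (j : Fin m) :
    LocO (d := d) err ρ err fun (T : ApproxTorus H ω β Z Q ρ M) _ => (T.α j : ℂ) := by
  -- A conjugate pair of eigenvectors: the eigenvalues add up to the real number `2α_j`, the
  -- divisors are the plain `k·ω`, and the outcome is `2α_j c = O(err)`.
  set p : Fin m ⊕ Fin m := Sum.inl j with hp
  set q : Fin m ⊕ Fin m := Sum.inr j with hq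
  have h1 := pull_Ω_equation (M := M) (Q := Q) (ρ := ρ) (H := H) (ω := ω) (β := β) hZ hZU
    (fun T => T.V_per) (fun T => T.V_per) (V_bounded hM) (V_bounded hM) linOp_V_small linOp_V_small p q
  have hsum : ∀ T : ApproxTorus H ω β Z Q ρ M, gamEig T.α β p + gamEig T.α β q = 2 * T.α j := by
    intro T
    simp only [hp, hq, gamEig, freqIndex, signedFreq, Sum.elim_inl, Sum.elim_inr, id]
    push_cast; ring
  simp only [hsum] at h1
  have h2 := LocO.small_divisor (γ := γ) (τ := τ) hDM.γ_pos hρ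
    (fun T => T.pull_Ω_per T.V_per T.V_per p q)
    (fun T k hk => by simpa using hDM.divisor_zero hk) h1
  set c : ApproxTorus H ω β Z Q ρ M → ℂ := fun T =>
    fourierAt (fun η => pull S.Ω T.K T.V T.V η p q) 0 0 with hc
  -- The bounded inverse of `Ω_VV`.
  set F : ApproxTorus H ω β Z Q ρ M → (Fin d → ℂ) → Matrix (Fin m ⊕ Fin m) (Fin m ⊕ Fin m) ℂ :=
    fun T θ => gamVecInv m * (pull S.Ω T.K T.W T.W θ)⁻¹ * (gamVecInv m)ᵀ with hF
  have hFb : Bdd H ω β Z Q ρ M F :=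
    ((MatO.const _).mul_bounded (inv_ΩWW_bounded hM)).mul_bounded (MatO.const _)
  have hmul : ∀ T : ApproxTorus H ω β Z Q ρ M, ∀ θ ∈ strip d ρ, pull S.Ω T.K T.V T.V θ * F T θ = 1 := by
    intro T θ hθ
    have hinv := Matrix.mul_nonsing_inv _ ((Matrix.isUnit_iff_isUnit_det _).1 (T.isUnit_ΩWW θ hθ))
    have e : pull S.Ω T.K T.V T.V θ = (gamVec m)ᵀ * pull S.Ω T.K T.W T.W θ * gamVec m := by
      simp only [pull, V, Matrix.transpose_mul, Matrix.mul_assoc]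
    have ht : (gamVec m)ᵀ * (gamVecInv m)ᵀ = 1 := by
      rw [← Matrix.transpose_mul, mul_eq_one_comm.1 gamVec_mul_inv, Matrix.transpose_one]
    calc pull S.Ω T.K T.V T.V θ * F T θ
        = (gamVec m)ᵀ * (pull S.Ω T.K T.W T.W θ * ((gamVec m * gamVecInv m) *
            (pull S.Ω T.K T.W T.W θ)⁻¹)) * (gamVecInv m)ᵀ := by
          rw [e, hF]; simp only [Matrix.mul_assoc]
      _ = 1 := by rw [gamVec_mul_inv, Matrix.one_mul, hinv, Matrix.mul_one, ht]
  -- Row `p` of `Ω_VV` has zero diagonal entry by antisymmetry and small entries at foreign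
  -- frequencies, so the `(p, p)` entry of `Ω_VV F = 1` reads `c F_qp ≈ 1`.
  have hone : LocO (d := d) err ρ err fun (T : ApproxTorus H ω β Z Q ρ M) θ => 1 - c T * F T θ q p := by
    have hrest : LocO err ρ err fun (T : ApproxTorus H ω β Z Q ρ M) θ =>
        ∑ b ∈ Finset.univ.erase q, pull S.Ω T.K T.V T.V θ p b * F T θ b p := by
      refine LocO.sum _ fun b hb => ?_
      by_cases hbp : b = p
      · refine LocO.congr (fun T θ _ => ?_) LocO.zero
        have h0 := congrFun (congrFun (pull_Ω_transpose (S := S) (V₁ := T.V) (V₂ := T.V) T.K θ) p) p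
        rw [Matrix.transpose_apply, Matrix.neg_apply, self_eq_neg] at h0
        rw [hbp, h0, zero_mul]
      · have hidx : freqIndex p ≠ freqIndex b := by
          have hbq := Finset.ne_of_mem_erase hb
          rcases b with i | i
          · intro h; apply hbp
            simp only [hp, freqIndex, Sum.elim_inl, id] at h
            rw [hp, h]
          · intro h; apply hbq
            simp only [hp, freqIndex, Sum.elim_inl, Sum.elim_inr, id] at h
            rw [hq, h]
        exact (pull_Ω_VV_small hDM hρ hZ hZU hM hidx).mul (hFb b p) fun T => mul_one _
    refine LocO.congr (fun T θ hθ => ?_) ((h2.2.mul (hFb q p) fun T => mul_one _).add hrest)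
    have h3 := congrFun (congrFun (hmul T θ hθ) p) p
    rw [Matrix.mul_apply, Matrix.one_apply_eq, ← Finset.add_sum_erase _ _ (Finset.mem_univ q)] at h3
    rw [← h3]
    ring
  have hαc := h2.1.mul (hFb q p) fun T => mul_one _
  obtain ⟨C₁, hC₁, ε₁, hε₁, H₁⟩ := hαc (ρ / 2) (by linarith)
  obtain ⟨C₂, hC₂, ε₂, hε₂, H₂⟩ := hone (ρ / 2) (by linarith)
  refine LocO.of_bound_const (C := C₁) (ε := min (min ε₁ ε₂) (1 / (2 * (C₂ + 1)))) hC₁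
    (by positivity) fun T hT => ?_
  have h0 : (0 : Fin d → ℂ) ∈ strip d (ρ / 2) := by simpa [strip] using fun _ => hρ
  have k1 := H₁ T (hT.trans ((min_le_left _ _).trans (min_le_left _ _))) 0 h0
  have k2 := H₂ T (hT.trans ((min_le_left _ _).trans (min_le_right _ _))) 0 h0
  have k3 : C₂ * T.err ≤ 1 / 2 := by
    have := hT.trans (min_le_right _ _)
    rw [le_div_iff₀ (by positivity)] at this
    nlinarith [T.err_nonneg]
  -- There is no a priori bound on `α_j`, so the last term is absorbed: its factor `1 - c F_qp` is
  -- at most `1/2` for small error. All is evaluated at `θ = 0`, as `α_j` is constant.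
  have e : (2 * (T.α j : ℂ)) = 2 * (T.α j : ℂ) * c T * F T 0 q p +
      2 * (T.α j : ℂ) * (1 - c T * F T 0 q p) := by ring
  have k4 : ‖(2 * (T.α j : ℂ))‖ ≤ C₁ * T.err + ‖(2 * (T.α j : ℂ))‖ * (1 / 2) := by
    conv_lhs => rw [e]
    refine (norm_add_le _ _).trans (add_le_add k1 ?_)
    rw [norm_mul]
    exact mul_le_mul_of_nonneg_left (k2.trans k3) (norm_nonneg _)
  rw [norm_mul, Complex.norm_ofNat] at k4
  linarith

end ApproxTorus

/-! ### Approximate inversion of the frame -/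

section Blocks

variable {ι : Type*} {d : ℕ} {err w : ι → ℝ} {ρ : ℝ} {ν κ₁ κ₂ κ₃ μ₁ μ₂ μ₃ : Type} [Fintype ν]

lemma MatO.sub_blocks {X₁ : ι → (Fin d → ℂ) → Matrix κ₁ ν ℂ} {X₂ : ι → (Fin d → ℂ) → Matrix κ₂ ν ℂ}
    {X₃ : ι → (Fin d → ℂ) → Matrix κ₃ ν ℂ} {Y₁ : ι → (Fin d → ℂ) → Matrix ν μ₁ ℂ}
    {Y₂ : ι → (Fin d → ℂ) → Matrix ν μ₂ ℂ} {Y₃ : ι → (Fin d → ℂ) → Matrix ν μ₃ ℂ}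
    {D₁₁ : ι → (Fin d → ℂ) → Matrix κ₁ μ₁ ℂ} {D₁₂ : ι → (Fin d → ℂ) → Matrix κ₁ μ₂ ℂ}
    {D₁₃ : ι → (Fin d → ℂ) → Matrix κ₁ μ₃ ℂ} {D₂₁ : ι → (Fin d → ℂ) → Matrix κ₂ μ₁ ℂ}
    {D₂₂ : ι → (Fin d → ℂ) → Matrix κ₂ μ₂ ℂ} {D₂₃ : ι → (Fin d → ℂ) → Matrix κ₂ μ₃ ℂ}
    {D₃₁ : ι → (Fin d → ℂ) → Matrix κ₃ μ₁ ℂ} {D₃₂ : ι → (Fin d → ℂ) → Matrix κ₃ μ₂ ℂ}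
    {D₃₃ : ι → (Fin d → ℂ) → Matrix κ₃ μ₃ ℂ}
    (h₁₁ : MatO err ρ w fun i θ => X₁ i θ * Y₁ i θ - D₁₁ i θ)
    (h₁₂ : MatO err ρ w fun i θ => X₁ i θ * Y₂ i θ - D₁₂ i θ)
    (h₁₃ : MatO err ρ w fun i θ => X₁ i θ * Y₃ i θ - D₁₃ i θ)
    (h₂₁ : MatO err ρ w fun i θ => X₂ i θ * Y₁ i θ - D₂₁ i θ)
    (h₂₂ : MatO err ρ w fun i θ => X₂ i θ * Y₂ i θ - D₂₂ i θ)
    (h₂₃ : MatO err ρ w fun i θ => X₂ i θ * Y₃ i θ - D₂₃ i θ)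
    (h₃₁ : MatO err ρ w fun i θ => X₃ i θ * Y₁ i θ - D₃₁ i θ)
    (h₃₂ : MatO err ρ w fun i θ => X₃ i θ * Y₂ i θ - D₃₂ i θ)
    (h₃₃ : MatO err ρ w fun i θ => X₃ i θ * Y₃ i θ - D₃₃ i θ) :
    MatO err ρ w fun i θ =>
      Matrix.fromRows (X₁ i θ) (Matrix.fromRows (X₂ i θ) (X₃ i θ)) *
          Matrix.fromCols (Y₁ i θ) (Matrix.fromCols (Y₂ i θ) (Y₃ i θ)) -
        Matrix.fromBlocks (D₁₁ i θ) (Matrix.fromCols (D₁₂ i θ) (D₁₃ i θ))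
          (Matrix.fromRows (D₂₁ i θ) (D₃₁ i θ))
          (Matrix.fromBlocks (D₂₂ i θ) (D₂₃ i θ) (D₃₂ i θ) (D₃₃ i θ)) := by
  rintro (a | a | a) (b | b | b)
  exacts [h₁₁ a b, h₁₂ a b, h₁₃ a b, h₂₁ a b, h₂₂ a b, h₂₃ a b, h₃₁ a b, h₃₂ a b, h₃₃ a b]

end Blocks

section SmallPerturbation

variable {κ : Type} [Fintype κ] [DecidableEq κ]

/-- A small perturbation of the identity is invertible, with a bounded inverse. -/
lemma isUnit_one_add_of_entry_le {E : Matrix κ κ ℂ}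
    (h : ∀ a b, ‖E a b‖ ≤ 1 / (4 * (Fintype.card κ + 1))) :
    IsUnit (1 + E) ∧ ∀ a b, ‖(1 + E)⁻¹ a b‖ ≤ 2 := by
  set q : ℝ := 1 / (4 * (Fintype.card κ + 1)) with hq
  have hq0 : 0 ≤ q := by positivity
  have hq1 : Fintype.card κ * q ≤ 1 / 4 := by
    rw [hq, mul_one_div, div_le_div_iff₀ (by positivity) (by norm_num)]
    linarith
  have hq2 : q ≤ 1 / 4 := by
    rw [hq, div_le_div_iff₀ (by positivity) (by norm_num)]
    have : (0 : ℝ) ≤ Fintype.card κ := Nat.cast_nonneg _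
    linarith
  have hrow : ∀ a (s : Finset κ), ∑ b ∈ s, ‖E a b‖ ≤ 1 / 4 := by
    intro a s
    calc ∑ b ∈ s, ‖E a b‖ ≤ ∑ b, ‖E a b‖ :=
          Finset.sum_le_sum_of_subset_of_nonneg (Finset.subset_univ s) fun _ _ _ => norm_nonneg _
      _ ≤ ∑ _b : κ, q := Finset.sum_le_sum fun b _ => h a b
      _ ≤ 1 / 4 := by simpa using hq1
  -- Strict diagonal dominance by rows.
  have hdet : (1 + E).det ≠ 0 := by
    refine det_ne_zero_of_sum_row_lt_diag fun k => ?_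
    have h1 : ∑ j ∈ Finset.univ.erase k, ‖(1 + E) k j‖ = ∑ j ∈ Finset.univ.erase k, ‖E k j‖ := by
      refine Finset.sum_congr rfl fun j hj => ?_
      rw [Matrix.add_apply, Matrix.one_apply_ne (Finset.ne_of_mem_erase hj).symm, zero_add]
    rw [h1, Matrix.add_apply, Matrix.one_apply_eq]
    have h2 := norm_sub_le_norm_add (1 : ℂ) (E k k)
    rw [norm_one] at h2
    have := hrow k (Finset.univ.erase k)
    have := h k k
    linarith
  have hu : IsUnit (1 + E) := (Matrix.isUnit_iff_isUnit_det _).2 (isUnit_iff_ne_zero.2 hdet)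
  refine ⟨hu, fun a b => ?_⟩
  set X := (1 + E)⁻¹ with hX
  have hmul : (1 + E) * X = 1 := Matrix.mul_nonsing_inv _ ((Matrix.isUnit_iff_isUnit_det _).1 hu)
  -- At the largest entry `x` of a column of the inverse, `X = 1 - E X` gives `‖x‖ ≤ 1 + ‖x‖ / 4`.
  obtain ⟨c, -, hc⟩ := Finset.exists_max_image Finset.univ (fun a => ‖X a b‖) ⟨a, Finset.mem_univ a⟩
  refine (hc a (Finset.mem_univ a)).trans ?_
  have h1 : X c b = (1 : Matrix κ κ ℂ) c b - ∑ j, E c j * X j b := by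
    rw [← Matrix.mul_apply, ← Matrix.sub_apply, ← hmul, Matrix.add_mul, Matrix.one_mul,
      add_sub_cancel_right]
  have h2 : ‖∑ j, E c j * X j b‖ ≤ 1 / 4 * ‖X c b‖ := by
    refine (norm_sum_le _ _).trans ?_
    calc ∑ j, ‖E c j * X j b‖ ≤ ∑ j, ‖E c j‖ * ‖X c b‖ := Finset.sum_le_sum fun j hj => by
          rw [norm_mul]
          exact mul_le_mul_of_nonneg_left (hc j hj) (norm_nonneg _)
      _ = (∑ j, ‖E c j‖) * ‖X c b‖ := by rw [Finset.sum_mul]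
      _ ≤ 1 / 4 * ‖X c b‖ := mul_le_mul_of_nonneg_right (hrow c _) (norm_nonneg _)
  have h3 : ‖(1 : Matrix κ κ ℂ) c b‖ ≤ 1 := by
    rw [Matrix.one_apply]; split_ifs <;> simp
  have h4 : ‖X c b‖ ≤ 1 + 1 / 4 * ‖X c b‖ := by
    conv_lhs => rw [h1]
    exact (norm_sub_le _ _).trans (add_le_add h3 h2)
  linarith [norm_nonneg (X c b)]

end SmallPerturbation

namespace ApproxTorus

variable {d n m : ℕ} {S : SymplecticSetting n} {H : HamiltonianFamily S m} {ω : Fin d → ℝ}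
  {β : Fin m → ℝ} {Z : Set (Fin (2 * n) → ℂ)} {Q : Set (Fin m → ℝ)} {ρ M : ℝ} {κ κ₁ κ₂ : Type}
  {γ τ : ℝ}

lemma Ω_comp_bounded (hZ : IsCompact Z) (hZU : Z ⊆ S.U) :
    Bdd H ω β Z Q ρ M fun T θ => S.Ω (T.K θ) := comp_bounded hZ hZU S.matHol_Ω

section Frame

lemma small_WL (hDM : DiophantineMelnikov γ τ ω β) (hρ : 0 < ρ) (hZ : IsCompact Z) (hZU : Z ⊆ S.U)
    (hM : 0 ≤ M) : Small H ω β Z Q ρ M fun T => pull S.Ω T.K T.W T.L :=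
  MatO.congr (fun T θ _ => by rw [pull_Ω_transpose, neg_neg])
    (pull_Ω_LW_small hDM hρ hZ hZU hM).transpose.neg

lemma small_NL (hDM : DiophantineMelnikov γ τ ω β) (hρ : 0 < ρ) (hZ : IsCompact Z) (hZU : Z ⊆ S.U)
    (hM : 0 ≤ M) : Small H ω β Z Q ρ M fun T θ => pull S.Ω T.K T.N T.L θ - 1 :=
  MatO.congr (fun T _ hθ => sub_eq_of_eq_add' (T.frameRelations hρ hθ).ΩNL)
    (((A_bounded hZ hZU hM).transpose.bounded_mul (pull_Ω_LL_small hDM hρ hZ hZU)).add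
      ((C_bounded hZ hZU hM).transpose.bounded_mul (small_WL hDM hρ hZ hZU hM)))

lemma small_NW (hDM : DiophantineMelnikov γ τ ω β) (hρ : 0 < ρ) (hZ : IsCompact Z) (hZU : Z ⊆ S.U)
    (hM : 0 ≤ M) : Small H ω β Z Q ρ M fun T => pull S.Ω T.K T.N T.W :=
  MatO.congr (fun T _ hθ => (T.frameRelations hρ hθ).ΩNW)
    ((A_bounded hZ hZU hM).transpose.bounded_mul (pull_Ω_LW_small hDM hρ hZ hZU hM))

lemma small_NN (hDM : DiophantineMelnikov γ τ ω β) (hρ : 0 < ρ) (hZ : IsCompact Z) (hZU : Z ⊆ S.U)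
    (hM : 0 ≤ M) : Small H ω β Z Q ρ M fun T => pull S.Ω T.K T.N T.N :=
  have hA := A_bounded (H := H) (ω := ω) (β := β) (Q := Q) (ρ := ρ) hZ hZU hM
  have hC := C_bounded (H := H) (ω := ω) (β := β) (Q := Q) (ρ := ρ) hZ hZU hM
  have hB := B_bounded (H := H) (ω := ω) (β := β) (Z := Z) (Q := Q) (ρ := ρ) hM
  have hLL := pull_Ω_LL_small (H := H) (Q := Q) (M := M) hDM hρ hZ hZU
  MatO.congr (fun T _ hθ => (T.frameRelations hρ hθ).ΩNN)
    (((((hA.transpose.bounded_mul hLL).mul_bounded hA).add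
      ((hC.transpose.bounded_mul (small_WL hDM hρ hZ hZU hM)).mul_bounded hA)).add
      ((hB.transpose.bounded_mul hLL).mul_bounded hB)).add
      ((hA.transpose.bounded_mul (pull_Ω_LW_small hDM hρ hZ hZU hM)).mul_bounded hC))

lemma small_LN (hDM : DiophantineMelnikov γ τ ω β) (hρ : 0 < ρ) (hZ : IsCompact Z) (hZU : Z ⊆ S.U)
    (hM : 0 ≤ M) : Small H ω β Z Q ρ M fun T θ => pull S.Ω T.K T.L T.N θ + 1 :=
  MatO.congr (fun T θ _ => by
    rw [Matrix.transpose_sub, pull_Ω_transpose, Matrix.transpose_one]; abel)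
    (small_NL hDM hρ hZ hZU hM).transpose.neg

lemma small_WN (hDM : DiophantineMelnikov γ τ ω β) (hρ : 0 < ρ) (hZ : IsCompact Z) (hZU : Z ⊆ S.U)
    (hM : 0 ≤ M) : Small H ω β Z Q ρ M fun T => pull S.Ω T.K T.W T.N :=
  MatO.congr (fun T θ _ => by rw [pull_Ω_transpose, neg_neg])
    (small_NW hDM hρ hZ hZU hM).transpose.neg

/-! ### The linearized operator on the frame -/

lemma lieMat_add_const {k : ℕ} {η : Fin k → ℝ} (A : (Fin k → ℂ) → Matrix κ₁ κ₂ ℂ) (c : Matrix κ₁ κ₂ ℂ)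
    (θ : Fin k → ℂ) : lieMat η (fun z => A z + c) θ = lieMat η A θ := by
  ext r s
  simp [lieMat]

lemma Gam_sub (α β : Fin m → ℝ) : Gam α β - Gam 0 β =
    Matrix.fromBlocks (Matrix.diagonal (complexify α)) 0 0 (Matrix.diagonal (complexify α)) := by
  rw [sub_eq_iff_eq_add, Gam, Gam, Matrix.fromBlocks_add, complexify_zero]
  simp

lemma Gam_sub_small (hDM : DiophantineMelnikov γ τ ω β) (hρ : 0 < ρ) (hZ : IsCompact Z)
    (hZU : Z ⊆ S.U) (hM : 0 ≤ M) :
    Small H ω β Z Q ρ M fun T _ => Gam T.α β - Gam 0 β := by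
  have hdiag : Small H ω β Z Q ρ M fun T _ => Matrix.diagonal (complexify T.α) := by
    intro i j
    rcases eq_or_ne i j with rfl | hij
    · simpa [complexify] using α_small (d := d) (H := H) (Q := Q) hDM hρ hZ hZU hM i
    · simpa [hij] using LocO.zero
  have h0 : ∀ i j, LocO (d := d) err ρ err fun (_ : ApproxTorus H ω β Z Q ρ M) _ =>
    (0 : Matrix (Fin m) (Fin m) ℂ) i j := fun i j => LocO.zero
  simp only [Gam_sub]
  rintro (i | i) (j | j)
  exacts [hdiag i j, h0 i j, h0 i j, hdiag i j]

/-- Boundedness of `α` is not a hypothesis; it comes from `α_small`. -/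
lemma Gam_bounded (hDM : DiophantineMelnikov γ τ ω β) (hρ : 0 < ρ) (hZ : IsCompact Z)
    (hZU : Z ⊆ S.U) (hM : 0 ≤ M) : Bdd H ω β Z Q ρ M fun T _ => Gam T.α β :=
  MatO.congr (fun T θ _ => by abel)
    ((Gam_sub_small hDM hρ hZ hZU hM).toBounded.add (MatO.const (Gam 0 β)))

lemma linOp_W_eq (T : ApproxTorus H ω β Z Q ρ M) (θ : Fin d → ℂ) :
    linOp H ω T.K T.lam T.W θ = errW H ω β T.K T.W T.lam T.α θ + T.W θ * Gam T.α β := by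
  rw [errW, sub_add_cancel]

/-- Differentiating `Ω_LN + 1`, which is small: in the formula for its Lie derivative the term `Lᵀ Ω
𝒳_N` is the only one not already known to be small. -/
lemma small_L_linOp_N (hDM : DiophantineMelnikov γ τ ω β) (hρ : 0 < ρ) (hZ : IsCompact Z)
    (hZU : Z ⊆ S.U) (hM : 0 ≤ M) :
    Small H ω β Z Q ρ M fun T => pull S.Ω T.K T.L (linOp H ω T.K T.lam T.N) := by
  have h1 := (small_LN (H := H) (Q := Q) hDM hρ hZ hZU hM).lieMat (ω := ω) fun T =>
    (T.pull_hol S.matHol_Ω T.L_hol T.N_hol).add (MatHol.const 1)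
  have h2 := ((linOp_L_small (M := M) (H := H) (ω := ω) (β := β) (Z := Z) (Q := Q)
    (ρ := ρ)).transpose.mul_bounded (Ω_comp_bounded hZ hZU)).mul_bounded (N_bounded hZ hZU hM)
  have h3 := ((L_bounded (M := M) (H := H) (ω := ω) (β := β) (Q := Q)
    (ρ := ρ) hZ).transpose.bounded_mul (dΩ_errK_small hZ hZU)).mul_bounded (N_bounded hZ hZU hM)
  refine MatO.congr (fun T θ hθ => ?_) ((h1.sub h2).sub h3)
  rw [lieMat_add_const, lieMat_pull_Ω H ω T.lam_mem_Par T.K_hol T.K_mem_U T.L_hol T.N_hol hθ, pull]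
  abel

/-- As for `L`, with the extra term `Γᵀ Ω_WN`, a bounded matrix times a small one. -/
lemma small_W_linOp_N (hDM : DiophantineMelnikov γ τ ω β) (hρ : 0 < ρ) (hZ : IsCompact Z)
    (hZU : Z ⊆ S.U) (hM : 0 ≤ M) :
    Small H ω β Z Q ρ M fun T => pull S.Ω T.K T.W (linOp H ω T.K T.lam T.N) := by
  have h1 := (small_WN (H := H) (Q := Q) hDM hρ hZ hZU hM).lieMat (ω := ω) fun T =>
    T.pull_hol S.matHol_Ω T.W_hol T.N_hol
  have h2 := (((errW_small (M := M) (H := H) (ω := ω) (β := β) (Z := Z) (Q := Q)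
    (ρ := ρ)).transpose.mul_bounded (Ω_comp_bounded hZ hZU)).mul_bounded (N_bounded hZ hZU hM)).add
    ((Gam_bounded hDM hρ hZ hZU hM).transpose.bounded_mul (small_WN hDM hρ hZ hZU hM))
  have h3 := ((W_bounded (H := H) (ω := ω) (β := β) (Z := Z) (Q := Q)
    (ρ := ρ) hM).transpose.bounded_mul (dΩ_errK_small hZ hZU)).mul_bounded (N_bounded hZ hZU hM)
  refine MatO.congr (fun T θ hθ => ?_) ((h1.sub h2).sub h3)
  rw [lieMat_pull_Ω H ω T.lam_mem_Par T.K_hol T.K_mem_U T.W_hol T.N_hol hθ, linOp_W_eq]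
  simp only [pull, Matrix.transpose_add, Matrix.transpose_mul, Matrix.add_mul, Matrix.mul_assoc]
  abel

/-- An approximate left inverse of the frame. -/
def leftInv (T : ApproxTorus H ω β Z Q ρ M) (θ : Fin d → ℂ) :
    Matrix (Fin d ⊕ (Fin d ⊕ (Fin m ⊕ Fin m))) (Fin (2 * n)) ℂ :=
  Matrix.fromRows ((T.N θ)ᵀ * S.Ω (T.K θ)) (Matrix.fromRows (-((T.L θ)ᵀ * S.Ω (T.K θ)))
    ((pull S.Ω T.K T.W T.W θ)⁻¹ * ((T.W θ)ᵀ * S.Ω (T.K θ))))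

lemma one_eq_blocks : (1 : Matrix (Fin d ⊕ (Fin d ⊕ (Fin m ⊕ Fin m)))
    (Fin d ⊕ (Fin d ⊕ (Fin m ⊕ Fin m))) ℂ) =
    Matrix.fromBlocks 1 (Matrix.fromCols 0 0) (Matrix.fromRows 0 0) (Matrix.fromBlocks 1 0 0 1) := by
  rw [Matrix.fromBlocks_one, Matrix.fromCols_zero, Matrix.fromRows_zero, Matrix.fromBlocks_one]

lemma leftInv_mul_frame_small (hDM : DiophantineMelnikov γ τ ω β) (hρ : 0 < ρ) (hZ : IsCompact Z)
    (hZU : Z ⊆ S.U) (hM : 0 ≤ M) :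
    Small H ω β Z Q ρ M fun T θ => T.leftInv θ * frameP S T.K T.W θ - 1 := by
  have hi := inv_ΩWW_bounded (H := H) (ω := ω) (β := β) (Z := Z) (Q := Q) (ρ := ρ) hM
  have h₂₁ : Small H ω β Z Q ρ M fun T θ => -((T.L θ)ᵀ * S.Ω (T.K θ)) * T.L θ - 0 :=
    MatO.congr (fun T θ _ => by rw [sub_zero, Matrix.neg_mul]; rfl)
      (pull_Ω_LL_small hDM hρ hZ hZU).neg
  have h₂₂ : Small H ω β Z Q ρ M fun T θ => -((T.L θ)ᵀ * S.Ω (T.K θ)) * T.N θ - 1 :=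
    MatO.congr (fun T θ _ => by rw [Matrix.neg_mul, neg_add, pull, sub_eq_add_neg])
      (small_LN hDM hρ hZ hZU hM).neg
  have h₂₃ : Small H ω β Z Q ρ M fun T θ => -((T.L θ)ᵀ * S.Ω (T.K θ)) * T.W θ - 0 :=
    MatO.congr (fun T θ _ => by rw [sub_zero, Matrix.neg_mul]; rfl)
      (pull_Ω_LW_small hDM hρ hZ hZU hM).neg
  have h₃₁ : Small H ω β Z Q ρ M fun T θ =>
      (pull S.Ω T.K T.W T.W θ)⁻¹ * ((T.W θ)ᵀ * S.Ω (T.K θ)) * T.L θ - 0 :=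
    MatO.congr (fun T θ _ => by rw [sub_zero, Matrix.mul_assoc]; rfl)
      (hi.bounded_mul (small_WL hDM hρ hZ hZU hM))
  have h₃₂ : Small H ω β Z Q ρ M fun T θ =>
      (pull S.Ω T.K T.W T.W θ)⁻¹ * ((T.W θ)ᵀ * S.Ω (T.K θ)) * T.N θ - 0 :=
    MatO.congr (fun T θ _ => by rw [sub_zero, Matrix.mul_assoc]; rfl)
      (hi.bounded_mul (small_WN hDM hρ hZ hZU hM))
  have h₃₃ : Small H ω β Z Q ρ M fun T θ =>
      (pull S.Ω T.K T.W T.W θ)⁻¹ * ((T.W θ)ᵀ * S.Ω (T.K θ)) * T.W θ - 1 :=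
    MatO.congr (A := fun _ _ => 0) (fun T θ hθ => by
      rw [sub_eq_zero, Matrix.mul_assoc]
      exact Matrix.nonsing_inv_mul _ ((Matrix.isUnit_iff_isUnit_det _).1 (T.isUnit_ΩWW θ hθ)))
      fun _ _ => LocO.zero
  have h₁₂ : Small H ω β Z Q ρ M fun T θ => (T.N θ)ᵀ * S.Ω (T.K θ) * T.N θ - 0 :=
    MatO.congr (fun T θ _ => by rw [sub_zero]; rfl) (small_NN hDM hρ hZ hZU hM)
  have h₁₃ : Small H ω β Z Q ρ M fun T θ => (T.N θ)ᵀ * S.Ω (T.K θ) * T.W θ - 0 :=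
    MatO.congr (fun T θ _ => by rw [sub_zero]; rfl) (small_NW hDM hρ hZ hZU hM)
  have h₁₁ : Small H ω β Z Q ρ M fun T θ => (T.N θ)ᵀ * S.Ω (T.K θ) * T.L θ - 1 :=
    small_NL hDM hρ hZ hZU hM
  refine MatO.congr (fun T θ _ => ?_) (MatO.sub_blocks h₁₁ h₁₂ h₁₃ h₂₁ h₂₂ h₂₃ h₃₁ h₃₂ h₃₃)
  rw [one_eq_blocks]
  rfl

lemma linOp_frame (T : ApproxTorus H ω β Z Q ρ M) (θ : Fin d → ℂ) :
    linOp H ω T.K T.lam (frameP S T.K T.W) θ = Matrix.fromCols (linOp H ω T.K T.lam T.L θ)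
      (Matrix.fromCols (linOp H ω T.K T.lam T.N θ) (linOp H ω T.K T.lam T.W θ)) := by
  ext r (s | s | s) <;> rfl

lemma reducedMatrix_eq (T : ApproxTorus H ω β Z Q ρ M) (θ : Fin d → ℂ) :
    reducedMatrix H ω β T.K T.W T.lam θ =
      Matrix.fromBlocks 0 (Matrix.fromCols (pull S.Ω T.K T.N (linOp H ω T.K T.lam T.N) θ) 0)
        (Matrix.fromRows 0 0) (Matrix.fromBlocks 0 0 0 (Gam 0 β)) := by
  rw [Matrix.fromRows_zero]; rfl

lemma leftInv_mul_linOp_small (hDM : DiophantineMelnikov γ τ ω β) (hρ : 0 < ρ) (hZ : IsCompact Z)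
    (hZU : Z ⊆ S.U) (hM : 0 ≤ M) :
    Small H ω β Z Q ρ M fun T θ => T.leftInv θ * linOp H ω T.K T.lam (frameP S T.K T.W) θ -
      reducedMatrix H ω β T.K T.W T.lam θ := by
  have hi := inv_ΩWW_bounded (H := H) (ω := ω) (β := β) (Z := Z) (Q := Q) (ρ := ρ) hM
  have hΩ := Ω_comp_bounded (H := H) (ω := ω) (β := β) (Q := Q) (ρ := ρ) (M := M) hZ hZU
  have hNΩ := (N_bounded (H := H) (ω := ω) (β := β) (Q := Q) (ρ := ρ) hZ hZU hM).transpose.mul_bounded hΩ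
  have hLΩ := (L_bounded (H := H) (ω := ω) (β := β) (Q := Q) (ρ := ρ)
    (M := M) hZ).transpose.mul_bounded hΩ
  have hWΩ := (W_bounded (H := H) (ω := ω) (β := β) (Z := Z) (Q := Q) (ρ := ρ)
    hM).transpose.mul_bounded hΩ
  have hΓ := Gam_bounded (H := H) (Q := Q) hDM hρ hZ hZU hM
  have h₁₁ : Small H ω β Z Q ρ M fun T θ =>
      (T.N θ)ᵀ * S.Ω (T.K θ) * linOp H ω T.K T.lam T.L θ - 0 :=
    MatO.congr (fun T θ _ => by rw [sub_zero]) (hNΩ.bounded_mul linOp_L_small)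
  -- This block is the torsion itself, so its defect is exactly zero.
  have h₁₂ : Small H ω β Z Q ρ M fun T θ =>
      (T.N θ)ᵀ * S.Ω (T.K θ) * linOp H ω T.K T.lam T.N θ -
        pull S.Ω T.K T.N (linOp H ω T.K T.lam T.N) θ :=
    MatO.congr (A := fun _ _ => 0) (fun T θ _ => sub_self _) fun _ _ => LocO.zero
  have h₁₃ : Small H ω β Z Q ρ M fun T θ =>
      (T.N θ)ᵀ * S.Ω (T.K θ) * linOp H ω T.K T.lam T.W θ - 0 :=
    MatO.congr (fun T θ _ => by
      rw [sub_zero, linOp_W_eq, Matrix.mul_add, pull]; simp only [Matrix.mul_assoc])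
      ((hNΩ.bounded_mul errW_small).add ((small_NW hDM hρ hZ hZU hM).mul_bounded hΓ))
  have h₂₁ : Small H ω β Z Q ρ M fun T θ =>
      -((T.L θ)ᵀ * S.Ω (T.K θ)) * linOp H ω T.K T.lam T.L θ - 0 :=
    MatO.congr (fun T θ _ => by rw [sub_zero, Matrix.neg_mul]) (hLΩ.bounded_mul linOp_L_small).neg
  have h₂₂ : Small H ω β Z Q ρ M fun T θ =>
      -((T.L θ)ᵀ * S.Ω (T.K θ)) * linOp H ω T.K T.lam T.N θ - 0 :=
    MatO.congr (fun T θ _ => by rw [sub_zero, Matrix.neg_mul]; rfl)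
      (small_L_linOp_N hDM hρ hZ hZU hM).neg
  have h₂₃ : Small H ω β Z Q ρ M fun T θ =>
      -((T.L θ)ᵀ * S.Ω (T.K θ)) * linOp H ω T.K T.lam T.W θ - 0 :=
    MatO.congr (fun T θ _ => by
      rw [sub_zero, linOp_W_eq, Matrix.neg_mul, Matrix.mul_add, pull]; simp only [Matrix.mul_assoc])
      ((hLΩ.bounded_mul errW_small).add ((pull_Ω_LW_small hDM hρ hZ hZU hM).mul_bounded hΓ)).neg
  have h₃₁ : Small H ω β Z Q ρ M fun T θ => (pull S.Ω T.K T.W T.W θ)⁻¹ *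
      ((T.W θ)ᵀ * S.Ω (T.K θ)) * linOp H ω T.K T.lam T.L θ - 0 :=
    MatO.congr (fun T θ _ => by rw [sub_zero, Matrix.mul_assoc])
      (hi.bounded_mul (hWΩ.bounded_mul linOp_L_small))
  have h₃₂ : Small H ω β Z Q ρ M fun T θ => (pull S.Ω T.K T.W T.W θ)⁻¹ *
      ((T.W θ)ᵀ * S.Ω (T.K θ)) * linOp H ω T.K T.lam T.N θ - 0 :=
    MatO.congr (fun T θ _ => by rw [sub_zero, Matrix.mul_assoc]; rfl)
      (hi.bounded_mul (small_W_linOp_N hDM hρ hZ hZU hM))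
  have h₃₃ : Small H ω β Z Q ρ M fun T θ => (pull S.Ω T.K T.W T.W θ)⁻¹ *
      ((T.W θ)ᵀ * S.Ω (T.K θ)) * linOp H ω T.K T.lam T.W θ - Gam 0 β := by
    refine MatO.congr (fun T θ hθ => ?_)
      ((hi.bounded_mul (hWΩ.bounded_mul errW_small)).add (Gam_sub_small hDM hρ hZ hZU hM))
    have h := Matrix.nonsing_inv_mul _ ((Matrix.isUnit_iff_isUnit_det _).1 (T.isUnit_ΩWW θ hθ))
    have h' : (pull S.Ω T.K T.W T.W θ)⁻¹ * ((T.W θ)ᵀ * S.Ω (T.K θ)) * (T.W θ * Gam T.α β) =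
        Gam T.α β := by
      calc _ = (pull S.Ω T.K T.W T.W θ)⁻¹ * pull S.Ω T.K T.W T.W θ * Gam T.α β := by
            rw [pull]; simp only [Matrix.mul_assoc]
        _ = Gam T.α β := by rw [h, Matrix.one_mul]
    rw [linOp_W_eq, Matrix.mul_add, h', add_sub_assoc, Matrix.mul_assoc (pull S.Ω T.K T.W T.W θ)⁻¹]
  refine MatO.congr (fun T θ _ => ?_) (MatO.sub_blocks h₁₁ h₁₂ h₁₃ h₂₁ h₂₂ h₂₃ h₃₁ h₃₂ h₃₃)
  rw [linOp_frame, reducedMatrix_eq]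
  rfl

lemma reducedMatrix_bounded (hZ : IsCompact Z) (hZU : Z ⊆ S.U) (hQ : IsCompact Q) (hQP : Q ⊆ H.Par)
    (hM : 0 ≤ M) : Bdd H ω β Z Q ρ M fun T => reducedMatrix H ω β T.K T.W T.lam := by
  have hT := pull_bounded (H := H) (ω := ω) (β := β) (Q := Q) (ρ := ρ) hZ hZU S.matHol_Ω
    (N_bounded hZ hZU hM) (linOp_N_bounded hZ hZU hQ hQP hM)
  rintro (a | a | a) (b | b | b)
  exacts [LocO.const 0, hT a b, LocO.const 0, LocO.const 0, LocO.const 0, LocO.const 0,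
    LocO.const 0, LocO.const 0, LocO.const (Gam 0 β a b)]

/-- Approximate reducibility of the linearized dynamics. -/
theorem exists_reducibility_bound (hnm : n = d + m) (hDM : DiophantineMelnikov γ τ ω β) (hρ : 0 < ρ)
    (hZ : IsCompact Z) (hZU : Z ⊆ S.U) (hQ : IsCompact Q) (hQP : Q ⊆ H.Par) (hM : 0 ≤ M) {ρ' : ℝ}
    (hρ' : ρ' < ρ) :
    ∃ C, 0 ≤ C ∧ ∃ ε, 0 < ε ∧ ∀ T : ApproxTorus H ω β Z Q ρ M, T.err ≤ ε →
      ∃ Pinv : (Fin d → ℂ) → Matrix (Fin d ⊕ (Fin d ⊕ (Fin m ⊕ Fin m))) (Fin (2 * n)) ℂ,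
        ∀ θ ∈ strip d ρ', (frameP S T.K T.W θ * Pinv θ = 1 ∧ Pinv θ * frameP S T.K T.W θ = 1) ∧
          ∀ a b, ‖(Pinv θ * linOp H ω T.K T.lam (frameP S T.K T.W) θ -
            reducedMatrix H ω β T.K T.W T.lam θ) a b‖ ≤ C * T.err := by
  set I := Fin d ⊕ (Fin d ⊕ (Fin m ⊕ Fin m))
  have hE := leftInv_mul_frame_small (H := H) (Q := Q) hDM hρ hZ hZU hM
  -- With `Y` the approximate left inverse and `Y P = 1 + E`, one has `(1 + E)⁻¹ Y 𝒳_P - Λ = (1 +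
  -- E)⁻¹ (Y 𝒳_P - Λ - E Λ)`. The bracket is small since `Λ` is bounded.
  have hR := (leftInv_mul_linOp_small (H := H) (Q := Q) hDM hρ hZ hZU hM).sub
    (hE.mul_bounded (reducedMatrix_bounded hZ hZU hQ hQP hM))
  have herr : ∀ T : ApproxTorus H ω β Z Q ρ M, 0 ≤ T.err := fun T => T.err_nonneg
  obtain ⟨C₁, hC₁, ε₁, hε₁, H₁⟩ := hE.exists_bound herr hρ'
  obtain ⟨C₂, hC₂, ε₂, hε₂, H₂⟩ := hR.exists_bound herr hρ'
  set q : ℝ := 1 / (4 * (Fintype.card I + 1)) with hq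
  have hq0 : 0 < q := by positivity
  -- The constant is a row sum: entries of `(1 + E)⁻¹` are at most `2`, those of the bracket at most
  -- `C₂ * err`. The bound `q / (C₁ + 1)` forces the entries of `E` below the threshold `q`.
  refine ⟨Fintype.card I * (2 * C₂), by positivity, min (min ε₁ ε₂) (q / (C₁ + 1)), by positivity,
    fun T hT => ?_⟩
  set E : (Fin d → ℂ) → Matrix I I ℂ := fun θ => T.leftInv θ * frameP S T.K T.W θ - 1 with hEdef
  refine ⟨fun θ => (1 + E θ)⁻¹ * T.leftInv θ, fun θ hθ => ?_⟩
  have hE' : ∀ a b, ‖E θ a b‖ ≤ q := by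
    intro a b
    refine (H₁ T (hT.trans ((min_le_left _ _).trans (min_le_left _ _))) θ hθ a b).trans ?_
    have := hT.trans (min_le_right _ _)
    rw [le_div_iff₀ (by positivity)] at this
    nlinarith [T.err_nonneg]
  obtain ⟨hu, hX⟩ := isUnit_one_add_of_entry_le hE'
  have hinv := Matrix.nonsing_inv_mul _ ((Matrix.isUnit_iff_isUnit_det _).1 hu)
  have hYP : T.leftInv θ * frameP S T.K T.W θ = 1 + E θ := (add_sub_cancel _ _).symm
  have hleft : (1 + E θ)⁻¹ * T.leftInv θ * frameP S T.K T.W θ = 1 := by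
    rw [Matrix.mul_assoc, hYP, hinv]
  refine ⟨⟨?_, hleft⟩, fun a b => ?_⟩
  -- `P` is square because `2n = d + d + m + m`, so a left inverse is two-sided.
  · refine (Matrix.mul_eq_one_comm_of_card_eq _ _ _ ?_).1 hleft
    simp only [Fintype.card_sum, Fintype.card_fin]
    omega
  · have e : (1 + E θ)⁻¹ * T.leftInv θ * linOp H ω T.K T.lam (frameP S T.K T.W) θ -
        reducedMatrix H ω β T.K T.W T.lam θ = (1 + E θ)⁻¹ *
          (T.leftInv θ * linOp H ω T.K T.lam (frameP S T.K T.W) θ -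
            reducedMatrix H ω β T.K T.W T.lam θ - E θ * reducedMatrix H ω β T.K T.W T.lam θ) := by
      have h1 : (1 + E θ)⁻¹ * (reducedMatrix H ω β T.K T.W T.lam θ +
          E θ * reducedMatrix H ω β T.K T.W T.lam θ) = reducedMatrix H ω β T.K T.W T.lam θ := by
        conv_rhs => rw [← Matrix.one_mul (reducedMatrix H ω β T.K T.W T.lam θ), ← hinv]
        rw [Matrix.mul_assoc, Matrix.add_mul, Matrix.one_mul]
      rw [sub_sub, Matrix.mul_sub, h1, Matrix.mul_assoc]
    rw [e, Matrix.mul_apply]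
    refine (norm_sum_le _ _).trans ?_
    calc _ ≤ ∑ _c : I, 2 * (C₂ * T.err) := Finset.sum_le_sum fun c _ => by
          rw [norm_mul]
          exact mul_le_mul (hX a c)
            (H₂ T (hT.trans ((min_le_left _ _).trans (min_le_right _ _))) θ hθ c b)
            (norm_nonneg _) zero_le_two
      _ = Fintype.card I * (2 * C₂) * T.err := by
          simp only [Finset.sum_const, Finset.card_univ, nsmul_eq_mul]; ring

end Frame

end ApproxTorus

/-! ### The reducibility lemma -/

lemma norm_le_toReal_of_enorm_le {x : ℂ} {e : ℝ≥0∞} (he : e ≠ ⊤) (h : ‖x‖ₑ ≤ e) : ‖x‖ ≤ e.toReal := by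
  rw [← toReal_enorm]
  exact ENNReal.toReal_mono he h

lemma norm_le_of_stripMatrixNorm_le {d : ℕ} {κ κ' : Type} {ρ : ℝ}
    {f : (Fin d → ℂ) → Matrix κ κ' ℂ} {e : ℝ≥0∞} (he : e ≠ ⊤) (h : stripMatrixNorm ρ f ≤ e)
    {θ : Fin d → ℂ} (hθ : θ ∈ strip d ρ) (r : κ) (s : κ') : ‖f θ r s‖ ≤ e.toReal :=
  norm_le_toReal_of_enorm_le he (le_trans (le_iSup₂_of_le θ hθ
    (le_iSup_of_le r (le_iSup (fun s => ‖f θ r s‖ₑ) s))) h)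

lemma norm_le_of_stripNorm_le {d : ℕ} {κ : Type} {ρ : ℝ} {f : (Fin d → ℂ) → κ → ℂ} {e : ℝ≥0∞}
    (he : e ≠ ⊤) (h : stripNorm ρ f ≤ e) {θ : Fin d → ℂ} (hθ : θ ∈ strip d ρ) (r : κ) :
    ‖f θ r‖ ≤ e.toReal :=
  norm_le_toReal_of_enorm_le he (le_trans (le_iSup₂_of_le θ hθ (le_iSup (fun r => ‖f θ r‖ₑ) r)) h)

end EllipticTorus

end

theorem mainTheorem5 {d n : ℕ} (hdn : d < n)
    (S : SymplecticSetting n) (H : HamiltonianFamily S (n - d))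
    (ω : Fin d → ℝ) (β : Fin (n - d) → ℝ) (γ τ : ℝ) (hDM : DiophantineMelnikov γ τ ω β)
    (Z : Set (Fin (2 * n) → ℂ)) (hZ : IsCompact Z) (hZU : Z ⊆ S.U)
    (Q : Set (Fin (n - d) → ℝ)) (hQ : IsCompact Q) (hQP : Q ⊆ H.Par)
    (ρ ρ' : ℝ) (hρ' : 0 < ρ') (hρ : ρ' < ρ) (M : ℝ≥0) :
    ∃ ε : ℝ≥0, 0 < ε ∧ ∃ C : ℝ≥0,
      ∀ (K : (Fin d → ℂ) → (Fin (2 * n) → ℂ))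
        (W : (Fin d → ℂ) → Matrix (Fin (2 * n)) (Fin (n - d) ⊕ Fin (n - d)) ℂ)
        (lam α : Fin (n - d) → ℝ),
        (∀ r, IsTorusAnalytic ρ (fun θ => K θ r)) →
        (∀ r s, IsTorusAnalytic ρ (fun θ => W θ r s)) →
        (∀ θ ∈ strip d ρ, K θ ∈ Z) →
        lam ∈ Q →
        stripMatrixNorm ρ W ≤ M →
        (∀ θ ∈ strip d ρ, IsUnit (pull S.G K (jacobian K) (jacobian K) θ)) →
        (∀ θ ∈ strip d ρ, IsUnit (pull S.Ω K W W θ)) →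
        stripMatrixNorm ρ (fun θ => (pull S.G K (jacobian K) (jacobian K) θ)⁻¹) ≤ M →
        stripMatrixNorm ρ (fun θ => (pull S.Ω K W W θ)⁻¹) ≤ M →
        stripNorm ρ (errK H ω K lam) ≤ ε →
        stripMatrixNorm ρ (errW H ω β K W lam α) ≤ ε →
        ∃ Pinv : (Fin d → ℂ) →
            Matrix (Fin d ⊕ (Fin d ⊕ (Fin (n - d) ⊕ Fin (n - d)))) (Fin (2 * n)) ℂ,
          (∀ θ ∈ strip d ρ', frameP S K W θ * Pinv θ = 1 ∧ Pinv θ * frameP S K W θ = 1) ∧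
          stripMatrixNorm ρ' (fun θ =>
              Pinv θ * linOp H ω K lam (frameP S K W) θ - reducedMatrix H ω β K W lam θ)
            ≤ C * (stripNorm ρ (errK H ω K lam) + stripMatrixNorm ρ (errW H ω β K W lam α)) := by
  obtain ⟨C, hC, ε, hε, hmain⟩ := ApproxTorus.exists_reducibility_bound (H := H) (Z := Z) (Q := Q)
    (M := (M : ℝ)) (show n = d + (n - d) by omega) hDM (hρ'.trans hρ) hZ hZU hQ hQP M.2 hρ
  -- The two errors are each at most `ε / 2`, so their sum, which serves as the common bound `err`,
  -- is finite and at most `ε`.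
  refine ⟨(ε / 2).toNNReal, by simpa using hε, C.toNNReal, ?_⟩
  intro K W lam α hK hW hKZ hlam hWM hGu hΩu hGi hΩi hEK hEW
  set e : ℝ≥0∞ := stripNorm ρ (errK H ω K lam) + stripMatrixNorm ρ (errW H ω β K W lam α) with he
  have hele : e ≤ ENNReal.ofReal ε := by
    refine (add_le_add hEK hEW).trans (le_of_eq ?_)
    change ENNReal.ofReal (ε / 2) + ENNReal.ofReal (ε / 2) = _
    rw [← ENNReal.ofReal_add (by positivity) (by positivity), add_halves]
  have hetop : e ≠ ⊤ := ne_top_of_le_ne_top ENNReal.ofReal_ne_top hele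
  let T : ApproxTorus H ω β Z Q ρ (M : ℝ) :=
    { K := K
      W := W
      lam := lam
      α := α
      err := e.toReal
      K_analytic := hK
      W_analytic := hW
      K_mem := hKZ
      K_mem_U := fun θ hθ => hZU (hKZ θ hθ)
      lam_mem := hlam
      lam_mem_Par := hQP hlam
      err_nonneg := ENNReal.toReal_nonneg
      W_le := fun θ hθ r s => norm_le_of_stripMatrixNorm_le ENNReal.coe_ne_top hWM hθ r s
      isUnit_GLL := hGu
      isUnit_ΩWW := hΩu
      inv_GLL_le := fun θ hθ r s => norm_le_of_stripMatrixNorm_le ENNReal.coe_ne_top hGi hθ r s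
      inv_ΩWW_le := fun θ hθ r s => norm_le_of_stripMatrixNorm_le ENNReal.coe_ne_top hΩi hθ r s
      errK_le := fun θ hθ r => norm_le_of_stripNorm_le hetop le_self_add hθ r
      errW_le := fun θ hθ r s => norm_le_of_stripMatrixNorm_le hetop le_add_self hθ r s }
  obtain ⟨Pinv, hP⟩ := hmain T (ENNReal.toReal_le_of_le_ofReal hε.le hele)
  refine ⟨Pinv, fun θ hθ => (hP θ hθ).1, iSup₂_le fun θ hθ => iSup_le fun r => iSup_le fun s => ?_⟩
  have h := (hP θ hθ).2 r s
  rw [← ofReal_norm]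
  refine (ENNReal.ofReal_le_ofReal h).trans (le_of_eq ?_)
  change ENNReal.ofReal (C * e.toReal) = _
  rw [ENNReal.ofReal_mul hC, ENNReal.ofReal_toReal hetop]
  rfl
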